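/- \textbf{Setting.} Let $B_d=\{x\in\mathbb R^d:\|x\|_2\le 1\}$. A feasibility problem with accuracy $\epsilon>0$ in dimension $d$ consists of a convex set $Q\subset B_d$ that contains a Euclidean ball of radius $\epsilon$, together with separation oracles $\mathcal O_t:B_d\to\mathbb R^d\cup\{\mathsf{Success}\}$, $t\ge 0$, for $Q$: on a query $x\in Q$ the oracle returns $\mathsf{Success}$, and on a query $x\in B_d\setminus Q$ it returns a vector $g\in\mathbb R^d$ with $g^\top(x'-x)<0$ for all $x'\in Q$. The oracles may depend on the iteration $t$ and may be randomized, independently of the run of the algorithm. An $M$-bit randomized algorithm is given by query functions $\{0,1\}^M\to B_d$ and update functions $\{0,1\}^M\times B_d\times(\mathbb R^d\cup\{\mathsf{Success}\})\to\{0,1\}^M$, one of each for every iteration, which may also use fresh randomness at every iteration. It starts with the memory state $0$; at each iteration it queries the point given by its memory state, receives the response of the oracle and updates its memory state from the old state, the query and the response. With at most $T$ queries, it solves feasibility problems with accuracy $\epsilon$ with probability at least $\frac9{10}$ if, for every feasibility problem with accuracy $\epsilon$, one of its first $T$ queries lies in $Q$ with probability at least $\frac{9}{10}$. \textbf{Theorem.}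 (1) There are universal constants $c_6,C>0$ such that the following holds. Let $d\ge 2$ and $M\ge 1$ be integers and $\epsilon\in(0,\frac1{\sqrt d}]$ with $$d^{1/4}\ln^2 d\ \ge\ c_6\,\frac Md\,\ln^{3+1/4}\frac1\epsilon .$$ Then any $M$-bit randomized algorithm that solves feasibility problems with accuracy $\epsilon$ with probability at least $\frac9{10}$ makes at least $$\Big(\frac dM\Big)^2\frac1{\epsilon^{2\varphi(d,M,\epsilon)}}$$ queries, where $$\varphi(d,M,\epsilon)=1-4\,\frac{\ln\frac Md}{\ln d}-C\left(\frac{\ln\frac{\ln(1/\epsilon)}{\ln d}}{\ln d}+\frac{\ln\ln d}{\ln d}\right).$$ (2) For every function $a(d)\to0$ there is a function $b(d)\to0$ (as $d\to\infty$) such that for all sufficiently large $d$, all $\epsilon$ with $\frac1{\sqrt d}\ge\epsilon\ge e^{-d^{a(d)}}$ and all $\delta\in[0,\frac14]$: any randomized algorithm that uses at most $d^{1+\delta}$ bits of memory and solves feasibility problems with accuracy $\epsilon$ with probability at least $\frac9{10}$ makes at least $$\frac1{d^{2\delta}\,\epsilon^{2(1-4\delta)-b(d)}}$$ queries. -/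

import Mathlib

open MeasureTheory Filter Topology

noncomputable section

namespace Feasibility

/-- The query space: the closed Euclidean unit ball of `ℝᵈ`. -/
abbrev Ball (d : ℕ) : Type :=
  Metric.closedBall (0 : EuclideanSpace ℝ (Fin d)) 1

/-- The response space `ℝᵈ ∪ {Success}`. -/
abbrev Response (d : ℕ) : Type :=
  EuclideanSpace ℝ (Fin d) ⊕ Unit

/-- The response `Success`. -/
abbrev Response.success (d : ℕ) : Response d := Sum.inr ()

/-- The memory states of an `M`-bit algorithm. -/
abbrev Memory (M : ℕ) : Type := Fin M → Bool

/-- `O` is a separation oracle for `Q`: it answers `Success` only on points of `Q`, and any vector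
`g` that it returns on a query `x` satisfies `gᵀ (x' - x) < 0` for all `x' ∈ Q`.
(On a point `x` of a set `Q` the second clause fails for `x' = x`, so the answer is `Success`
exactly on the points of `Q`.) -/
def IsSeparationOracle {d : ℕ} (Q : Set (EuclideanSpace ℝ (Fin d)))
    (O : Ball d → Response d) : Prop :=
  ∀ x : Ball d,
    (O x = Response.success d → (x : EuclideanSpace ℝ (Fin d)) ∈ Q) ∧
    (∀ g : EuclideanSpace ℝ (Fin d), O x = Sum.inl g →
      ∀ x' ∈ Q, inner ℝ g (x' - (x : EuclideanSpace ℝ (Fin d))) < 0)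

/-- A feasibility problem with accuracy `ε` in dimension `d`: a convex subset `Q` of the unit ball
that contains a ball of radius `ε`, with a separation oracle for `Q`. The oracle may depend on the
iteration and may be randomized: all its randomness, over all iterations, is an element of the
probability space `Ω`, and it does not depend on the run of the algorithm. -/
structure Problem (d : ℕ) (ε : ℝ) where
  Q : Set (EuclideanSpace ℝ (Fin d))
  convex : Convex ℝ Q
  subset_ball : Q ⊆ Metric.closedBall 0 1
  contains_ball : ∃ c : EuclideanSpace ℝ (Fin d), Metric.closedBall c ε ⊆ Q
  Ω : Type
  [measurableSpace : MeasurableSpace Ω]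
  law : Measure Ω
  [isProbabilityMeasure : IsProbabilityMeasure law]
  oracle : ℕ → Ω → Ball d → Response d
  measurable_oracle : ∀ t, Measurable fun p : Ω × Ball d => oracle t p.1 p.2
  separates : ∀ t w, IsSeparationOracle Q (oracle t w)

attribute [instance] Problem.measurableSpace Problem.isProbabilityMeasure

/-- An `M`-bit memory-constrained randomized algorithm: for each iteration `t`, a query function and
an update function, both of which may use a random seed drawn afresh at iteration `t`
from the law `seedLaw t`. -/
structure Algorithm (d M : ℕ) where
  Seed : Type
  [measurableSpace : MeasurableSpace Seed]
  seedLaw : ℕ → Measure Seed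
  [isProbabilityMeasure : ∀ t, IsProbabilityMeasure (seedLaw t)]
  query : ℕ → Seed → Memory M → Ball d
  update : ℕ → Seed → Memory M → Ball d → Response d → Memory M
  measurable_query : ∀ t, Measurable fun p : Seed × Memory M => query t p.1 p.2
  measurable_update : ∀ t, Measurable fun p : Seed × Memory M × Ball d × Response d =>
    update t p.1 p.2.1 p.2.2.1 p.2.2.2

attribute [instance] Algorithm.measurableSpace Algorithm.isProbabilityMeasure

namespace Algorithm

variable {d M : ℕ}

/-- The memory state before iteration `t` (iterations are counted from `0`) when the algorithm runs
with the seeds `s` against the oracles `O`; the initial state is the all-zero string. -/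
def memory (A : Algorithm d M) (O : ℕ → Ball d → Response d) (s : ℕ → A.Seed) : ℕ → Memory M
  | 0 => fun _ => false
  | t + 1 =>
    A.update t (s t) (A.memory O s t) (A.query t (s t) (A.memory O s t))
      (O t (A.query t (s t) (A.memory O s t)))

/-- The query made at iteration `t`. -/
def queryAt (A : Algorithm d M) (O : ℕ → Ball d → Response d) (s : ℕ → A.Seed) (t : ℕ) : Ball d :=
  A.query t (s t) (A.memory O s t)

/-- The probability that one of the first `T` queries of the algorithm is a feasible point. The
seeds of the different iterations and the randomness of the oracle are all independent. -/
def successProb (A : Algorithm d M) {ε : ℝ} (F : Problem d ε) (T : ℕ) : ℝ :=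
  ((Measure.infinitePi A.seedLaw).prod F.law).real
    {p | ∃ t < T, (A.queryAt (fun n => F.oracle n p.2) p.1 t : EuclideanSpace ℝ (Fin d)) ∈ F.Q}

/-- With at most `T` queries, the algorithm solves every feasibility problem with accuracy `ε`
with probability at least `q`. -/
def Solves (A : Algorithm d M) (ε : ℝ) (T : ℕ) (q : ℝ) : Prop :=
  ∀ F : Problem d ε, q ≤ A.successProb F T

end Algorithm

/-- The exponent
`φ(d, M, ε) = 1 - 4 ln(M/d) / ln d - C (ln(ln(1/ε) / ln d) / ln d + ln ln d / ln d)`,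
where `C` is the constant of the `O(·)` term. -/
def phi (C : ℝ) (d M : ℕ) (ε : ℝ) : ℝ :=
  1 - 4 * (Real.log ((M : ℝ) / d) / Real.log d)
    - C * (Real.log (Real.log (1 / ε) / Real.log d) / Real.log d
        + Real.log (Real.log d) / Real.log d)

end Feasibility

end

/-! The bound comes from a random instance. Its feasible set consists of the points of the ball with
first coordinate at least 1/4 that are almost orthogonal to a family of Gaussian vectors, whose
number is a small fraction of `d`. The vectors are grouped in levels p = 0, …, P, with tolerances
proportional to δ p. These grow with p by factors of order √d, from about ε√d to a constant, so that
d^P D' is about ε⁻² up to constants to the power P; the top level lives in only D' coordinates,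
which tunes this product. At level p time is cut into epochs of length τ p = ∏_{q<p} N q, and each
epoch has `J p` tests. A test is a random section (one vector from each stratum); it rejects a query
whose mean truncated correlation with the section exceeds a threshold. The claim is that with high
probability no query among the first T = ∏ N p passes all tests, whereas every feasible point does.

Fresh tests are representative. A section that has not been used is independent of the queries made
so far, so by Hoeffding and a net its statistic is within α p of the mean over all vectors of the
level, uniformly near the span of up to `J p` queries (`sectionLaw_exists_deviation_le`). Thresholds
increase by 2 α p. Hence a query close to the span of the queries that used up the earlier tests,
and passing the latest of these tests, passes all later ones too: each new test is used up by a
query at distance at least η p from that span.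

Small memory forbids many good directions. During an epoch of level p + 1 the tests of level p use
at most half of the vectors in each stratum. For a fixed initial memory state the queries of the
epoch are independent of the other half, so the probability that J (p+1) robustly independent ones
have small mean at level p is at most exp(-2 J (p+1) l N J), with l, N, J taken at p
(`Params.measure_epoch_le`). This survives a union bound over the 2^M memory states.

`TestSystem.not_passes` combines the two by induction on the level: queries that pass the levels up
to p have small mean at level p, so an epoch has fewer than J (p+1) robustly independent ones, so
the tests of level p + 1 do not run out, so passing them means a small mean at level p + 1. At the
top a single such query is already excluded.

With κ about M/d, memory requires J of order κ, the net requires l of order J³, and the total number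
of vectors limits l N J to order d, all up to logarithms; thus N is about d/κ⁴. Since P is about 2
ln(1/ε)/ln d, this is the exponent in the theorem (`Params.exists_le_T_mul`). If M < d, a packing
argument gives the much stronger bound ε⁻¹⁴ (`Algorithm.Solves.pow_le`). -/

set_option linter.unusedSectionVars false

namespace Feasibility

open ProbabilityTheory
open scoped ENNReal

/-! ### Freezing and redrawing coordinates of a product measure -/

section Resampling

variable {ι : Type*} [Fintype ι] {α : ι → Type*} [∀ i, MeasurableSpace (α i)]

/-- Replace the coordinates of `ω` in `A` by those of `ω'`. -/
def resample (A : Set ι) [DecidablePred (· ∈ A)] (ω ω' : ∀ i, α i) : ∀ i, α i :=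
  fun i => if i ∈ A then ω' i else ω i

theorem measurable_resample (A : Set ι) [DecidablePred (· ∈ A)] :
    Measurable fun p : (∀ i, α i) × (∀ i, α i) => resample A p.1 p.2 := by
  refine measurable_pi_lambda _ fun i => ?_
  by_cases h : i ∈ A
  · simp only [resample, h, if_true]; fun_prop
  · simp only [resample, h, if_false]; fun_prop

theorem measurePreserving_resample (μ : ∀ i, Measure (α i)) [∀ i, IsProbabilityMeasure (μ i)]
    (A : Set ι) [DecidablePred (· ∈ A)] :
    MeasurePreserving (fun p : (∀ i, α i) × (∀ i, α i) => resample A p.1 p.2)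
      ((Measure.pi μ).prod (Measure.pi μ)) (Measure.pi μ) := by
  refine ⟨measurable_resample A, (Measure.pi_eq fun s hs => ?_).symm⟩
  rw [Measure.map_apply (measurable_resample A) (MeasurableSet.univ_pi hs)]
  have : (fun p : (∀ i, α i) × (∀ i, α i) => resample A p.1 p.2) ⁻¹' (Set.univ.pi s)
      = (Set.univ.pi fun i => if i ∈ A then Set.univ else s i) ×ˢ
        (Set.univ.pi fun i => if i ∈ A then s i else Set.univ) := by
    ext p
    simp only [Set.mem_preimage, Set.mem_pi, Set.mem_univ, true_implies, Set.mem_prod, resample]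
    constructor
    · intro h
      constructor <;> intro i <;> have := h i <;> split_ifs at * <;> simp_all
    · rintro ⟨h1, h2⟩ i
      have h1 := h1 i
      have h2 := h2 i
      split_ifs at * <;> simp_all
  rw [this, Measure.prod_prod, Measure.pi_pi, Measure.pi_pi, ← Finset.prod_mul_distrib]
  refine Finset.prod_congr rfl fun i _ => ?_
  split_ifs <;> simp

/-- Conditioning without conditional measures: the coordinates outside `A` are frozen and those in
`A` redrawn. In the applications the frozen part determines the queries, and `A` holds the vectors
or the section that these have not seen. -/
theorem measure_pi_le_of_resample (μ : ∀ i, Measure (α i)) [∀ i, IsProbabilityMeasure (μ i)]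
    (A : Set ι) [DecidablePred (· ∈ A)] {D : Set (∀ i, α i)} (hD : MeasurableSet D) {c : ℝ≥0∞}
    (h : ∀ ω, Measure.pi μ {ω' | resample A ω ω' ∈ D} ≤ c) : Measure.pi μ D ≤ c := by
  rw [← (measurePreserving_resample μ A).measure_preimage hD.nullMeasurableSet,
    Measure.prod_apply (measurable_resample A hD)]
  calc _ ≤ ∫⁻ _, c ∂(Measure.pi μ) := lintegral_mono fun ω => h ω
    _ = c := by simp

theorem lintegral_pi_prod (μ : ∀ i, Measure (α i)) [∀ i, IsProbabilityMeasure (μ i)]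
    (s : Finset ι) {f : ∀ i, α i → ℝ≥0∞} (hf : ∀ i, Measurable (f i)) :
    ∫⁻ ω, ∏ i ∈ s, f i (ω i) ∂(Measure.pi μ) = ∏ i ∈ s, ∫⁻ x, f i x ∂(μ i) := by
  rw [lintegral_prod_eq_prod_lintegral_of_indepFun s (fun i (ω : ∀ i, α i) => f i (ω i))
    (iIndepFun_pi fun i => (hf i).aemeasurable) fun i => (hf i).comp (measurable_pi_apply i)]
  refine Finset.prod_congr rfl fun i _ => ?_
  exact (measurePreserving_eval μ i).lintegral_comp (hf i)

end Resampling

/-! ### A Gaussian vector against robustly independent points -/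

section Gaussian

variable {E : Type*} [NormedAddCommGroup E] [InnerProductSpace ℝ E] [FiniteDimensional ℝ E]
  [MeasurableSpace E] [BorelSpace E]

/-- Resampling the component of a standard Gaussian vector along a unit vector. -/
theorem measurePreserving_resample_direction {v : E} (hv : ‖v‖ = 1) :
    MeasurePreserving (fun p : E × ℝ => p.1 + (p.2 - inner ℝ v p.1) • v)
      ((stdGaussian E).prod (gaussianReal 0 1)) (stdGaussian E) := by
  have hm : Measurable fun p : E × ℝ => p.1 + (p.2 - inner ℝ v p.1) • v := by fun_prop
  refine ⟨hm, Measure.ext_of_charFun ?_⟩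
  ext t
  rw [charFun_apply, integral_map hm.aemeasurable (by fun_prop), charFun_stdGaussian]
  have key : ∀ p : E × ℝ, Complex.exp (inner ℝ (p.1 + (p.2 - inner ℝ v p.1) • v) t * Complex.I)
      = Complex.exp (inner ℝ p.1 (t - inner ℝ v t • v) * Complex.I)
        * Complex.exp (inner ℝ p.2 (inner ℝ v t) * Complex.I) := by
    intro p
    rw [← Complex.exp_add, ← add_mul]
    congr 2
    norm_cast
    simp only [inner_add_left, inner_smul_left, inner_sub_right, inner_smul_right, map_sub,
      conj_trivial, RCLike.inner_apply, real_inner_comm v p.1]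
    ring
  simp_rw [key]
  rw [integral_prod_mul (f := fun x : E =>
    Complex.exp (inner ℝ x (t - inner ℝ v t • v) * Complex.I))
    (g := fun x : ℝ => Complex.exp (inner ℝ x (inner ℝ v t) * Complex.I)),
    ← charFun_apply, ← charFun_apply, charFun_stdGaussian, charFun_gaussianReal,
    ← Complex.exp_add]
  congr 1
  -- By Pythagoras, the part of the characteristic function lost along `v` is exactly the factor
  -- supplied by the fresh coordinate.
  have : ‖t - inner ℝ v t • v‖ ^ 2 = ‖t‖ ^ 2 - (inner ℝ v t) ^ 2 := by
    rw [← real_inner_self_eq_norm_sq, ← real_inner_self_eq_norm_sq]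
    simp only [inner_sub_left, inner_sub_right, inner_smul_left, inner_smul_right, conj_trivial,
      real_inner_self_eq_norm_sq, hv, real_inner_comm v t]
    ring
  have h2 : ((‖t - inner ℝ v t • v‖ : ℝ) : ℂ) ^ 2 = (‖t‖ : ℂ) ^ 2 - ((inner ℝ v t : ℝ) : ℂ) ^ 2 := by
    exact_mod_cast this
  rw [h2]
  simp
  ring

/-- The first `k` vectors of `y` are linearly independent with margin `η`: each one has distance at
least `η` from the span of its predecessors. -/
def Robust (η : ℝ) (k : ℕ) (y : ℕ → E) : Prop :=
  ∀ i < k, ∀ c : ℕ → ℝ, η ≤ ‖y i - ∑ j ∈ Finset.range i, c j • y j‖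

theorem isClosed_robust (η : ℝ) (k : ℕ) : IsClosed {y : ℕ → E | Robust η k y} := by
  simp only [Robust, Set.ofPred_forall]
  refine isClosed_iInter fun i => isClosed_iInter fun _ => isClosed_iInter fun c => ?_
  exact isClosed_le (by fun_prop) (by fun_prop)

/-- `v` is the component of `y k` orthogonal to its predecessors. Moving a Gaussian vector along `v`
changes its correlation with `y k` only, and at a rate controlled by `η`. -/
theorem Robust.exists_orthogonal {η : ℝ} {k : ℕ} {y : ℕ → E} (h : Robust η (k + 1) y) :
    ∃ v : E, (∀ i < k, inner ℝ (y i) v = 0) ∧ η ≤ ‖v‖ ∧ inner ℝ (y k) v = ‖v‖ ^ 2 := by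
  classical
  set V : Submodule ℝ E := Submodule.span ℝ (y '' (Finset.range k : Set ℕ)) with hV
  have hmem := Submodule.starProjection_apply_mem V (y k)
  obtain ⟨c, hc⟩ : ∃ c : ℕ → ℝ, ∑ j ∈ Finset.range k, c j • y j = V.starProjection (y k) := by
    obtain ⟨c, hc⟩ := (Submodule.mem_span_image_finset_iff_exists_fun ℝ).1 hmem
    refine ⟨fun j => if h : j ∈ Finset.range k then c ⟨j, h⟩ else 0, ?_⟩
    rw [← hc, ← Finset.sum_coe_sort]
    exact Finset.sum_congr rfl fun j _ => by simp
  refine ⟨y k - V.starProjection (y k), fun i hi => ?_, ?_, ?_⟩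
  · have := Submodule.sub_starProjection_mem_orthogonal (K := V) (y k)
    exact this (y i) (Submodule.subset_span ⟨i, by simpa using hi, rfl⟩)
  · rw [← hc]; exact h k (by omega) c
  · have h1 := Submodule.sub_starProjection_mem_orthogonal (K := V) (y k) _ hmem
    rw [← real_inner_self_eq_norm_sq]
    conv_rhs => rw [inner_sub_left, h1, sub_zero]

/-- Induction on `k`: redrawing `g` along the orthogonal component of the last point keeps the other
correlations and makes the last one Gaussian with standard deviation at least `η` around some
centre. Whatever the centre, `hρ` yields one factor `ρ`. -/
theorem lintegral_prod_inner_le {η : ℝ} (hη : 0 < η) {ψ : ℝ → ℝ≥0∞} (hψ : Measurable ψ) {ρ : ℝ≥0∞}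
    (hρ : ∀ s σ : ℝ, η ≤ σ → ∫⁻ z, ψ (s + σ * z) ∂(gaussianReal 0 1) ≤ ρ) (k : ℕ) (y : ℕ → E)
    (hy : Robust η k y) :
    ∫⁻ g, ∏ i ∈ Finset.range k, ψ (inner ℝ g (y i)) ∂(stdGaussian E) ≤ ρ ^ k := by
  induction k with
  | zero => simp
  | succ k ih =>
    obtain ⟨v, hv, hηv, hvk⟩ := hy.exists_orthogonal
    have hv0 : 0 < ‖v‖ := hη.trans_le hηv
    set w : E := ‖v‖⁻¹ • v with hw
    have hw1 : ‖w‖ = 1 := by rw [hw, norm_smul]; simp [hv0.ne']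
    have hwi : ∀ i < k, inner ℝ w (y i) = 0 := fun i hi => by
      rw [hw, inner_smul_left, real_inner_comm, hv i hi, mul_zero]
    have hwk : inner ℝ w (y k) = ‖v‖ := by
      rw [hw, inner_smul_left, real_inner_comm, hvk]
      simp only [map_inv₀, conj_trivial]
      field_simp
    have hmeas : Measurable fun g : E => ∏ i ∈ Finset.range (k + 1), ψ (inner ℝ g (y i)) :=
      Finset.measurable_prod _ fun i _ => hψ.comp (by fun_prop)
    have hmeas' := hmeas.comp (measurePreserving_resample_direction hw1).measurable
    rw [← (measurePreserving_resample_direction hw1).lintegral_comp hmeas,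
      lintegral_prod _ (by simpa [Function.comp_def] using hmeas'.aemeasurable)]
    have : ∀ g : E, ∫⁻ z, ∏ i ∈ Finset.range (k + 1),
        ψ (inner ℝ (g + (z - inner ℝ w g) • w) (y i)) ∂(gaussianReal 0 1)
        ≤ (∏ i ∈ Finset.range k, ψ (inner ℝ g (y i))) * ρ := by
      intro g
      have e : ∀ z : ℝ, ∏ i ∈ Finset.range (k + 1), ψ (inner ℝ (g + (z - inner ℝ w g) • w) (y i))
          = (∏ i ∈ Finset.range k, ψ (inner ℝ g (y i))) *
            ψ ((inner ℝ g (y k) - inner ℝ w g * ‖v‖) + ‖v‖ * z) := by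
        intro z
        rw [Finset.prod_range_succ]
        congr 1
        · refine Finset.prod_congr rfl fun i hi => ?_
          rw [inner_add_left, inner_smul_left, hwi i (Finset.mem_range.1 hi), mul_zero, add_zero]
        · rw [inner_add_left, inner_smul_left, hwk]
          congr 1
          simp only [conj_trivial]
          ring
      simp_rw [e]
      rw [lintegral_const_mul _ (by fun_prop)]
      gcongr
      exact hρ _ _ hηv
    calc _ ≤ ∫⁻ g, (∏ i ∈ Finset.range k, ψ (inner ℝ g (y i))) * ρ ∂(stdGaussian E) :=
          lintegral_mono fun g => this g
      _ = (∫⁻ g, ∏ i ∈ Finset.range k, ψ (inner ℝ g (y i)) ∂(stdGaussian E)) * ρ :=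
          lintegral_mul_const _ (Finset.measurable_prod _ fun i _ => hψ.comp (by fun_prop))
      _ ≤ ρ ^ k * ρ := by
          gcongr
          exact ih fun i hi => hy i (by omega)
      _ = ρ ^ (k + 1) := (pow_succ _ _).symm

/-- The event is an interval of length 2δ/σ, and the Gaussian density is at most 1/2 because √(2π) ≥
2. -/
theorem gaussianReal_abs_lt_le (s : ℝ) {σ δ : ℝ} (hσ : 0 < σ) :
    gaussianReal 0 1 {z | |s + σ * z| < δ} ≤ ENNReal.ofReal (δ / σ) := by
  have hsub : {z : ℝ | |s + σ * z| < δ} ⊆ Set.Ioo ((-δ - s) / σ) ((δ - s) / σ) := by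
    intro z hz
    rw [Set.mem_ofPred_eq, abs_lt] at hz
    constructor
    · rw [div_lt_iff₀ hσ]; linarith
    · rw [lt_div_iff₀ hσ]; linarith
  refine (measure_mono hsub).trans ?_
  rw [gaussianReal_apply 0 (by simp)]
  calc _ ≤ ∫⁻ _ in Set.Ioo ((-δ - s) / σ) ((δ - s) / σ), ENNReal.ofReal (1 / 2) := by
        refine lintegral_mono fun x => ?_
        rw [gaussianPDF]
        refine ENNReal.ofReal_le_ofReal ?_
        rw [gaussianPDFReal]
        have h2 : (2 : ℝ) ≤ √(2 * Real.pi * (1 : NNReal)) := by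
          rw [Real.le_sqrt (by norm_num)]
          · have := Real.pi_gt_three
            simp; linarith
          · positivity
        calc _ ≤ (√(2 * Real.pi * (1 : NNReal)))⁻¹ * 1 := by
              gcongr
              rw [Real.exp_le_one_iff]
              have : 0 ≤ (x - 0) ^ 2 / (2 * ((1 : NNReal) : ℝ)) := by positivity
              rw [neg_div]; linarith
          _ ≤ 1 / 2 := by
              rw [mul_one, one_div]
              exact inv_anti₀ (by norm_num) h2
    _ = ENNReal.ofReal (δ / σ) := by
        rw [setLIntegral_const, Real.volume_Ioo, ← ENNReal.ofReal_mul (by norm_num)]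
        congr 1
        field_simp
        ring

/-- The truncated absolute value at scale `δ`. -/
noncomputable def ramp (δ t : ℝ) : ℝ := min (|t| / δ) 1

theorem continuous_ramp (δ : ℝ) : Continuous (ramp δ) := by unfold ramp; fun_prop

theorem ramp_nonneg {δ : ℝ} (hδ : 0 ≤ δ) (t : ℝ) : 0 ≤ ramp δ t := by unfold ramp; positivity

theorem ramp_le_one (δ t : ℝ) : ramp δ t ≤ 1 := min_le_right _ _

theorem abs_ramp_sub_le {δ : ℝ} (hδ : 0 < δ) (s t : ℝ) : |ramp δ s - ramp δ t| ≤ |s - t| / δ := by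
  unfold ramp
  calc _ ≤ max |(|s| / δ - |t| / δ)| |(1 : ℝ) - 1| := abs_min_sub_min_le_max _ _ _ _
    _ ≤ |s - t| / δ := by
      rw [sub_self, abs_zero, ← sub_div, abs_div, abs_of_pos hδ]
      refine max_le ?_ (by positivity)
      exact div_le_div_of_nonneg_right (abs_abs_sub_abs_le s t) hδ.le

/-- Origin of the ratio 60: the argument of the ramp is below δ with probability at most 1/60, and
otherwise the integrand is e⁻⁴. Since e⁴ < 60 < e⁵, the sum is at most 2e⁻⁴ ≤ e⁻³. -/
theorem lintegral_exp_ramp_le {δ η : ℝ} (hδ : 0 < δ) (hη : 60 * δ ≤ η) (s σ : ℝ) (hσ : η ≤ σ) :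
    ∫⁻ z, ENNReal.ofReal (Real.exp (-4 * ramp δ (s + σ * z))) ∂(gaussianReal 0 1)
      ≤ ENNReal.ofReal (Real.exp (-3)) := by
  have hσ0 : 0 < σ := by linarith
  calc _ ≤ ∫⁻ z, (ENNReal.ofReal (Real.exp (-4)) +
        Set.indicator {z | |s + σ * z| < δ} 1 z) ∂(gaussianReal 0 1) := by
        refine lintegral_mono fun z => ?_
        by_cases h : |s + σ * z| < δ
        · refine le_add_left ?_
          simp only [Set.indicator, Set.mem_ofPred_eq, h, if_true, Pi.one_apply]
          rw [ENNReal.ofReal_le_one, Real.exp_le_one_iff]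
          have := ramp_nonneg hδ.le (s + σ * z)
          linarith
        · refine le_add_right (ENNReal.ofReal_le_ofReal (Real.exp_le_exp.2 ?_))
          have : ramp δ (s + σ * z) = 1 := by
            unfold ramp
            rw [min_eq_right]
            rw [le_div_iff₀ hδ]; linarith
          rw [this]; norm_num
    _ = ENNReal.ofReal (Real.exp (-4)) + gaussianReal 0 1 {z | |s + σ * z| < δ} := by
        have hm : MeasurableSet {z : ℝ | |s + σ * z| < δ} :=
          measurableSet_lt (by fun_prop) (by fun_prop)
        rw [lintegral_add_left measurable_const, lintegral_const, measure_univ, mul_one,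
          lintegral_indicator_one hm]
    _ ≤ ENNReal.ofReal (Real.exp (-4)) + ENNReal.ofReal (1 / 60) := by
        gcongr
        refine (gaussianReal_abs_lt_le s hσ0).trans (ENNReal.ofReal_le_ofReal ?_)
        rw [div_le_div_iff₀ hσ0 (by norm_num)]; linarith
    _ ≤ ENNReal.ofReal (Real.exp (-3)) := by
        rw [← ENNReal.ofReal_add (Real.exp_pos _).le (by norm_num)]
        refine ENNReal.ofReal_le_ofReal ?_
        have h1 : Real.exp (-3) = Real.exp (-4) * Real.exp 1 := by rw [← Real.exp_add]; norm_num
        have h2 : (2.7 : ℝ) < Real.exp 1 := lt_trans (by norm_num) Real.exp_one_gt_d9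
        have h3 : Real.exp 1 < 2.7182818286 := Real.exp_one_lt_d9
        have h4 : Real.exp (-4) = ((Real.exp 1) ^ 4)⁻¹ := by
          rw [← Real.exp_nat_mul, ← Real.exp_neg]; norm_num
        have h5 : (1 / 60 : ℝ) ≤ Real.exp (-4) := by
          rw [h4, one_div]
          refine inv_anti₀ (by positivity) ?_
          calc Real.exp 1 ^ 4 ≤ 2.72 ^ 4 := by gcongr; linarith
            _ ≤ 60 := by norm_num
        nlinarith

end Gaussian

end Feasibility

namespace Feasibility

open ProbabilityTheory
open scoped ENNReal

/-! ### Norms of Gaussian sums -/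

section GaussianSums

/-- The projection of `ℝᵈ` onto the first `n` coordinates. -/
noncomputable def trunc {d : ℕ} (n : ℕ) :
    EuclideanSpace ℝ (Fin d) →L[ℝ] EuclideanSpace ℝ (Fin d) :=
  LinearMap.toContinuousLinearMap
    { toFun := fun x => WithLp.toLp 2 fun i => if (i : ℕ) < n then x i else 0
      map_add' := fun x y => by ext i; by_cases h : (i : ℕ) < n <;> simp [h]
      map_smul' := fun c x => by ext i; by_cases h : (i : ℕ) < n <;> simp [h] }

variable {d : ℕ}

theorem trunc_apply (n : ℕ) (x : EuclideanSpace ℝ (Fin d)) (i : Fin d) :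
    trunc n x i = if (i : ℕ) < n then x i else 0 := rfl

theorem trunc_of_le {n : ℕ} (h : d ≤ n) (x : EuclideanSpace ℝ (Fin d)) : trunc n x = x := by
  ext i
  rw [trunc_apply, if_pos (by omega)]

theorem inner_trunc_left (n : ℕ) (x y : EuclideanSpace ℝ (Fin d)) :
    inner ℝ (trunc n x) y = inner ℝ x (trunc n y) := by
  simp only [PiLp.inner_apply, trunc_apply]
  refine Finset.sum_congr rfl fun i _ => ?_
  split_ifs <;> simp

theorem lintegral_exp_sq_gaussianReal :
    ∫⁻ z, ENNReal.ofReal (Real.exp (z ^ 2 / 4)) ∂(gaussianReal 0 1) = ENNReal.ofReal √2 := by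
  rw [gaussianReal_of_var_ne_zero 0 (by simp), lintegral_withDensity_eq_lintegral_mul _
    (measurable_gaussianPDF 0 1) (by fun_prop)]
  have e : ∀ z : ℝ, (gaussianPDF 0 1 * fun z => ENNReal.ofReal (Real.exp (z ^ 2 / 4))) z
      = ENNReal.ofReal ((√(2 * Real.pi))⁻¹ * Real.exp (-(1 / 4) * z ^ 2)) := by
    intro z
    rw [Pi.mul_apply, gaussianPDF, ← ENNReal.ofReal_mul (gaussianPDFReal_nonneg _ _ _),
      gaussianPDFReal, mul_assoc, ← Real.exp_add]
    congr 3
    · simp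
    · simp; ring
  simp_rw [e]
  rw [← ofReal_integral_eq_lintegral_ofReal, integral_const_mul, integral_gaussian]
  · congr 1
    rw [← Real.sqrt_inv, ← Real.sqrt_mul (by positivity)]
    congr 1
    have := Real.pi_pos
    field_simp
    norm_num
  · exact (integrable_exp_neg_mul_sq (by norm_num)).const_mul _
  · exact ae_of_all _ fun z => by positivity

/-- Markov's inequality for exp(‖·‖²/4): its mean is a power of √2 with at most n factors, hence at
most e^{n/2}, against e^{4n} at the threshold. -/
theorem stdGaussian_norm_trunc_le (n : ℕ) :
    stdGaussian (EuclideanSpace ℝ (Fin d)) {g | 16 * (n : ℝ) ≤ ‖trunc n g‖ ^ 2}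
      ≤ ENNReal.ofReal (Real.exp (-3.5 * n)) := by
  set f : EuclideanSpace ℝ (Fin d) → ℝ≥0∞ := fun g =>
    ENNReal.ofReal (Real.exp (‖trunc n g‖ ^ 2 / 4)) with hf
  have hfm : Measurable f := by rw [hf]; fun_prop
  have h1 : ∫⁻ g, f g ∂(stdGaussian (EuclideanSpace ℝ (Fin d)))
      ≤ ENNReal.ofReal (Real.exp (n / 2)) := by
    rw [← map_pi_eq_stdGaussian, lintegral_map hfm (by fun_prop)]
    have e : ∀ x : Fin d → ℝ, f (WithLp.toLp 2 x)
        = ∏ i ∈ Finset.univ.filter (fun i : Fin d => (i : ℕ) < n),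
          ENNReal.ofReal (Real.exp (x i ^ 2 / 4)) := by
      intro x
      change ENNReal.ofReal (Real.exp (‖trunc n (WithLp.toLp 2 x)‖ ^ 2 / 4)) = _
      rw [← ENNReal.ofReal_prod_of_nonneg (fun i _ => (Real.exp_pos _).le), ← Real.exp_sum]
      congr 2
      rw [EuclideanSpace.norm_sq_eq, ← Finset.sum_div, Finset.sum_filter]
      congr 1
      refine Finset.sum_congr rfl fun i _ => ?_
      rw [trunc_apply]
      split_ifs <;> simp
    simp_rw [e]
    rw [lintegral_pi_prod _ _ (f := fun _ x => ENNReal.ofReal (Real.exp (x ^ 2 / 4)))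
      (fun i => by fun_prop)]
    simp_rw [lintegral_exp_sq_gaussianReal]
    rw [Finset.prod_const, ← ENNReal.ofReal_pow (by positivity)]
    refine ENNReal.ofReal_le_ofReal ?_
    have hs : √2 ≤ Real.exp (1 / 2) := by
      rw [Real.sqrt_le_left (Real.exp_pos _).le, ← Real.exp_nat_mul]
      have := Real.add_one_le_exp (1 : ℝ)
      norm_num
      linarith
    have hcard : (Finset.univ.filter (fun i : Fin d => (i : ℕ) < n)).card ≤ n := by
      calc _ = ((Finset.univ.filter (fun i : Fin d => (i : ℕ) < n)).map Fin.valEmbedding).card :=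
            (Finset.card_map _).symm
        _ ≤ (Finset.range n).card := Finset.card_le_card fun j hj => by
            simp only [Finset.mem_map, Finset.mem_filter, Finset.mem_univ, true_and] at hj
            obtain ⟨i, hi, rfl⟩ := hj
            simpa using hi
        _ = n := Finset.card_range n
    calc √2 ^ _ ≤ √2 ^ n := pow_le_pow_right₀ (by rw [Real.one_le_sqrt]; norm_num) hcard
      _ ≤ Real.exp (1 / 2) ^ n := by gcongr
      _ = Real.exp (n / 2) := by rw [← Real.exp_nat_mul]; congr 1; ring
  have hsub : {g : EuclideanSpace ℝ (Fin d) | 16 * (n : ℝ) ≤ ‖trunc n g‖ ^ 2}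
      ⊆ {g | ENNReal.ofReal (Real.exp (4 * n)) ≤ f g} := by
    intro g hg
    simp only [Set.mem_ofPred_eq] at hg
    exact ENNReal.ofReal_le_ofReal (Real.exp_le_exp.2 (by linarith))
  refine (measure_mono hsub).trans ?_
  refine (meas_ge_le_lintegral_div hfm.aemeasurable (by simp [Real.exp_pos])
    ENNReal.ofReal_ne_top).trans ?_
  refine (ENNReal.div_le_div_right h1 _).trans ?_
  rw [← ENNReal.ofReal_div_of_pos (Real.exp_pos _), ← Real.exp_sub]
  exact ENNReal.ofReal_le_ofReal (Real.exp_le_exp.2 (by linarith))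

variable {ι : Type*} [Fintype ι]

theorem measurePreserving_sum_smul {E : Type*} [NormedAddCommGroup E] [InnerProductSpace ℝ E]
    [FiniteDimensional ℝ E] [MeasurableSpace E] [BorelSpace E] (c : ι → ℝ)
    (hc : ∑ i, c i ^ 2 = 1) :
    MeasurePreserving (fun G : ι → E => ∑ i, c i • G i) (Measure.pi fun _ => stdGaussian E)
      (stdGaussian E) := by
  have hm : Measurable fun G : ι → E => ∑ i, c i • G i := by fun_prop
  refine ⟨hm, Measure.ext_of_charFun ?_⟩
  ext t
  rw [charFun_apply, integral_map hm.aemeasurable (by fun_prop), charFun_stdGaussian]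
  have key : ∀ G : ι → E, Complex.exp (inner ℝ (∑ i, c i • G i) t * Complex.I)
      = ∏ i, Complex.exp (inner ℝ (G i) (c i • t) * Complex.I) := by
    intro G
    rw [← Complex.exp_sum, ← Finset.sum_mul, sum_inner]
    push_cast
    simp only [inner_smul_left, inner_smul_right, conj_trivial]
  simp_rw [key]
  rw [integral_fintype_prod_eq_prod (fun i (x : E) =>
    Complex.exp (inner ℝ x (c i • t) * Complex.I))]
  simp_rw [← charFun_apply, charFun_stdGaussian]
  rw [← Complex.exp_sum]
  congr 1
  simp_rw [norm_smul, Complex.ofReal_mul, mul_pow, neg_div]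
  rw [Finset.sum_neg_distrib, ← Finset.sum_div, ← Finset.sum_mul]
  congr 2
  have : ∑ i, ((‖c i‖ : ℝ) : ℂ) ^ 2 = 1 := by
    rw [← Complex.ofReal_one, ← hc]
    push_cast
    refine Finset.sum_congr rfl fun i _ => ?_
    norm_cast
    simp
  rw [this, one_mul]

theorem measure_norm_trunc_sum_le (n : ℕ) (c : ι → ℝ) {s : ℝ} (hs : 0 < s)
    (hc : ∑ i, c i ^ 2 = s) :
    (Measure.pi fun _ : ι => stdGaussian (EuclideanSpace ℝ (Fin d)))
      {G | 4 * √(s * n) < ‖trunc n (∑ i, c i • G i)‖} ≤ ENNReal.ofReal (Real.exp (-3.5 * n)) := by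
  have hc' : ∑ i, (c i / √s) ^ 2 = 1 := by
    simp_rw [div_pow, Real.sq_sqrt hs.le]
    rw [← Finset.sum_div, hc, div_self hs.ne']
  have hset : MeasurableSet {g : EuclideanSpace ℝ (Fin d) | 16 * (n : ℝ) ≤ ‖trunc n g‖ ^ 2} :=
    measurableSet_le (by fun_prop) (by fun_prop)
  have := (measurePreserving_sum_smul (E := EuclideanSpace ℝ (Fin d)) _ hc').measure_preimage
    hset.nullMeasurableSet
  refine le_trans (measure_mono ?_) (this.le.trans (stdGaussian_norm_trunc_le n))
  intro G hG
  simp only [Set.mem_ofPred_eq, Set.mem_preimage] at hG ⊢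
  have e : ∑ i, (c i / √s) • G i = (√s)⁻¹ • ∑ i, c i • G i := by
    rw [Finset.smul_sum]
    refine Finset.sum_congr rfl fun i _ => ?_
    rw [smul_smul]; congr 1; ring
  rw [e, map_smul, norm_smul, mul_pow]
  have h1 : (4 * √(s * n)) ^ 2 ≤ ‖trunc n (∑ i, c i • G i)‖ ^ 2 :=
    pow_le_pow_left₀ (by positivity) hG.le 2
  rw [mul_pow, Real.sq_sqrt (by positivity)] at h1
  have h2 : ‖(√s)⁻¹‖ ^ 2 = s⁻¹ := by
    rw [norm_inv, inv_pow, Real.norm_of_nonneg (by positivity), Real.sq_sqrt hs.le]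
  rw [h2, ← div_eq_inv_mul, le_div_iff₀ hs]
  linarith

end GaussianSums

/-! ### Projections onto random subspaces -/

section RandomSubspace

variable {d : ℕ} {ι : Type*} [Fintype ι]

/-- The span of a fixed subspace and of finitely many truncated vectors. -/
noncomputable def truncSpan (V₀ : Submodule ℝ (EuclideanSpace ℝ (Fin d))) (s : Finset ι) (n : ℕ)
    (G : ι → EuclideanSpace ℝ (Fin d)) : Submodule ℝ (EuclideanSpace ℝ (Fin d)) :=
  V₀ ⊔ Submodule.span ℝ ((fun a => trunc n (G a)) '' (s : Set ι))

theorem mem_truncSpan {V₀ : Submodule ℝ (EuclideanSpace ℝ (Fin d))} {s : Finset ι} {n : ℕ}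
    {G : ι → EuclideanSpace ℝ (Fin d)} {x : EuclideanSpace ℝ (Fin d)} :
    x ∈ truncSpan V₀ s n G ↔ ∃ v ∈ V₀, ∃ c : ι → ℝ, v + ∑ a ∈ s, c a • trunc n (G a) = x := by
  classical
  rw [truncSpan, Submodule.mem_sup]
  refine exists_congr fun v => and_congr_right fun _ => ?_
  constructor
  · rintro ⟨z, hz, rfl⟩
    obtain ⟨c, hc⟩ := (Submodule.mem_span_image_finset_iff_exists_fun ℝ).1 hz
    refine ⟨fun j => if h : j ∈ s then c ⟨j, h⟩ else 0, ?_⟩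
    rw [← hc, ← Finset.sum_coe_sort]
    congr 1
    exact Finset.sum_congr rfl fun j _ => by simp
  · rintro ⟨c, hc⟩
    exact ⟨_, Submodule.sum_mem _ fun a ha => Submodule.smul_mem _ _
      (Submodule.subset_span ⟨a, ha, rfl⟩), hc⟩

theorem norm_sub_starProjection_le {E : Type*} [NormedAddCommGroup E] [InnerProductSpace ℝ E]
    (W : Submodule ℝ E) [W.HasOrthogonalProjection] (u : E) {w : E} (hw : w ∈ W) :
    ‖u - W.starProjection u‖ ≤ ‖u - w‖ := by
  rw [Submodule.starProjection_minimal]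
  exact ciInf_le (f := fun x : W => ‖u - x‖) ⟨0, by rintro _ ⟨x, rfl⟩; positivity⟩ ⟨w, hw⟩

theorem norm_sq_starProjection {E : Type*} [NormedAddCommGroup E] [InnerProductSpace ℝ E]
    (W : Submodule ℝ E) [W.HasOrthogonalProjection] (u : E) :
    ‖W.starProjection u‖ ^ 2 = ‖u‖ ^ 2 - ‖u - W.starProjection u‖ ^ 2 := by
  have h := Submodule.norm_sq_eq_add_norm_sq_starProjection u W
  have h2 : u - W.starProjection u = Wᗮ.starProjection u := by
    rw [sub_eq_iff_eq_add, add_comm, Submodule.starProjection_add_starProjection_orthogonal]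
  rw [h2]
  linarith

/-- The projection jumps where the dimension of the span drops, but the distance to the span is an
infimum of functions continuous in `G`, so its superlevel sets are closed. -/
theorem measurable_norm_sub_starProjection (V₀ : Submodule ℝ (EuclideanSpace ℝ (Fin d)))
    (s : Finset ι) (n : ℕ) (u : EuclideanSpace ℝ (Fin d)) :
    Measurable fun G : ι → EuclideanSpace ℝ (Fin d) =>
      ‖u - (truncSpan V₀ s n G).starProjection u‖ := by
  refine measurable_of_Ici fun c => IsClosed.measurableSet ?_
  have : (fun G : ι → EuclideanSpace ℝ (Fin d) =>
      ‖u - (truncSpan V₀ s n G).starProjection u‖) ⁻¹' Set.Ici c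
      = ⋂ v ∈ V₀, ⋂ k : ι → ℝ, {G | c ≤ ‖u - (v + ∑ a ∈ s, k a • trunc n (G a))‖} := by
    ext G
    simp only [Set.mem_preimage, Set.mem_Ici, Set.mem_iInter, Set.mem_ofPred_eq]
    constructor
    · intro h v hv k
      exact h.trans (norm_sub_starProjection_le _ _ (mem_truncSpan.2 ⟨v, hv, k, rfl⟩))
    · intro h
      obtain ⟨v, hv, k, hk⟩ := mem_truncSpan.1
        (Submodule.starProjection_apply_mem (truncSpan V₀ s n G) u)
      rw [← hk]
      exact h v hv k
  rw [this]
  refine isClosed_biInter fun v _ => isClosed_iInter fun k => ?_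
  exact isClosed_le (by fun_prop) (by fun_prop)

/-- A trace bound: the projections lie in `V₀ᗮ ⊓ W`, of dimension at most `s.card`. In an
orthonormal basis of that space the double sum is exchanged, and Bessel's inequality for `b` bounds
the share of each basis vector by 1. -/
theorem sum_norm_sq_starProjection_le {r : ℕ} (V₀ : Submodule ℝ (EuclideanSpace ℝ (Fin d)))
    (s : Finset ι) (n : ℕ) (G : ι → EuclideanSpace ℝ (Fin d))
    {b : Fin r → EuclideanSpace ℝ (Fin d)} (hb : Orthonormal ℝ b) (hb0 : ∀ i, b i ∈ V₀ᗮ) :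
    ∑ i, ‖(truncSpan V₀ s n G).starProjection (b i)‖ ^ 2 ≤ s.card := by
  classical
  set W := truncSpan V₀ s n G with hW
  have hle : V₀ ≤ W := le_sup_left
  set W' := V₀ᗮ ⊓ W with hW'
  have hdim : Module.finrank ℝ W' ≤ s.card := by
    have h1 := Submodule.finrank_add_inf_finrank_orthogonal hle
    have h2 : Module.finrank ℝ W ≤ Module.finrank ℝ V₀ + s.card := by
      refine (Submodule.finrank_add_le_finrank_add_finrank _ _).trans ?_
      gcongr
      have := finrank_span_finset_le_card (R := ℝ) (s.image fun a => trunc n (G a))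
      rw [Finset.coe_image] at this
      exact this.trans Finset.card_image_le
    rw [← hW'] at h1
    omega
  have hproj : ∀ i, W.starProjection (b i) ∈ W' := by
    intro i
    refine Submodule.mem_inf.2 ⟨fun v hv => ?_, Submodule.starProjection_apply_mem _ _⟩
    rw [← Submodule.inner_starProjection_left_eq_right,
      Submodule.starProjection_eq_self_iff.2 (hle hv)]
    exact hb0 i v hv
  let e := stdOrthonormalBasis ℝ W'
  have hn : ∀ i, ‖W.starProjection (b i)‖ ^ 2 = ∑ j, ‖inner ℝ (b i) (e j : EuclideanSpace ℝ (Fin d))‖ ^ 2 := by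
    intro i
    have := e.sum_sq_norm_inner_right ⟨W.starProjection (b i), hproj i⟩
    rw [Submodule.coe_norm] at this
    simp only at this
    rw [← this]
    refine Finset.sum_congr rfl fun j _ => ?_
    rw [Submodule.coe_inner, ← Submodule.inner_starProjection_left_eq_right,
      Submodule.starProjection_eq_self_iff.2 (Submodule.mem_inf.1 (e j).2).2, real_inner_comm]
  simp_rw [hn]
  rw [Finset.sum_comm]
  calc _ ≤ ∑ j : Fin (Module.finrank ℝ W'), (1 : ℝ) := by
        refine Finset.sum_le_sum fun j _ => ?_
        refine (hb.sum_inner_products_le _).trans ?_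
        have : ‖(e j : EuclideanSpace ℝ (Fin d))‖ = 1 := by
          rw [← Submodule.coe_norm]; exact e.orthonormal.1 j
        rw [this]; norm_num
    _ ≤ s.card := by simp; exact_mod_cast hdim

/-- The reflection that exchanges `u` and `w` fixes `V₀`, commutes with the truncation and preserves
the Gaussian law, so it carries the random subspace to an equally distributed one. -/
theorem lintegral_norm_sq_starProjection_eq (V₀ : Submodule ℝ (EuclideanSpace ℝ (Fin d)))
    (s : Finset ι) (n : ℕ) {u w : EuclideanSpace ℝ (Fin d)} (huw : ‖u‖ = ‖w‖) (hu : u ∈ V₀ᗮ)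
    (hw : w ∈ V₀ᗮ) (hu' : trunc n u = u) (hw' : trunc n w = w) :
    ∫⁻ G, ENNReal.ofReal (‖(truncSpan V₀ s n G).starProjection u‖ ^ 2)
        ∂(Measure.pi fun _ : ι => stdGaussian (EuclideanSpace ℝ (Fin d)))
      = ∫⁻ G, ENNReal.ofReal (‖(truncSpan V₀ s n G).starProjection w‖ ^ 2)
        ∂(Measure.pi fun _ : ι => stdGaussian (EuclideanSpace ℝ (Fin d))) := by
  set R := (Submodule.span ℝ {u - w})ᗮ.reflection with hR
  have hRu : R u = w := Submodule.reflection_sub huw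
  have hsub : ∀ x, ∃ c : ℝ, R x = x - c • (u - w) ∧ c = 2 * (inner ℝ (u - w) x / ‖u - w‖ ^ 2) := by
    intro x
    refine ⟨_, ?_, rfl⟩
    rw [hR, Submodule.reflection_orthogonal_apply, Submodule.reflection_singleton_apply, two_smul,
      two_mul, add_smul]
    simp
  have hRt : ∀ x, R (trunc n x) = trunc n (R x) := by
    intro x
    obtain ⟨c, h1, h2⟩ := hsub x
    obtain ⟨c', h1', h2'⟩ := hsub (trunc n x)
    have : c = c' := by
      rw [h2, h2', ← inner_trunc_left, map_sub, hu', hw']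
    rw [h1, h1', this, map_sub, map_smul, map_sub, hu', hw']
  have hRV : ∀ v ∈ V₀, R v = v := by
    intro v hv
    refine Submodule.reflection_mem_subspace_eq_self ?_
    rw [Submodule.mem_orthogonal_singleton_iff_inner_right, inner_sub_left, real_inner_comm,
      hu v hv, real_inner_comm, hw v hv, sub_zero]
  have hRR : ∀ x, R (R x) = x := fun x => Submodule.reflection_reflection _ x
  have hspan : ∀ G : ι → EuclideanSpace ℝ (Fin d),
      truncSpan V₀ s n (fun a => R (G a))
        = Submodule.map (R.toLinearEquiv : _ →ₗ[ℝ] _) (truncSpan V₀ s n G) := by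
    intro G
    rw [truncSpan, truncSpan, Submodule.map_sup, Submodule.map_span]
    congr 1
    · ext v
      simp only [Submodule.mem_map]
      constructor
      · intro hv; exact ⟨v, hv, hRV v hv⟩
      · rintro ⟨v', hv', rfl⟩
        have := hRV v' hv'
        simp only [LinearEquiv.coe_coe, LinearIsometryEquiv.coe_toLinearEquiv]
        rw [this]; exact hv'
    · congr 1
      rw [← Set.image_comp]
      refine Set.image_congr fun a _ => ?_
      simp [hRt]
  have hmp : MeasurePreserving (fun (G : ι → EuclideanSpace ℝ (Fin d)) a => R (G a))
      (Measure.pi fun _ : ι => stdGaussian (EuclideanSpace ℝ (Fin d)))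
      (Measure.pi fun _ : ι => stdGaussian (EuclideanSpace ℝ (Fin d))) := by
    refine measurePreserving_pi _ _ (f := fun _ x => R x) fun _ =>
      ⟨R.continuous.measurable, stdGaussian_map R⟩
  have hmeas : Measurable fun G : ι → EuclideanSpace ℝ (Fin d) =>
      ENNReal.ofReal (‖(truncSpan V₀ s n G).starProjection w‖ ^ 2) := by
    simp_rw [norm_sq_starProjection]
    have := measurable_norm_sub_starProjection V₀ s n w
    fun_prop
  rw [← hmp.lintegral_comp hmeas]
  refine lintegral_congr fun G => ?_
  rw [hspan, Submodule.starProjection_map_apply]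
  have : R.symm w = u := by rw [LinearIsometryEquiv.symm_apply_eq, hRu]
  rw [this, LinearIsometryEquiv.norm_map]

/-- By symmetry all the `b i` have the same mean squared projection, and these add up to at most
`s.card`; `u` is compared with the multiple of `b i` of equal norm. Markov's inequality concludes.
-/
theorem measure_norm_sq_starProjection_le {r : ℕ} (hr : 0 < r)
    (V₀ : Submodule ℝ (EuclideanSpace ℝ (Fin d)))
    (s : Finset ι) (n : ℕ) {b : Fin r → EuclideanSpace ℝ (Fin d)} (hb : Orthonormal ℝ b)
    (hb0 : ∀ i, b i ∈ V₀ᗮ) (hbn : ∀ i, trunc n (b i) = b i) {u : EuclideanSpace ℝ (Fin d)}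
    (hu1 : ‖u‖ ≤ 1) (hu : u ∈ V₀ᗮ) (hun : trunc n u = u) {c : ℝ} (hc : 0 < c) :
    (Measure.pi fun _ : ι => stdGaussian (EuclideanSpace ℝ (Fin d)))
      {G | c ≤ ‖(truncSpan V₀ s n G).starProjection u‖ ^ 2}
      ≤ ENNReal.ofReal (s.card / (r * c)) := by
  set μ := Measure.pi fun _ : ι => stdGaussian (EuclideanSpace ℝ (Fin d)) with hμ
  have hmeas : ∀ w, Measurable fun G : ι → EuclideanSpace ℝ (Fin d) =>
      ENNReal.ofReal (‖(truncSpan V₀ s n G).starProjection w‖ ^ 2) := by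
    intro w
    simp_rw [norm_sq_starProjection]
    have := measurable_norm_sub_starProjection V₀ s n w
    fun_prop
  have hI : ∀ i, ∫⁻ G, ENNReal.ofReal (‖(truncSpan V₀ s n G).starProjection u‖ ^ 2) ∂μ
      ≤ ∫⁻ G, ENNReal.ofReal (‖(truncSpan V₀ s n G).starProjection (b i)‖ ^ 2) ∂μ := by
    intro i
    rw [← lintegral_norm_sq_starProjection_eq V₀ s n (u := ‖u‖ • b i) (w := u)
      (by rw [norm_smul, hb.1 i]; simp) (Submodule.smul_mem _ _ (hb0 i)) hu
      (by rw [map_smul, hbn]) hun]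
    refine lintegral_mono fun G => ENNReal.ofReal_le_ofReal ?_
    rw [map_smul, norm_smul, norm_norm, mul_pow]
    have : ‖u‖ ^ 2 ≤ 1 := pow_le_one₀ (norm_nonneg _) hu1
    nlinarith [sq_nonneg ‖(truncSpan V₀ s n G).starProjection (b i)‖]
  have htot : (r : ℝ≥0∞) * ∫⁻ G, ENNReal.ofReal (‖(truncSpan V₀ s n G).starProjection u‖ ^ 2) ∂μ
      ≤ s.card := by
    calc _ = ∑ i : Fin r,
          ∫⁻ G, ENNReal.ofReal (‖(truncSpan V₀ s n G).starProjection u‖ ^ 2) ∂μ := by simp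
      _ ≤ ∑ i : Fin r,
          ∫⁻ G, ENNReal.ofReal (‖(truncSpan V₀ s n G).starProjection (b i)‖ ^ 2) ∂μ :=
          Finset.sum_le_sum fun i _ => hI i
      _ = ∫⁻ G, ∑ i : Fin r,
          ENNReal.ofReal (‖(truncSpan V₀ s n G).starProjection (b i)‖ ^ 2) ∂μ :=
          (lintegral_finsetSum _ fun i _ => hmeas _).symm
      _ ≤ ∫⁻ _, (s.card : ℝ≥0∞) ∂μ := by
          refine lintegral_mono fun G => ?_
          simp only
          rw [← ENNReal.ofReal_sum_of_nonneg fun i _ => by positivity, ← ENNReal.ofReal_natCast]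
          exact ENNReal.ofReal_le_ofReal (sum_norm_sq_starProjection_le V₀ s n G hb hb0)
      _ = s.card := by simp
  have hsub : {G : ι → EuclideanSpace ℝ (Fin d) |
        c ≤ ‖(truncSpan V₀ s n G).starProjection u‖ ^ 2}
      ⊆ {G | ENNReal.ofReal c ≤ ENNReal.ofReal (‖(truncSpan V₀ s n G).starProjection u‖ ^ 2)} :=
    fun G hG => ENNReal.ofReal_le_ofReal hG
  refine (measure_mono hsub).trans ?_
  refine (meas_ge_le_lintegral_div (hmeas u).aemeasurable (by simpa using hc)
    ENNReal.ofReal_ne_top).trans ?_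
  rw [ENNReal.div_le_iff (by simpa using hc) ENNReal.ofReal_ne_top,
    ← ENNReal.ofReal_mul (by positivity)]
  have hr' : (0 : ℝ) < r := by exact_mod_cast hr
  have e : (s.card : ℝ) / (r * c) * c = s.card / r := by field_simp
  rw [e, ENNReal.ofReal_div_of_pos hr', ENNReal.ofReal_natCast, ENNReal.ofReal_natCast,
    ENNReal.le_div_iff_mul_le (by simp [hr.ne']) (by simp), mul_comm]
  exact htot

end RandomSubspace

end Feasibility

namespace Feasibility

open ProbabilityTheory
open scoped ENNReal

/-! ### Nets in subspaces -/

section Nets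

variable {E : Type*} [NormedAddCommGroup E] [InnerProductSpace ℝ E] [FiniteDimensional ℝ E]

/-- Coordinates in an orthonormal basis are rounded to multiples of 1/q; an error of at most 1/q in
each of n coordinates has norm at most √n/q ≤ η. -/
theorem exists_net (V : Submodule ℝ E) {n q : ℕ} (hn : Module.finrank ℝ V ≤ n) {η : ℝ}
    (hq : √n ≤ η * q) (hq0 : 0 < q) :
    ∃ net : Finset E, net.card ≤ (2 * q + 1) ^ n ∧
      ∀ s ∈ V, ‖s‖ ≤ 1 → ∃ z ∈ net, ‖s - z‖ ≤ η := by
  classical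
  set r := Module.finrank ℝ V with hr
  let e := stdOrthonormalBasis ℝ V
  have hq' : (0 : ℝ) < q := by exact_mod_cast hq0
  let f : (Fin r → ℤ) → E := fun c => ((∑ i, ((c i : ℝ) / q) • e i : V) : E)
  refine ⟨(Fintype.piFinset fun _ : Fin r => Finset.Icc (-(q : ℤ)) q).image f, ?_, ?_⟩
  · refine Finset.card_image_le.trans ?_
    rw [Fintype.card_piFinset]
    simp only [Int.card_Icc, Finset.prod_const, Finset.card_univ, Fintype.card_fin]
    have : ((q : ℤ) + 1 - -(q : ℤ)).toNat = 2 * q + 1 := by omega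
    rw [this]
    exact Nat.pow_le_pow_right (by omega) hn
  · intro s hs hs1
    set c : Fin r → ℤ := fun i => round (inner ℝ (e i) ⟨s, hs⟩ * q) with hc
    have hcoord : ∀ i, |inner ℝ (e i) (⟨s, hs⟩ : V)| ≤ 1 := fun i => by
      refine (abs_real_inner_le_norm _ _).trans ?_
      rw [e.orthonormal.1 i, one_mul, Submodule.coe_norm]
      exact hs1
    refine ⟨f c, Finset.mem_image_of_mem _ (Fintype.mem_piFinset.2 fun i => ?_), ?_⟩
    · have h1 := abs_le.1 (hcoord i)
      have h2 : -(q : ℝ) ≤ inner ℝ (e i) (⟨s, hs⟩ : V) * q := by nlinarith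
      have h3 : inner ℝ (e i) (⟨s, hs⟩ : V) * q ≤ q := by nlinarith
      have h4 := abs_le.1 (abs_sub_round (inner ℝ (e i) (⟨s, hs⟩ : V) * q))
      rw [Finset.mem_Icc]
      constructor
      · have : (-(q : ℝ)) - 1 < c i := by rw [hc]; simp only; linarith
        have h5 : ((-(q : ℤ) - 1 : ℤ) : ℝ) < c i := by push_cast; exact this
        have := Int.cast_lt.1 h5
        omega
      · have : (c i : ℝ) < q + 1 := by rw [hc]; simp only; linarith
        have h5 : (c i : ℝ) < ((q + 1 : ℤ) : ℝ) := by push_cast; exact this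
        have := Int.cast_lt.1 h5
        omega
    · have hrep : (⟨s, hs⟩ : V) - ∑ i, ((c i : ℝ) / q) • e i
          = ∑ i, (inner ℝ (e i) (⟨s, hs⟩ : V) - (c i : ℝ) / q) • e i := by
        simp_rw [sub_smul]
        rw [Finset.sum_sub_distrib, e.sum_repr']
      have hnorm : ‖s - f c‖ = ‖∑ i, (inner ℝ (e i) (⟨s, hs⟩ : V) - (c i : ℝ) / q) • e i‖ := by
        rw [← hrep, Submodule.coe_norm, Submodule.coe_sub]
      rw [hnorm]
      have hsq : ‖∑ i, (inner ℝ (e i) (⟨s, hs⟩ : V) - (c i : ℝ) / q) • e i‖ ^ 2 ≤ η ^ 2 := by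
        rw [← e.sum_sq_norm_inner_right]
        have hi : ∀ i, ‖inner ℝ (e i) (∑ j, (inner ℝ (e j) (⟨s, hs⟩ : V) - (c j : ℝ) / q) • e j)‖ ^ 2
            ≤ (1 / q) ^ 2 := by
          intro i
          rw [e.orthonormal.inner_right_fintype]
          refine pow_le_pow_left₀ (norm_nonneg _) ?_ 2
          have h4 := abs_sub_round (inner ℝ (e i) (⟨s, hs⟩ : V) * q)
          have e1 : inner ℝ (e i) (⟨s, hs⟩ : V) - (c i : ℝ) / q
              = (inner ℝ (e i) (⟨s, hs⟩ : V) * q - c i) / q := by field_simp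
          rw [e1, Real.norm_eq_abs, abs_div, abs_of_pos hq']
          gcongr
          exact h4.trans (by norm_num)
        refine (Finset.sum_le_sum fun i _ => hi i).trans ?_
        simp only [Finset.sum_const, Finset.card_univ, Fintype.card_fin, nsmul_eq_mul]
        have h5 : √n / q ≤ η := by rwa [div_le_iff₀ hq']
        have h6 : (√n / q) ^ 2 ≤ η ^ 2 := pow_le_pow_left₀ (by positivity) h5 2
        rw [div_pow, Real.sq_sqrt (by positivity)] at h6
        refine le_trans ?_ h6
        rw [one_div, inv_pow, ← div_eq_mul_inv]
        gcongr
      have hη : 0 ≤ η := by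
        by_contra h
        have : η * q < 0 := by nlinarith
        linarith [Real.sqrt_nonneg n]
      exact abs_le_of_sq_le_sq' hsq hη |>.2

end Nets

/-! ### Random sections represent the whole family -/

section Sections

/-- The uniform law of a section `S`, which selects one of `B` elements from each of `l` strata. -/
noncomputable def sectionLaw (l B : ℕ) : Measure (Fin l → Fin B) :=
  Measure.pi fun _ => uniformOn Set.univ

instance (B : ℕ) [NeZero B] : IsProbabilityMeasure (uniformOn (Set.univ : Set (Fin B))) :=
  isProbabilityMeasure_uniformOn Set.finite_univ Set.univ_nonempty

instance (l B : ℕ) [NeZero B] : IsProbabilityMeasure (sectionLaw l B) := by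
  unfold sectionLaw; infer_instance

theorem integral_uniformOn_fin {B : ℕ} [NeZero B] (f : Fin B → ℝ) :
    ∫ b, f b ∂(uniformOn (Set.univ : Set (Fin B))) = (∑ b, f b) / B := by
  rw [integral_fintype (Integrable.of_finite), Finset.sum_div]
  refine Finset.sum_congr rfl fun b _ => ?_
  have : (uniformOn (Set.univ : Set (Fin B))).real {b} = (B : ℝ)⁻¹ := by
    rw [Measure.real, uniformOn_univ]
    simp
  rw [this, smul_eq_mul]
  ring

/-- Hoeffding's inequality: the choices in different strata are independent, and each term ranges in
an interval of length 1. -/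
theorem sectionLaw_deviation_le {l B : ℕ} [NeZero B] (hl : 0 < l) (f : Fin l → Fin B → ℝ)
    (hf0 : ∀ i b, 0 ≤ f i b) (hf1 : ∀ i b, f i b ≤ 1) {α : ℝ} (hα : 0 ≤ α) :
    sectionLaw l B {S | α ≤ |(∑ i, f i (S i)) / l - (∑ i, (∑ b, f i b) / B) / l|}
      ≤ ENNReal.ofReal (2 * Real.exp (-(2 * l * α ^ 2))) := by
  have hl' : (0 : ℝ) < l := by exact_mod_cast hl
  -- Phrased through the oscillation of `f`, the one-sided bound applies to `f` and to `-f`.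
  have key : ∀ f : Fin l → Fin B → ℝ, (∀ i b, |f i b| ≤ 1 ∧ ∀ b', |f i b - f i b'| ≤ 1) →
      (sectionLaw l B).real {S | l * α ≤ ∑ i, (f i (S i) - (∑ b, f i b) / B)}
        ≤ Real.exp (-(2 * l * α ^ 2)) := by
    intro f hf
    have hind : iIndepFun (fun (i : Fin l) (S : Fin l → Fin B) => f i (S i) - (∑ b, f i b) / B)
        (sectionLaw l B) :=
      iIndepFun_pi (X := fun i b => f i b - (∑ b, f i b) / B) fun i =>
        (measurable_of_finite _).aemeasurable
    have hsub : ∀ i ∈ (Finset.univ : Finset (Fin l)),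
        HasSubgaussianMGF (fun (S : Fin l → Fin B) => f i (S i) - (∑ b, f i b) / B)
          ((1 / 2) ^ 2) (sectionLaw l B) := by
      intro i _
      obtain ⟨b0, hb0⟩ := Finite.exists_min (f i)
      have h1 : HasSubgaussianMGF (fun b => f i b - ∫ b, f i b ∂(uniformOn Set.univ))
          ((‖(f i b0 + 1) - f i b0‖₊ / 2) ^ 2) (uniformOn (Set.univ : Set (Fin B))) :=
        hasSubgaussianMGF_of_mem_Icc (measurable_of_finite _).aemeasurable
          (ae_of_all _ fun b => ⟨hb0 b, by have := (abs_le.1 ((hf i b).2 b0)).2; linarith⟩)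
      rw [integral_uniformOn_fin] at h1
      have h2 : (‖(f i b0 + 1) - f i b0‖₊ / 2) ^ 2 = ((1 / 2) ^ 2 : NNReal) := by
        have : ‖(f i b0 + 1) - f i b0‖₊ = 1 := by ext; simp
        rw [this]
      rw [h2] at h1
      have hev := measurePreserving_eval (fun _ : Fin l => uniformOn (Set.univ : Set (Fin B))) i
      rw [← hev.map_eq] at h1
      exact HasSubgaussianMGF.of_map (Y := Function.eval i) hev.measurable.aemeasurable h1
    refine (HasSubgaussianMGF.measure_sum_ge_le_of_iIndepFun hind hsub (by positivity)).trans ?_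
    refine Real.exp_le_exp.2 (le_of_eq ?_)
    simp
    field_simp
  have hd : ∀ i b b', |f i b - f i b'| ≤ 1 := fun i b b' =>
    abs_le.2 ⟨by linarith [hf0 i b, hf1 i b'], by linarith [hf0 i b', hf1 i b]⟩
  have k1 := key f fun i b => ⟨abs_le.2 ⟨by linarith [hf0 i b], hf1 i b⟩, hd i b⟩
  have k2 := key (fun i b => - f i b) fun i b =>
    ⟨by rw [abs_neg]; exact abs_le.2 ⟨by linarith [hf0 i b], hf1 i b⟩, fun b' => by
      have := hd i b' b
      rwa [neg_sub_neg]⟩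
  have hsub : {S : Fin l → Fin B | α ≤ |(∑ i, f i (S i)) / l - (∑ i, (∑ b, f i b) / B) / l|}
      ⊆ {S | l * α ≤ ∑ i, (f i (S i) - (∑ b, f i b) / B)} ∪
        {S | l * α ≤ ∑ i, (- f i (S i) - (∑ b, - f i b) / B)} := by
    intro S hS
    simp only [Set.mem_ofPred_eq, Set.mem_union] at hS ⊢
    rw [← sub_div, ← Finset.sum_sub_distrib, abs_div, abs_of_pos hl', le_div_iff₀ hl', le_abs] at hS
    rcases hS with h | h
    · left; linarith
    · right
      have : ∑ i, (- f i (S i) - (∑ b, - f i b) / B) = -∑ i, (f i (S i) - (∑ b, f i b) / B) := by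
        rw [← Finset.sum_neg_distrib]
        refine Finset.sum_congr rfl fun i _ => ?_
        rw [Finset.sum_neg_distrib]
        ring
      rw [this]; linarith
  refine (measure_mono hsub).trans ((measure_union_le _ _).trans ?_)
  rw [two_mul, ENNReal.ofReal_add (Real.exp_pos _).le (Real.exp_pos _).le]
  refine add_le_add ?_ ?_
  · rw [← ofReal_measureReal]; exact ENNReal.ofReal_le_ofReal k1
  · rw [← ofReal_measureReal]; exact ENNReal.ofReal_le_ofReal k2

variable {E : Type*} [NormedAddCommGroup E] [InnerProductSpace ℝ E] [FiniteDimensional ℝ E]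

/-- The mean truncated correlation of `x` with the vectors `w`. -/
noncomputable def rampMean {l : ℕ} (δ : ℝ) (w : Fin l → E) (x : E) : ℝ :=
  (∑ i, ramp δ (inner ℝ (w i) x)) / l

/-- The mean truncated correlation of `x` with all the vectors of all the strata. -/
noncomputable def fullMean {l B : ℕ} (δ : ℝ) (v : Fin l → Fin B → E) (x : E) : ℝ :=
  (∑ i, (∑ b, ramp δ (inner ℝ (v i b) x)) / B) / l

theorem continuous_rampMean {l : ℕ} (δ : ℝ) :
    Continuous fun p : (Fin l → E) × E => rampMean δ p.1 p.2 := by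
  have := continuous_ramp δ
  unfold rampMean
  fun_prop

theorem continuous_fullMean {l B : ℕ} (δ : ℝ) :
    Continuous fun p : (Fin l → Fin B → E) × E => fullMean δ p.1 p.2 := by
  have := continuous_ramp δ
  unfold fullMean
  fun_prop

/-- Written as an average over sections with constant `b`, the full mean inherits the Lipschitz
bound of `rampMean`. -/
theorem fullMean_eq {l B : ℕ} (δ : ℝ) (v : Fin l → Fin B → E) (x : E) :
    fullMean δ v x = (∑ b, rampMean δ (fun i => v i b) x) / B := by
  unfold fullMean rampMean
  simp_rw [← Finset.sum_div]
  rw [Finset.sum_comm]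
  ring

/-- The `ℓ₁`-norm of the correlations with `w` is at most `Λ` times the norm. -/
def CorrBound {l : ℕ} (Λ : ℝ) (w : Fin l → E) : Prop :=
  ∀ r : E, ∑ i, |inner ℝ (w i) r| ≤ Λ * ‖r‖

theorem isClosed_corrBound {l : ℕ} (Λ : ℝ) : IsClosed {w : Fin l → E | CorrBound Λ w} := by
  simp only [CorrBound, Set.ofPred_forall]
  exact isClosed_iInter fun r => isClosed_le (by fun_prop) (by fun_prop)

theorem CorrBound.abs_rampMean_sub_le {l : ℕ} (hl : 0 < l) {Λ δ : ℝ} (hδ : 0 < δ) {w : Fin l → E}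
    (h : CorrBound Λ w) (x y : E) :
    |rampMean δ w x - rampMean δ w y| ≤ Λ * ‖x - y‖ / (l * δ) := by
  have hl' : (0 : ℝ) < l := by exact_mod_cast hl
  unfold rampMean
  rw [← sub_div, ← Finset.sum_sub_distrib, abs_div, abs_of_pos hl', div_le_div_iff₀ hl' (by positivity)]
  have : |∑ i, (ramp δ (inner ℝ (w i) x) - ramp δ (inner ℝ (w i) y))| ≤ Λ * ‖x - y‖ / δ := by
    refine (Finset.abs_sum_le_sum_abs _ _).trans ?_
    calc _ ≤ ∑ i, |inner ℝ (w i) (x - y)| / δ := by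
          refine Finset.sum_le_sum fun i _ => ?_
          rw [inner_sub_right]
          exact abs_ramp_sub_le hδ _ _
      _ ≤ Λ * ‖x - y‖ / δ := by
          rw [← Finset.sum_div]
          exact div_le_div_of_nonneg_right (h _) hδ.le
  calc _ ≤ Λ * ‖x - y‖ / δ * (l * δ) := by gcongr
    _ = _ := by field_simp

theorem abs_fullMean_sub_le {l B : ℕ} [NeZero B] (hl : 0 < l) {Λ δ : ℝ} (hδ : 0 < δ)
    {v : Fin l → Fin B → E} (h : ∀ b, CorrBound Λ fun i => v i b) (x y : E) :
    |fullMean δ v x - fullMean δ v y| ≤ Λ * ‖x - y‖ / (l * δ) := by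
  have hB : (0 : ℝ) < B := by exact_mod_cast Nat.pos_of_ne_zero (NeZero.ne B)
  rw [fullMean_eq, fullMean_eq, ← sub_div, ← Finset.sum_sub_distrib, abs_div, abs_of_pos hB,
    div_le_iff₀ hB]
  refine (Finset.abs_sum_le_sum_abs _ _).trans ?_
  calc _ ≤ ∑ b : Fin B, Λ * ‖x - y‖ / (l * δ) :=
        Finset.sum_le_sum fun b _ => (h b).abs_rampMean_sub_le hl hδ x y
    _ = _ := by simp; ring

/-- Hoeffding with error α/2 at each point of a net of `V`. A point within η of `V` is within 2η of
the net, and by `hΛ` each of the two means then changes by at most α/4. -/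
theorem sectionLaw_exists_deviation_le {l B n q : ℕ} [NeZero B] (hl : 0 < l)
    (v : Fin l → Fin B → E) (V : Submodule ℝ E) (hn : Module.finrank ℝ V ≤ n) {δ Λ η α : ℝ}
    (hδ : 0 < δ) (hq : √n ≤ η * q) (hq0 : 0 < q) (hα : 0 ≤ α) (hΛ : 8 * η * Λ ≤ α * (l * δ))
    (hv : ∀ b, CorrBound Λ fun i => v i b) :
    sectionLaw l B {S | CorrBound Λ (fun i => v i (S i)) ∧ ∃ x : E, ‖x‖ ≤ 1 ∧
        (∃ s ∈ V, ‖x - s‖ ≤ η) ∧ α < |rampMean δ (fun i => v i (S i)) x - fullMean δ v x|}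
      ≤ ENNReal.ofReal ((2 * q + 1) ^ n * (2 * Real.exp (-(l * α ^ 2 / 2)))) := by
  have hl' : (0 : ℝ) < l := by exact_mod_cast hl
  obtain ⟨net, hcard, hnet⟩ := exists_net V hn hq hq0
  -- The correlation bound forces `Λ` to be nonnegative only if the space is nontrivial.
  have hΛ0 : 0 ≤ Λ ∨ ∀ x : E, x = 0 := by
    by_cases hE : ∀ x : E, x = 0
    · exact Or.inr hE
    · push Not at hE
      obtain ⟨x, hx⟩ := hE
      left
      have h1 := hv ⟨0, Nat.pos_of_ne_zero (NeZero.ne B)⟩ x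
      have h2 : 0 ≤ Λ * ‖x‖ := le_trans (Finset.sum_nonneg fun i _ => abs_nonneg _) h1
      exact nonneg_of_mul_nonneg_left h2 (norm_pos_iff.2 hx)
  have hsub : {S : Fin l → Fin B | CorrBound Λ (fun i => v i (S i)) ∧ ∃ x : E, ‖x‖ ≤ 1 ∧
        (∃ s ∈ V, ‖x - s‖ ≤ η) ∧ α < |rampMean δ (fun i => v i (S i)) x - fullMean δ v x|}
      ⊆ ⋃ z ∈ net, {S | α / 2 ≤ |(∑ i, ramp δ (inner ℝ (v i (S i)) z)) / l
        - (∑ i, (∑ b, ramp δ (inner ℝ (v i b) z)) / B) / l|} := by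
    rintro S ⟨hS, x, hx, ⟨s, hs, hxs⟩, hdev⟩
    have hPx : ‖V.starProjection x‖ ≤ 1 := (V.norm_starProjection_apply_le x).trans hx
    obtain ⟨z, hz, hzn⟩ := hnet _ (V.starProjection_apply_mem x) hPx
    simp only [Set.mem_iUnion]
    refine ⟨z, hz, ?_⟩
    have hxz : ‖x - z‖ ≤ 2 * η := by
      have h1 := (norm_sub_starProjection_le V x hs).trans hxs
      calc ‖x - z‖ = ‖(x - V.starProjection x) + (V.starProjection x - z)‖ := by congr 1; abel
        _ ≤ 2 * η := (norm_add_le _ _).trans (by linarith)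
    have hb : Λ * ‖x - z‖ / (l * δ) ≤ α / 4 := by
      rw [div_le_iff₀ (by positivity)]
      rcases hΛ0 with h | h
      · nlinarith
      · rw [h (x - z)]; simp; positivity
    have e1 := (hS.abs_rampMean_sub_le hl hδ x z).trans hb
    have e2 := (abs_fullMean_sub_le hl hδ hv x z).trans hb
    change α / 2 ≤ |rampMean δ (fun i => v i (S i)) z - fullMean δ v z|
    by_contra hcon
    rw [not_le] at hcon
    have : |rampMean δ (fun i => v i (S i)) x - fullMean δ v x| ≤ α := by
      rw [abs_le] at *
      rw [abs_lt] at hcon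
      constructor <;> linarith [e1.1, e1.2, e2.1, e2.2, hcon.1, hcon.2]
    linarith
  refine (measure_mono hsub).trans ((measure_biUnion_finset_le _ _).trans ?_)
  calc _ ≤ ∑ _z ∈ net, ENNReal.ofReal (2 * Real.exp (-(l * α ^ 2 / 2))) := by
        refine Finset.sum_le_sum fun z _ => ?_
        refine (sectionLaw_deviation_le hl (fun i b => ramp δ (inner ℝ (v i b) z))
          (fun i b => ramp_nonneg hδ.le _) (fun i b => ramp_le_one _ _) (by positivity)).trans
          (le_of_eq ?_)
        congr 3
        ring
    _ ≤ _ := by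
        rw [Finset.sum_const, nsmul_eq_mul,
          ENNReal.ofReal_mul (p := (2 * (q : ℝ) + 1) ^ n) (by positivity)]
        refine mul_le_mul' ?_ le_rfl
        rw [← ENNReal.ofReal_natCast]
        refine ENNReal.ofReal_le_ofReal ?_
        exact_mod_cast hcard

end Sections

end Feasibility

namespace Feasibility

/-! ### Runs of deterministic algorithms -/

section Runs

variable {X Mem R : Type*} (q : ℕ → Mem → X) (u : ℕ → Mem → R → Mem)

/-- The memory state after `n` iterations of a deterministic algorithm started at time `t₀` in the
memory state `m₀`. -/
def run (O : ℕ → X → R) (t₀ : ℕ) (m₀ : Mem) : ℕ → Mem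
  | 0 => m₀
  | n + 1 => u (t₀ + n) (run O t₀ m₀ n) (O (t₀ + n) (q (t₀ + n) (run O t₀ m₀ n)))

/-- The query made after `n` iterations. -/
def runQuery (O : ℕ → X → R) (t₀ : ℕ) (m₀ : Mem) (n : ℕ) : X := q (t₀ + n) (run q u O t₀ m₀ n)

variable {q u}

theorem run_congr {O O' : ℕ → X → R} {t₀ : ℕ} {m₀ : Mem} {N : ℕ}
    (h : ∀ n < N, O (t₀ + n) (runQuery q u O t₀ m₀ n) = O' (t₀ + n) (runQuery q u O t₀ m₀ n)) :
    ∀ n ≤ N, run q u O' t₀ m₀ n = run q u O t₀ m₀ n := by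
  intro n
  induction n with
  | zero => intro _; rfl
  | succ n ih =>
    intro hn
    have h1 := ih (by omega)
    have h2 := h n (by omega)
    simp only [runQuery] at h2
    simp only [run, h1, h2]

theorem runQuery_congr {O O' : ℕ → X → R} {t₀ : ℕ} {m₀ : Mem} {N : ℕ}
    (h : ∀ n < N, O (t₀ + n) (runQuery q u O t₀ m₀ n) = O' (t₀ + n) (runQuery q u O t₀ m₀ n)) :
    ∀ n ≤ N, runQuery q u O' t₀ m₀ n = runQuery q u O t₀ m₀ n := fun n hn => by
  rw [runQuery, runQuery, run_congr h n hn]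

/-- The past acts on the future only through the memory state. This is how the memory constraint
enters: a run from time `t₀` on is one of as many runs as there are states. -/
theorem run_add (O : ℕ → X → R) (m₀ : Mem) (t₀ n : ℕ) :
    run q u O t₀ (run q u O 0 m₀ t₀) n = run q u O 0 m₀ (t₀ + n) := by
  induction n with
  | zero => rfl
  | succ n ih => rw [← Nat.add_assoc, run, run, ih, Nat.zero_add]

theorem runQuery_add (O : ℕ → X → R) (m₀ : Mem) (t₀ n : ℕ) :
    runQuery q u O t₀ (run q u O 0 m₀ t₀) n = runQuery q u O 0 m₀ (t₀ + n) := by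
  rw [runQuery, runQuery, run_add, Nat.zero_add]

end Runs

/-! ### The first index with a property -/

section FirstOf

variable {β : Type*}

open Classical in
/-- The value at the first index `n < N` with `c n`, and `a` if there is none. -/
noncomputable def firstOf : ℕ → (ℕ → Prop) → (ℕ → β) → β → β
  | 0, _, _, a => a
  | N + 1, c, v, a => firstOf N c v (if c N then v N else a)

theorem firstOf_of_forall_not {N : ℕ} {c : ℕ → Prop} (v : ℕ → β) (a : β)
    (h : ∀ n < N, ¬ c n) : firstOf N c v a = a := by
  induction N generalizing a with
  | zero => rfl
  | succ N ih => rw [firstOf, if_neg (h N (by omega)), ih _ fun n hn => h n (by omega)]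

theorem firstOf_of_first {N n : ℕ} {c : ℕ → Prop} (v : ℕ → β) (a : β) (hn : n < N) (hc : c n)
    (h : ∀ n' < n, ¬ c n') : firstOf N c v a = v n := by
  induction N generalizing a with
  | zero => omega
  | succ N ih =>
    rw [firstOf]
    rcases Nat.lt_succ_iff_lt_or_eq.1 hn with h' | rfl
    · exact ih _ h'
    · rw [if_pos hc, firstOf_of_forall_not _ _ h]

theorem exists_first {N : ℕ} {c : ℕ → Prop} (h : ∃ n < N, c n) :
    ∃ n < N, c n ∧ ∀ n' < n, ¬ c n' := by
  classical
  obtain ⟨n, hn, hc⟩ := h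
  have hex : ∃ n, c n := ⟨n, hc⟩
  exact ⟨Nat.find hex, (Nat.find_min' hex hc).trans_lt hn, Nat.find_spec hex,
    fun n' hn' => Nat.find_min hex hn'⟩

theorem firstOf_congr {N : ℕ} {c c' : ℕ → Prop} {v v' : ℕ → β} {a : β}
    (h : ∀ n < N, (∀ n' < n, ¬ c n') → ((c n ↔ c' n) ∧ (c n → v n = v' n))) :
    firstOf N c v a = firstOf N c' v' a := by
  by_cases hex : ∃ n < N, c n
  · obtain ⟨n, hn, hc, hmin⟩ := exists_first hex
    have hmin' : ∀ n' < n, ¬ c' n' := fun n' hn' =>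
      mt (h n' (by omega) fun n'' hn'' => hmin n'' (by omega)).1.2 (hmin n' hn')
    rw [firstOf_of_first v a hn hc hmin,
      firstOf_of_first v' a hn ((h n hn hmin).1.1 hc) hmin', (h n hn hmin).2 hc]
  · push Not at hex
    rw [firstOf_of_forall_not v a hex, firstOf_of_forall_not v' a fun n hn =>
      mt (h n hn fun n' hn' => hex n' (by omega)).1.2 (hex n hn)]

theorem measurable_firstOf {Ω β : Type*} [MeasurableSpace Ω] [MeasurableSpace β] (N : ℕ)
    {c : ℕ → Ω → Prop} {v : ℕ → Ω → β} {a : Ω → β} (hc : ∀ n < N, MeasurableSet {w | c n w})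
    (hv : ∀ n < N, Measurable (v n)) (ha : Measurable a) :
    Measurable fun w => firstOf N (fun n => c n w) (fun n => v n w) (a w) := by
  induction N generalizing a with
  | zero => exact ha
  | succ N ih =>
    simp only [firstOf]
    exact ih (fun n hn => hc n (by omega)) (fun n hn => hv n (by omega))
      (Measurable.ite (hc N (by omega)) (hv N (by omega)) ha)

end FirstOf

/-! ### Hierarchies of tests and the induction over the levels -/

section Tests

variable {X Mem R : Type*}

/-- A hierarchy of tests for queries. Level `p` has `J p` tests, which change at the times that are
multiples of `τ p`: `fail p e j x` says that `x` fails the `j`-th test of level `p` in the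
`e`-th of these epochs, and `val p e j x` is the answer that it gets in this case, provided it is
admissible and passes all earlier tests. -/
structure TestSystem (X R : Type*) where
  P : ℕ
  J : ℕ → ℕ
  τ : ℕ → ℕ
  adm : X → Prop
  fail : ℕ → ℕ → ℕ → X → Prop
  base : X → R
  val : ℕ → ℕ → ℕ → X → R
  pass : X → R

namespace TestSystem

variable (S : TestSystem X R)

open Classical in
/-- The answers, when only the first `cut p e` tests of level `p` in epoch `e` are used. -/
noncomputable def resp (cut : ℕ → ℕ → ℕ) (t : ℕ) (x : X) : R :=
  if S.adm x then
    firstOf (S.P + 1) (fun p => ∃ j < cut p (t / S.τ p), S.fail p (t / S.τ p) j x)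
      (fun p => firstOf (cut p (t / S.τ p)) (fun j => S.fail p (t / S.τ p) j x)
        (fun j => S.val p (t / S.τ p) j x) (S.pass x)) (S.pass x)
  else S.base x

/-- All tests are used. -/
def full : ℕ → ℕ → ℕ := fun p _ => S.J p

/-- Only the first `i` tests of level `p` in epoch `e` are used. -/
def cutAt (p e i : ℕ) : ℕ → ℕ → ℕ := fun p' e' => if p' = p ∧ e' = e then i else S.J p'

/-- At time `t`, the query `x` is admissible and passes all levels below `p`. -/
def Passes (p t : ℕ) (x : X) : Prop :=
  S.adm x ∧ ∀ p' < p, ∀ j < S.J p', ¬ S.fail p' (t / S.τ p') j x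

variable {S}

/-- The answer comes from the first failed test, so the tests from `i` on are irrelevant to a query
that does not reach level `p`, or that fails one of the first `i` whenever it fails any. -/
theorem resp_cutAt {p e i t : ℕ} {x : X} (hi : i ≤ S.J p)
    (h : t / S.τ p = e → S.Passes p t x → ∀ j < S.J p, S.fail p e j x → ∃ j' < i, S.fail p e j' x) :
    S.resp S.full t x = S.resp (S.cutAt p e i) t x := by
  unfold resp
  split_ifs with hadm
  · refine firstOf_congr fun p' hp' hmin => ?_
    by_cases hpp : p' = p ∧ t / S.τ p' = e
    · obtain ⟨rfl, rfl⟩ := hpp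
      have hpass : S.Passes p' t x := ⟨hadm, fun p'' hp'' j hj hf => hmin p'' hp'' ⟨j, hj, hf⟩⟩
      have h' := h rfl hpass
      simp only [full, cutAt, and_self, if_true]
      refine ⟨⟨fun ⟨j, hj, hf⟩ => h' j hj hf, fun ⟨j, hj, hf⟩ => ⟨j, by omega, hf⟩⟩, ?_⟩
      rintro ⟨j, hj, hf⟩
      obtain ⟨n, hn, hc, hm⟩ := exists_first (h' j hj hf)
      rw [firstOf_of_first _ _ hn hc hm, firstOf_of_first _ _ (by omega : n < S.J p') hc hm]
    · simp only [full, cutAt, if_neg hpp, implies_true, and_self]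
  · rfl

theorem resp_pass_congr (cut : ℕ → ℕ → ℕ) (pass' : X → R) {t : ℕ} {x : X}
    (h : S.adm x → ∃ p < S.P + 1, ∃ j < cut p (t / S.τ p), S.fail p (t / S.τ p) j x) :
    ({S with pass := pass'} : TestSystem X R).resp cut t x = S.resp cut t x := by
  unfold resp
  split_ifs with hadm
  · obtain ⟨p, hp, hc, hm⟩ := exists_first (h hadm)
    rw [firstOf_of_first _ _ hp hc hm, firstOf_of_first _ _ hp hc hm]
    obtain ⟨n, hn, hcn, hmn⟩ := exists_first hc
    rw [firstOf_of_first _ _ hn hcn hmn, firstOf_of_first _ _ hn hcn hmn]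
  · rfl

variable {E : Type*} [NormedAddCommGroup E] [InnerProductSpace ℝ E]

/-- Statistics `stat p e j` and `mean p` of queries that describe a test system: a query fails a
test if the statistic of the test exceeds its threshold. If the statistics are close to the mean
near the span of the queries made before they have been used, and if from the start of an epoch of
level `p + 1` no sequence of `J (p + 1)` robustly independent queries with small mean is found
within this epoch, then no query passes all tests. -/
theorem not_passes (q : ℕ → Mem → X) (u : ℕ → Mem → R → Mem) (m₀ : Mem) (pt : X → E)
    (hpt : ∀ x, ‖pt x‖ ≤ 1) (stat : ℕ → ℕ → ℕ → E → ℝ) (mean : ℕ → E → ℝ) (θ : ℕ → ℕ → ℝ)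
    (α η : ℕ → ℝ) (Θ : ℝ) (T : ℕ)
    (hfail : ∀ p ≤ S.P, ∀ e < T, ∀ j < S.J p, ∀ x, S.fail p e j x ↔ θ p j < stat p e j (pt x))
    (hτ0 : S.τ 0 = 1) (hJ0 : S.J 0 = 1)
    (hα : ∀ p, 0 ≤ α p) (hθ : ∀ p j, θ p j + 2 * α p ≤ θ p (j + 1))
    (hΘ : ∀ p ≤ S.P, ∀ j < S.J p, θ p j + α p ≤ Θ)
    (hη : ∀ p ≤ S.P, 0 ≤ η p) (hadm : ∀ x, S.adm x → ∀ p ≤ S.P, η p ≤ ‖pt x‖)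
    (hA : ∀ p ≤ S.P, ∀ e < T, ∀ i < S.J p, ∀ r : ℕ → ℕ, (∀ j ≤ i, r j < T) →
      ∀ z : E, ‖z‖ ≤ 1 →
      (∃ c : ℕ → ℝ, ‖z - ∑ j ∈ Finset.range (i + 1),
        c j • pt (runQuery q u (S.resp (S.cutAt p e i)) 0 m₀ (r j))‖ ≤ η p) →
      ∀ j', i ≤ j' → j' < S.J p → |stat p e j' z - mean p z| ≤ α p)
    (hB : ∀ p < S.P, ∀ e < T, ∀ m : Mem, ∀ r : ℕ → ℕ,
      (∀ j < S.J (p + 1), e * S.τ (p + 1) + r j < T ∧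
        (e * S.τ (p + 1) + r j) / S.τ (p + 1) = e) →
      ¬ (Robust (η (p + 1)) (S.J (p + 1)) (fun j =>
          pt (runQuery q u (S.resp S.full) (e * S.τ (p + 1)) m (r j))) ∧
        ∀ j < S.J (p + 1),
          mean p (pt (runQuery q u (S.resp S.full) (e * S.τ (p + 1)) m (r j))) ≤ Θ))
    (hC : ∀ t < T, S.adm (runQuery q u (S.resp S.full) 0 m₀ t) →
      ¬ mean S.P (pt (runQuery q u (S.resp S.full) 0 m₀ t)) ≤ Θ) :
    ∀ t < T, ¬ S.Passes (S.P + 1) t (runQuery q u (S.resp S.full) 0 m₀ t) := by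
  classical
  set x : ℕ → X := runQuery q u (S.resp S.full) 0 m₀ with hx
  have hθmono : ∀ p j j', j < j' → θ p j + 2 * α p ≤ θ p j' := by
    intro p j j' hjj
    induction j', hjj using Nat.le_induction with
    | base => exact hθ p j
    | succ n _ ih => linarith [hθ p n, hα p]
  -- `Okay p e i t`: at time `t` the answer does not change if only the first `i` tests are used
  set Okay : ℕ → ℕ → ℕ → ℕ → Prop := fun p e i t => t / S.τ p = e → S.Passes p t (x t) →
    ∀ j < S.J p, S.fail p e j (x t) → ∃ j' < i, S.fail p e j' (x t) with hOkay
  -- While no test beyond the first `i` has been needed, the true queries are those of the cut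
  -- system. `hA` speaks of the latter, because only they are independent of the later tests.
  have hrun : ∀ p e i t, i ≤ S.J p → (∀ t' < t, Okay p e i t') →
      ∀ t' ≤ t, runQuery q u (S.resp (S.cutAt p e i)) 0 m₀ t' = x t' := by
    intro p e i t hi h
    refine runQuery_congr fun n hn => ?_
    rw [Nat.zero_add]
    exact resp_cutAt hi (h n hn)
  -- The inductive step at level `p`: if an epoch never has `J p` robustly independent queries that
  -- pass the lower levels, its tests do not run out, and the queries that pass this level have
  -- small mean.
  have main : ∀ p ≤ S.P,
      (∀ t < T, ∀ i, ∀ r : ℕ → ℕ, (∀ j < i, r j < t ∧ r j / S.τ p = t / S.τ p ∧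
        S.Passes p (r j) (x (r j))) → Robust (η p) i (fun j => pt (x (r j))) → i < S.J p) →
      ∀ t < T, S.Passes (p + 1) t (x t) → mean p (pt (x t)) ≤ Θ := by
    intro p hp hH t₁ ht₁ hpass₁
    set e := t₁ / S.τ p with he
    have heT : e < T := (Nat.div_le_self _ _).trans_lt ht₁
    -- The current query is entered as number `i` among the `i + 1` queries, so that it trivially
    -- lies in their span.
    have hself : ∀ t < T, ∀ i < S.J p, ∀ r : ℕ → ℕ, (∀ j < i, r j < t) →
        (∀ t' < t, Okay p e i t') → ∀ j', i ≤ j' → j' < S.J p →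
        |stat p e j' (pt (x t)) - mean p (pt (x t))| ≤ α p := by
      intro t ht i hiJ r hr hok
      refine hA p hp e heT i hiJ (Function.update r i t) (fun j hj => ?_) _ (hpt _)
        ⟨fun j => if j = i then 1 else 0, ?_⟩
      · by_cases h : j = i
        · simpa [h] using ht
        · rw [Function.update_of_ne h]; have := hr j (by omega); omega
      · rw [Finset.sum_eq_single i]
        · simp only [if_true]
          rw [one_smul, Function.update_self, hrun p e i t hiJ.le hok t le_rfl, sub_self,
            norm_zero]
          exact hη p hp
        · intro j _ hji; simp only [if_neg hji, zero_smul]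
        · intro h; simp at h
    -- Before time `t`, `i` tests have been needed; `r j` is the time of the query that first needed
    -- test `j`, and these queries are robustly independent. The last two clauses record that the
    -- times are ordered and that before `r j` the first `j` tests sufficed.
    have hinv : ∀ t ≤ t₁, ∃ i, ∃ r : ℕ → ℕ,
        (∀ j < i, r j < t ∧ r j / S.τ p = e ∧ S.Passes p (r j) (x (r j))) ∧
        Robust (η p) i (fun j => pt (x (r j))) ∧ (∀ t' < t, Okay p e i t') ∧
        (∀ j < i, ∀ j' ≤ j, r j' ≤ r j) ∧ (∀ j < i, ∀ t' < r j, Okay p e j t') := by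
      intro t
      induction t with
      | zero =>
        intro _
        exact ⟨0, fun _ => 0, by simp, by intro i hi; omega, by simp, by simp, by simp⟩
      | succ t ih =>
        intro ht
        obtain ⟨i, r, hr, hrob, hok, hmono, hokj⟩ := ih (by omega)
        by_cases hO : Okay p e i t
        · refine ⟨i, r, fun j hj => ⟨by have := (hr j hj).1; omega, (hr j hj).2⟩, hrob,
            fun t' ht' => ?_, hmono, hokj⟩
          rcases Nat.lt_succ_iff_lt_or_eq.1 ht' with h | rfl
          · exact hok t' h
          · exact hO
        · rw [hOkay] at hO
          push Not at hO
          obtain ⟨hte, hpass, j, hj, hfj, hnf⟩ := hO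
          have hiJ : i < S.J p := hH t (by omega) i r (fun j hj => by
            have := hr j hj; exact ⟨this.1, this.2.1.trans hte.symm, this.2.2⟩) hrob
          have hij : i ≤ j := by
            by_contra hcon
            exact hnf j (by omega) hfj
          have hnear := hself t (by omega) i hiJ r (fun j hj => (hr j hj).1) hok
          set r' : ℕ → ℕ := Function.update r i t with hr'
          have hr'i : r' i = t := by simp [hr']
          have hr'j : ∀ j, j ≠ i → r' j = r j := fun j hj => by simp [hr', hj]
          have hfi : S.fail p e i (x t) := by
            by_contra hcon
            have hne : i < j := lt_of_le_of_ne hij fun h => hcon (h ▸ hfj)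
            rw [hfail p hp e heT i hiJ, not_lt] at hcon
            rw [hfail p hp e heT j hj] at hfj
            have h1 := abs_le.1 (hnear i le_rfl hiJ)
            have h2 := abs_le.1 (hnear j hij hj)
            linarith [hθmono p i j hne, h1.1, h1.2, h2.1, h2.2]
          have hrob' : Robust (η p) (i + 1) (fun j => pt (x (r' j))) := by
            intro a ha c
            rcases Nat.lt_succ_iff_lt_or_eq.1 ha with h | rfl
            · have := hrob a h c
              simp only
              rw [hr'j a (by omega)]
              convert this using 4 with b hb
              rw [hr'j b (by have := Finset.mem_range.1 hb; omega)]
            · simp only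
              rw [hr'i]
              have hsum : ∑ b ∈ Finset.range a, c b • pt (x (r' b))
                  = ∑ b ∈ Finset.range a, c b • pt (x (r b)) :=
                Finset.sum_congr rfl fun b hb => by
                  rw [hr'j b (by have := Finset.mem_range.1 hb; omega)]
              rw [hsum]
              -- If the query were within `η p` of the span of its predecessors, then passing test
              -- `a - 1` would bound its mean by `θ p (a - 1) + α p`, hence the statistic of test
              -- `a` by `θ p a`, against `hfi`. For `a = 0` the norm bound on admissible queries
              -- serves instead.
              by_contra hcon
              rw [not_le] at hcon
              rcases Nat.eq_zero_or_pos a with rfl | hpos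
              · rw [Finset.range_zero, Finset.sum_empty, sub_zero] at hcon
                exact absurd (hadm _ hpass.1 p hp) (not_le.2 hcon)
              · obtain ⟨b, rfl⟩ : ∃ b, a = b + 1 := ⟨a - 1, by omega⟩
                have hnear' : ∀ j', b ≤ j' → j' < S.J p →
                    |stat p e j' (pt (x t)) - mean p (pt (x t))| ≤ α p := by
                  refine hA p hp e heT b (by omega) r (fun j hj => ?_) _ (hpt _) ⟨c, ?_⟩
                  · have := (hr j (by omega)).1; omega
                  · refine le_trans (le_of_eq ?_) hcon.le
                    congr 2
                    refine Finset.sum_congr rfl fun j hj => ?_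
                    -- Up to time `r b` the run coincides with the one cut at `b`, so these `b + 1`
                    -- queries do not depend on test `b` or on later ones.
                    rw [hrun p e b (r b) (by omega) (hokj b (by omega)) (r j)
                      (hmono b (by omega) j (by have := Finset.mem_range.1 hj; omega))]
                have h1 := abs_le.1 (hnear' b le_rfl (by omega))
                have h2 := abs_le.1 (hnear' (b + 1) (by omega) hiJ)
                have h3 : ¬ S.fail p e b (x t) := hnf b (by omega)
                rw [hfail p hp e heT b (by omega), not_lt] at h3
                rw [hfail p hp e heT (b + 1) hiJ] at hfi
                linarith [hθ p b, h1.1, h1.2, h2.1, h2.2]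
          refine ⟨i + 1, r', fun a ha => ?_, hrob', fun t' ht' => ?_, fun a ha b hb => ?_,
            fun a ha t' ht' => ?_⟩
          · rcases Nat.lt_succ_iff_lt_or_eq.1 ha with h | rfl
            · rw [hr'j a (by omega)]
              exact ⟨by have := (hr a h).1; omega, (hr a h).2⟩
            · rw [hr'i]; exact ⟨by omega, hte, hpass⟩
          · rcases Nat.lt_succ_iff_lt_or_eq.1 ht' with h | rfl
            · intro h1 h2 j hj hf
              obtain ⟨j', hj', hf'⟩ := hok t' h h1 h2 j hj hf
              exact ⟨j', by omega, hf'⟩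
            · intro _ _ _ _ _
              exact ⟨i, by omega, hfi⟩
          · rcases Nat.lt_succ_iff_lt_or_eq.1 ha with h | rfl
            · rw [hr'j a (by omega), hr'j b (by omega)]
              exact hmono a h b hb
            · rw [hr'i]
              rcases Nat.lt_or_eq_of_le hb with h | rfl
              · rw [hr'j b (by omega)]; exact (hr b h).1.le
              · rw [hr'i]
          · rcases Nat.lt_succ_iff_lt_or_eq.1 ha with h | rfl
            · rw [hr'j a (by omega)] at ht'
              exact hokj a h t' ht'
            · rw [hr'i] at ht'
              exact hok t' ht'
    obtain ⟨i, r, hr, hrob, hok, hmono, hokj⟩ := hinv t₁ le_rfl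
    have hiJ : i < S.J p := hH t₁ ht₁ i r hr hrob
    -- Test `i` exists, has not been needed before `t₁` and is passed at `t₁`, so its threshold
    -- bounds the mean.
    have h1 := abs_le.1 (hself t₁ ht₁ i hiJ r (fun j hj => (hr j hj).1) hok i le_rfl hiJ)
    have h2 := hpass₁.2 p (by omega) i hiJ
    rw [hfail p hp _ heT i hiJ, not_lt] at h2
    linarith [hΘ p hp i hiJ, h1.1]
  have hH : ∀ p ≤ S.P, ∀ t < T, ∀ i, ∀ r : ℕ → ℕ, (∀ j < i, r j < t ∧ r j / S.τ p = t / S.τ p ∧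
      S.Passes p (r j) (x (r j))) → Robust (η p) i (fun j => pt (x (r j))) → i < S.J p := by
    intro p
    induction p with
    | zero =>
      intro _ t _ i r hr _
      rw [hJ0]
      -- Epochs of level 0 consist of one time, so they contain no earlier query.
      by_contra hcon
      have := hr 0 (by omega)
      rw [hτ0, Nat.div_one, Nat.div_one] at this
      omega
    | succ p ih =>
      intro hp t ht i r hr hrob
      by_contra hcon
      rw [not_lt] at hcon
      set e := t / S.τ (p + 1) with he
      have heT : e < T := (Nat.div_le_self _ _).trans_lt ht
      have hle : ∀ j < S.J (p + 1), e * S.τ (p + 1) ≤ r j := fun j hj => by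
        rw [← (hr j (by omega)).2.1]; exact Nat.div_mul_le_self _ _
      have hadd : ∀ j < S.J (p + 1),
          e * S.τ (p + 1) + (r j - e * S.τ (p + 1)) = r j := fun j hj => by
        have := hle j hj; omega
      have hxr : ∀ j < S.J (p + 1), runQuery q u (S.resp S.full) (e * S.τ (p + 1))
          (run q u (S.resp S.full) 0 m₀ (e * S.τ (p + 1))) (r j - e * S.τ (p + 1)) = x (r j) := by
        intro j hj
        rw [runQuery_add, hadd j hj]
      -- The queries of the epoch are those of a run started at its beginning from the memory state
      -- then reached; by `main` one level below, they have small mean there.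
      refine hB p (by omega) e heT (run q u (S.resp S.full) 0 m₀ (e * S.τ (p + 1)))
        (fun j => r j - e * S.τ (p + 1)) (fun j hj => ?_) ⟨fun a ha c => ?_, fun j hj => ?_⟩
      · rw [hadd j hj]
        have := hr j (by omega)
        exact ⟨by omega, this.2.1⟩
      · simp only
        rw [hxr a ha]
        refine (hrob a (by omega) c).trans (le_of_eq ?_)
        congr 2
        refine Finset.sum_congr rfl fun b hb => ?_
        rw [hxr b (by have := Finset.mem_range.1 hb; omega)]
      · rw [hxr j hj]
        have hrj := hr j (by omega)
        exact main p (by omega) (ih (by omega)) (r j) (by omega) hrj.2.2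
  intro t ht hpass
  exact hC t ht hpass.1 (main S.P le_rfl (hH S.P le_rfl) t ht hpass)

end TestSystem

end Tests

end Feasibility

namespace Feasibility

noncomputable section

/-! ### Separating vectors -/

section Separation

variable {d : ℕ} {ι : Type*} [Fintype ι]

open Classical in
/-- The signed sum of the vectors `w i` with `|⟨w i, x⟩| > c i`. -/
def violated (c : ι → ℝ) (w : ι → EuclideanSpace ℝ (Fin d)) (x : EuclideanSpace ℝ (Fin d)) :
    EuclideanSpace ℝ (Fin d) :=
  ∑ i, (if c i < |inner ℝ (w i) x| then (if 0 < inner ℝ (w i) x then (1 : ℝ) else -1) else 0) • w i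

theorem measurable_violated {c : ι → ℝ} :
    Measurable fun p : (ι → EuclideanSpace ℝ (Fin d)) × EuclideanSpace ℝ (Fin d) =>
      violated c p.1 p.2 := by
  classical
  have hin : ∀ i, Measurable fun p : (ι → EuclideanSpace ℝ (Fin d)) × EuclideanSpace ℝ (Fin d) =>
      inner ℝ (p.1 i) p.2 := fun i =>
    (by fun_prop : Continuous fun p : (ι → EuclideanSpace ℝ (Fin d)) × EuclideanSpace ℝ (Fin d) =>
      inner ℝ (p.1 i) p.2).measurable
  unfold violated
  refine Finset.measurable_sum _ fun i _ =>
    Measurable.smul (f := fun p : (ι → EuclideanSpace ℝ (Fin d)) × EuclideanSpace ℝ (Fin d) =>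
      (if c i < |inner ℝ (p.1 i) p.2| then (if 0 < inner ℝ (p.1 i) p.2 then (1 : ℝ) else -1) else 0))
      (g := fun p : (ι → EuclideanSpace ℝ (Fin d)) × EuclideanSpace ℝ (Fin d) => p.1 i)
      ?_ ((measurable_pi_apply i).comp measurable_fst)
  refine Measurable.ite (measurableSet_lt measurable_const (hin i).abs) ?_ measurable_const
  exact Measurable.ite (measurableSet_lt measurable_const (hin i)) measurable_const measurable_const

/-- Every selected term separates on its own. Adding up all violated constraints, rather than
choosing one, gives an answer that is plainly measurable. -/
theorem inner_violated_sub_neg {c : ι → ℝ} {w : ι → EuclideanSpace ℝ (Fin d)}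
    {x x' : EuclideanSpace ℝ (Fin d)} (hx : ∃ i, c i < |inner ℝ (w i) x|)
    (hx' : ∀ i, |inner ℝ (w i) x'| ≤ c i) : inner ℝ (violated c w x) (x' - x) < 0 := by
  classical
  rw [violated, sum_inner]
  have key : ∀ i, inner ℝ ((if c i < |inner ℝ (w i) x| then
      (if 0 < inner ℝ (w i) x then (1 : ℝ) else -1) else 0) • w i) (x' - x) ≤ 0 ∧
      (c i < |inner ℝ (w i) x| → inner ℝ ((if c i < |inner ℝ (w i) x| then
      (if 0 < inner ℝ (w i) x then (1 : ℝ) else -1) else 0) • w i) (x' - x) < 0) := by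
    intro i
    have h1 := abs_le.1 (hx' i)
    rw [real_inner_smul_left, inner_sub_right]
    by_cases h : c i < |inner ℝ (w i) x|
    · have h2 : (if 0 < inner ℝ (w i) x then (1 : ℝ) else -1) *
          (inner ℝ (w i) x' - inner ℝ (w i) x) < 0 := by
        split_ifs with h0
        · rw [abs_of_pos h0] at h; linarith
        · rw [abs_of_nonpos (not_lt.1 h0)] at h; linarith
      rw [if_pos h]
      exact ⟨h2.le, fun _ => h2⟩
    · simp [h]
  obtain ⟨i, hi⟩ := hx
  exact Finset.sum_neg' (fun i _ => (key i).1) ⟨i, Finset.mem_univ i, (key i).2 hi⟩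

end Separation

/-! ### Answers of the full system and measurability of runs -/

section Responses

variable {X R : Type*} (S : TestSystem X R)

theorem TestSystem.resp_full_cases (t : ℕ) (x : X) :
    (¬ S.adm x ∧ S.resp S.full t x = S.base x) ∨
    (∃ p ≤ S.P, ∃ j < S.J p, S.fail p (t / S.τ p) j x ∧
      S.resp S.full t x = S.val p (t / S.τ p) j x) ∨
    (S.Passes (S.P + 1) t x ∧ S.resp S.full t x = S.pass x) := by
  unfold TestSystem.resp
  split_ifs with hadm
  · right
    by_cases h : ∃ p < S.P + 1, ∃ j < S.full p (t / S.τ p), S.fail p (t / S.τ p) j x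
    · left
      obtain ⟨p, hp, hc, hm⟩ := exists_first h
      obtain ⟨j, hj, hcj, hmj⟩ := exists_first hc
      refine ⟨p, by omega, j, hj, hcj, ?_⟩
      rw [firstOf_of_first _ _ hp hc hm, firstOf_of_first _ _ hj hcj hmj]
    · right
      push Not at h
      refine ⟨⟨hadm, h⟩, firstOf_of_forall_not _ _ fun p hp => ?_⟩
      push Not
      exact h p hp
  · exact Or.inl ⟨hadm, rfl⟩

variable {S} {Mem : Type*}

/-- If some query passes all tests, then this is so as well with other answers to such queries. -/
theorem TestSystem.exists_passes_of_pass (pass' : X → R) (q : ℕ → Mem → X) (u : ℕ → Mem → R → Mem)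
    (m₀ : Mem) {T : ℕ}
    (h : ∃ t < T, S.Passes (S.P + 1) t (runQuery q u
      (TestSystem.resp {S with pass := pass'} (TestSystem.full {S with pass := pass'})) 0 m₀ t)) :
    ∃ t < T, S.Passes (S.P + 1) t (runQuery q u (S.resp S.full) 0 m₀ t) := by
  obtain ⟨t, ht, hp, hmin⟩ := exists_first h
  refine ⟨t, ht, ?_⟩
  rw [runQuery_congr (O := TestSystem.resp {S with pass := pass'}
    (TestSystem.full {S with pass := pass'})) (N := t) (fun n hn => ?_) t le_rfl]
  · exact hp
  · rw [Nat.zero_add]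
    have h' := hmin n hn
    refine TestSystem.resp_pass_congr (S := S) S.full pass' fun hadm => ?_
    by_contra hcon
    push Not at hcon
    exact h' ⟨hadm, hcon⟩

variable {Ω : Type*} [MeasurableSpace Ω] [MeasurableSpace X] [MeasurableSpace R]
  [MeasurableSpace Mem]

theorem measurable_run {q : Ω → ℕ → Mem → X} {u : Ω → ℕ → Mem → R → Mem} {O : Ω → ℕ → X → R}
    (hq : ∀ t, Measurable fun p : Ω × Mem => q p.1 t p.2)
    (hu : ∀ t, Measurable fun p : Ω × Mem × R => u p.1 t p.2.1 p.2.2)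
    (hO : ∀ t, Measurable fun p : Ω × X => O p.1 t p.2) (t₀ : ℕ) (m₀ : Mem) (n : ℕ) :
    Measurable fun ω => run (q ω) (u ω) (O ω) t₀ m₀ n := by
  induction n with
  | zero => exact measurable_const
  | succ n ih =>
    simp only [run]
    have h1 : Measurable fun ω => q ω (t₀ + n) (run (q ω) (u ω) (O ω) t₀ m₀ n) :=
      (hq (t₀ + n)).comp (measurable_id.prodMk ih)
    have h2 := (hO (t₀ + n)).comp (measurable_id.prodMk h1)
    exact (hu (t₀ + n)).comp (measurable_id.prodMk (ih.prodMk h2))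

theorem measurable_runQuery {q : Ω → ℕ → Mem → X} {u : Ω → ℕ → Mem → R → Mem} {O : Ω → ℕ → X → R}
    (hq : ∀ t, Measurable fun p : Ω × Mem => q p.1 t p.2)
    (hu : ∀ t, Measurable fun p : Ω × Mem × R => u p.1 t p.2.1 p.2.2)
    (hO : ∀ t, Measurable fun p : Ω × X => O p.1 t p.2) (t₀ : ℕ) (m₀ : Mem) (n : ℕ) :
    Measurable fun ω => runQuery (q ω) (u ω) (O ω) t₀ m₀ n :=
  (hq (t₀ + n)).comp (measurable_id.prodMk (measurable_run hq hu hO t₀ m₀ n))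

end Responses

/-! ### The hard instance -/

/-- The parameters of the hard instance: `l p` strata of `2 * N p * J p` vectors for each level
`p ≤ P`, which lie in the first `D p` coordinates, and the scales of the levels. -/
structure Params where
  P : ℕ
  J : ℕ → ℕ
  N : ℕ → ℕ
  l : ℕ → ℕ
  D : ℕ → ℕ
  δ : ℕ → ℝ
  η : ℕ → ℝ

namespace Params

variable (H : Params)

/-- The number of vectors in a stratum. -/
abbrev B (p : ℕ) : ℕ := 2 * H.N p * H.J p

/-- The length of the epochs of a level. -/
def τ (p : ℕ) : ℕ := ∏ q ∈ Finset.range p, H.N q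

/-- The number of queries. -/
def T : ℕ := H.τ (H.P + 1)

/-- The thresholds of the tests. -/
def θ (p j : ℕ) : ℝ := 1 / 24 * (1 + j / H.J p)

/-- The accuracy of the tests. -/
def α (p : ℕ) : ℝ := 1 / (48 * H.J p)

abbrev Idx : Type := Σ p : Fin (H.P + 1), Fin (H.l p) × Fin (H.B p)

abbrev Slot : Type := Σ p : Fin (H.P + 1), Fin H.T × Fin (H.J p)

abbrev Sections : Type := ∀ s : H.Slot, Fin (H.l s.1) → Fin (H.B s.1)

variable {d : ℕ}

/-- The vectors of the levels. -/
def vec (G : H.Idx → EuclideanSpace ℝ (Fin d)) (p : ℕ) (i : Fin (H.l p)) (b : Fin (H.B p)) :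
    EuclideanSpace ℝ (Fin d) :=
  if h : p < H.P + 1 then trunc (H.D p) (G ⟨⟨p, h⟩, i, b⟩) else 0

/-- The vectors of a test. -/
def testVec (G : H.Idx → EuclideanSpace ℝ (Fin d)) (S : H.Sections) (p e j : ℕ) :
    Fin (H.l p) → EuclideanSpace ℝ (Fin d) :=
  if h : p < H.P + 1 ∧ e < H.T ∧ j < H.J p then
    fun i => H.vec G p i (S ⟨⟨p, h.1⟩, ⟨e, h.2.1⟩, ⟨j, h.2.2⟩⟩ i) else fun _ => 0

variable [NeZero d]

/-- The feasible set. -/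
def feasible (G : H.Idx → EuclideanSpace ℝ (Fin d)) : Set (EuclideanSpace ℝ (Fin d)) :=
  {x | ‖x‖ ≤ 1 ∧ 1 / 4 ≤ inner ℝ (EuclideanSpace.single 0 1) x ∧
    ∀ a : H.Idx, |inner ℝ (H.vec G a.1 a.2.1 a.2.2) x| ≤ 1 / 24 * H.δ a.1}

/-- The tests. -/
def tests (G : H.Idx → EuclideanSpace ℝ (Fin d)) (S : H.Sections) :
    TestSystem (Ball d) (Response d) where
  P := H.P
  J := H.J
  τ := H.τ
  adm x := 1 / 4 ≤ inner ℝ (EuclideanSpace.single 0 1) (x : EuclideanSpace ℝ (Fin d))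
  fail p e j x := H.θ p j < rampMean (H.δ p) (H.testVec G S p e j) x
  base _ := Sum.inl (-EuclideanSpace.single 0 1)
  val p e j x := Sum.inl (violated (fun _ => 1 / 24 * H.δ p) (H.testVec G S p e j) x)
  pass _ := Response.success d

open Classical in
/-- The answer of the oracle to queries that pass all tests. -/
def final (G : H.Idx → EuclideanSpace ℝ (Fin d)) (x : Ball d) : Response d :=
  if (x : EuclideanSpace ℝ (Fin d)) ∈ H.feasible G then Response.success d else
    Sum.inl (violated (fun a : H.Idx => 1 / 24 * H.δ a.1)
      (fun a : H.Idx => H.vec G a.1 a.2.1 a.2.2) x)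

/-- The oracle. -/
def oracle (G : H.Idx → EuclideanSpace ℝ (Fin d)) (S : H.Sections) : ℕ → Ball d → Response d :=
  TestSystem.resp {H.tests G S with pass := H.final G}
    (TestSystem.full {H.tests G S with pass := H.final G})

/-! ### Measurability of the oracle -/

section Measurability

theorem measurable_vec (p : ℕ) (i : Fin (H.l p)) (b : Fin (H.B p)) :
    Measurable fun G : H.Idx → EuclideanSpace ℝ (Fin d) => H.vec G p i b := by
  unfold vec
  split_ifs
  · fun_prop
  · exact measurable_const

theorem measurable_testVec (S : H.Sections) (p e j : ℕ) :
    Measurable fun G : H.Idx → EuclideanSpace ℝ (Fin d) => H.testVec G S p e j := by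
  unfold testVec
  split_ifs
  · exact measurable_pi_lambda _ fun i => H.measurable_vec p i _
  · exact measurable_const

theorem measurable_rampMean_testVec (S : H.Sections) (p e j : ℕ) :
    Measurable fun z : (H.Idx → EuclideanSpace ℝ (Fin d)) × EuclideanSpace ℝ (Fin d) =>
      rampMean (H.δ p) (H.testVec z.1 S p e j) z.2 := by
  have h1 : Measurable fun z : (H.Idx → EuclideanSpace ℝ (Fin d)) × EuclideanSpace ℝ (Fin d) =>
      (H.testVec z.1 S p e j, z.2) :=
    ((H.measurable_testVec S p e j).comp measurable_fst).prodMk measurable_snd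
  have h2 : Measurable fun z : (Fin (H.l p) → EuclideanSpace ℝ (Fin d)) × EuclideanSpace ℝ (Fin d) =>
      rampMean (H.δ p) z.1 z.2 := (continuous_rampMean (H.δ p)).measurable
  have h3 := h2.comp h1
  exact h3

theorem measurableSet_feasible : MeasurableSet
    {z : (H.Idx → EuclideanSpace ℝ (Fin d)) × EuclideanSpace ℝ (Fin d) | z.2 ∈ H.feasible z.1} := by
  refine measurableSet_setOfPred.2 (Measurable.and ?_ (Measurable.and ?_ (Measurable.forall
    fun a => ?_)))
  · exact measurableSet_setOfPred.1 (measurableSet_le measurable_snd.norm measurable_const)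
  · exact measurableSet_setOfPred.1
      (measurableSet_le measurable_const (measurable_const.inner measurable_snd))
  · have h := ((H.measurable_vec (d := d) a.1 a.2.1 a.2.2).comp (measurable_fst
      (β := EuclideanSpace ℝ (Fin d)))).inner (𝕜 := ℝ) measurable_snd
    exact measurableSet_setOfPred.1 (measurableSet_le h.abs measurable_const)

theorem measurable_final : Measurable
    fun z : (H.Idx → EuclideanSpace ℝ (Fin d)) × Ball d => H.final z.1 z.2 := by
  have hc : Measurable fun z : (H.Idx → EuclideanSpace ℝ (Fin d)) × Ball d =>
      (z.1, (z.2 : EuclideanSpace ℝ (Fin d))) := by fun_prop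
  have hv : Measurable fun z : (H.Idx → EuclideanSpace ℝ (Fin d)) × Ball d =>
      ((fun a : H.Idx => H.vec z.1 a.1 a.2.1 a.2.2), (z.2 : EuclideanSpace ℝ (Fin d))) := by
    refine Measurable.prodMk (measurable_pi_lambda _ fun a => ?_)
      (measurable_subtype_coe.comp measurable_snd)
    have h0 : Measurable fun z : (H.Idx → EuclideanSpace ℝ (Fin d)) × Ball d => z.1 :=
      measurable_fst
    have h := (H.measurable_vec (d := d) a.1 a.2.1 a.2.2).comp h0
    exact h
  have hw := (measurable_inl (β := Unit)).comp ((measurable_violated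
    (c := fun a : H.Idx => 1 / 24 * H.δ a.1)).comp hv)
  unfold final
  exact Measurable.ite (hc H.measurableSet_feasible) measurable_const hw

theorem measurable_fail (S : H.Sections) (p e j : ℕ) :
    Measurable fun z : (H.Idx → EuclideanSpace ℝ (Fin d)) × Ball d =>
      (H.tests z.1 S).fail p e j z.2 := by
  have hc : Measurable fun z : (H.Idx → EuclideanSpace ℝ (Fin d)) × Ball d =>
      (z.1, (z.2 : EuclideanSpace ℝ (Fin d))) :=
    measurable_fst.prodMk (measurable_subtype_coe.comp measurable_snd)
  have h := (H.measurable_rampMean_testVec S p e j).comp hc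
  exact measurableSet_setOfPred.1 (measurableSet_lt (measurable_const (a := H.θ p j)) h)

theorem measurable_val (S : H.Sections) (p e j : ℕ) :
    Measurable fun z : (H.Idx → EuclideanSpace ℝ (Fin d)) × Ball d =>
      (H.tests z.1 S).val p e j z.2 := by
  have h0 : Measurable fun z : (H.Idx → EuclideanSpace ℝ (Fin d)) × Ball d => z.1 :=
    measurable_fst
  have h1 : Measurable fun z : (H.Idx → EuclideanSpace ℝ (Fin d)) × Ball d =>
      (z.2 : EuclideanSpace ℝ (Fin d)) := measurable_subtype_coe.comp measurable_snd
  have h := ((H.measurable_testVec (d := d) S p e j).comp h0).prodMk h1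
  have h' := (measurable_inl (β := Unit)).comp
    ((measurable_violated (c := fun _ => 1 / 24 * H.δ p)).comp h)
  exact h'

theorem measurable_resp_tests (S : H.Sections) (cut : ℕ → ℕ → ℕ)
    {pass : (H.Idx → EuclideanSpace ℝ (Fin d)) → Ball d → Response d}
    (hpass : Measurable fun z : (H.Idx → EuclideanSpace ℝ (Fin d)) × Ball d => pass z.1 z.2)
    (t : ℕ) :
    Measurable fun z : (H.Idx → EuclideanSpace ℝ (Fin d)) × Ball d =>
      TestSystem.resp {H.tests z.1 S with pass := pass z.1} cut t z.2 := by
  have h1 := fun p => measurable_firstOf (cut p (t / H.τ p))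
    (c := fun j (z : (H.Idx → EuclideanSpace ℝ (Fin d)) × Ball d) =>
      (H.tests z.1 S).fail p (t / H.τ p) j z.2)
    (v := fun j (z : (H.Idx → EuclideanSpace ℝ (Fin d)) × Ball d) =>
      (H.tests z.1 S).val p (t / H.τ p) j z.2)
    (fun j _ => measurableSet_setOfPred.2 (H.measurable_fail S p (t / H.τ p) j))
    (fun j _ => H.measurable_val S p (t / H.τ p) j) hpass
  have h2 : ∀ p, MeasurableSet {z : (H.Idx → EuclideanSpace ℝ (Fin d)) × Ball d |
      ∃ j < cut p (t / H.τ p), (H.tests z.1 S).fail p (t / H.τ p) j z.2} := fun p =>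
    measurableSet_setOfPred.2 (Measurable.exists fun j => measurable_const.and
      (H.measurable_fail S p _ j))
  have h3 := measurable_firstOf (H.P + 1) (fun p _ => h2 p) (fun p _ => h1 p) hpass
  have hin : Measurable fun z : (H.Idx → EuclideanSpace ℝ (Fin d)) × Ball d =>
      inner ℝ (EuclideanSpace.single 0 1) (z.2 : EuclideanSpace ℝ (Fin d)) :=
    measurable_const.inner (measurable_subtype_coe.comp measurable_snd)
  exact Measurable.ite (measurableSet_le (measurable_const (a := (1 / 4 : ℝ))) hin) h3
    measurable_const

end Measurability

/-! ### The oracle separates -/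

section Correctness

theorem convex_feasible (G : H.Idx → EuclideanSpace ℝ (Fin d)) : Convex ℝ (H.feasible G) := by
  have h : H.feasible G = Metric.closedBall 0 1 ∩
      ({x | 1 / 4 ≤ inner ℝ (EuclideanSpace.single 0 1) x} ∩
        ⋂ a : H.Idx, {x | |inner ℝ (H.vec G a.1 a.2.1 a.2.2) x| ≤ 1 / 24 * H.δ a.1}) := by
    ext x
    simp [feasible]
  rw [h]
  refine (convex_closedBall _ _).inter (Convex.inter ?_ (convex_iInter fun a => ?_))
  · exact convex_halfSpace_ge (innerSL ℝ (EuclideanSpace.single 0 1)).toLinearMap.isLinear _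
  · simp only [abs_le, Set.ofPred_and]
    exact (convex_halfSpace_ge (innerSL ℝ _).toLinearMap.isLinear _).inter
      (convex_halfSpace_le (innerSL ℝ _).toLinearMap.isLinear _)

variable {H}

theorem testVec_inner_le {G : H.Idx → EuclideanSpace ℝ (Fin d)} (hδ : ∀ p ≤ H.P, 0 < H.δ p)
    {x : EuclideanSpace ℝ (Fin d)} (hx : x ∈ H.feasible G) (S : H.Sections) {p : ℕ} (hp : p ≤ H.P) (e j : ℕ)
    (i : Fin (H.l p)) : |inner ℝ (H.testVec G S p e j i) x| ≤ 1 / 24 * H.δ p := by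
  unfold testVec
  split_ifs with h
  · exact hx.2.2 ⟨⟨p, h.1⟩, i, _⟩
  · simp [(hδ p hp).le]

/-- Correlations of at most δ/24 would give a mean of at most 1/24, the lowest threshold. So
feasible points pass all tests, and a failed test supplies a violated constraint to answer with. -/
theorem exists_of_fail {G : H.Idx → EuclideanSpace ℝ (Fin d)} {S : H.Sections} {p e j : ℕ}
    (hδ : 0 < H.δ p) {x : Ball d} (h : (H.tests G S).fail p e j x) :
    ∃ i, 1 / 24 * H.δ p < |inner ℝ (H.testVec G S p e j i) (x : EuclideanSpace ℝ (Fin d))| := by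
  by_contra! hcon
  refine absurd (show H.θ p j < _ from h) (not_lt.2 ?_)
  have h1 : rampMean (H.δ p) (H.testVec G S p e j) x ≤ 1 / 24 := by
    unfold rampMean
    rcases Nat.eq_zero_or_pos (H.l p) with h0 | h0
    · simp only [h0, Nat.cast_zero, div_zero]; norm_num
    rw [div_le_iff₀ (by exact_mod_cast h0)]
    calc _ ≤ ∑ i : Fin (H.l p), (1 / 24 : ℝ) := by
          refine Finset.sum_le_sum fun i _ => (min_le_left _ _).trans ?_
          rw [div_le_iff₀ hδ]
          exact hcon i
      _ = _ := by simp; ring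
  refine h1.trans ?_
  unfold θ
  have : (0 : ℝ) ≤ (j : ℝ) / H.J p := by positivity
  linarith

theorem not_fail_of_mem {G : H.Idx → EuclideanSpace ℝ (Fin d)} (hδ : ∀ p ≤ H.P, 0 < H.δ p)
    {S : H.Sections} {p e j : ℕ} (hp : p ≤ H.P) {x : Ball d}
    (hx : (x : EuclideanSpace ℝ (Fin d)) ∈ H.feasible G) : ¬ (H.tests G S).fail p e j x := fun h => by
  obtain ⟨i, hi⟩ := exists_of_fail (hδ p hp) h
  exact absurd (testVec_inner_le hδ hx S hp e j i) (not_le.2 hi)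

theorem passes_of_mem {G : H.Idx → EuclideanSpace ℝ (Fin d)} (hδ : ∀ p ≤ H.P, 0 < H.δ p)
    (S : H.Sections) (t : ℕ) {x : Ball d} (hx : (x : EuclideanSpace ℝ (Fin d)) ∈ H.feasible G) :
    (H.tests G S).Passes (H.P + 1) t x :=
  ⟨hx.2.1, fun p hp _ _ => not_fail_of_mem hδ (by omega) hx⟩

theorem isSeparationOracle_oracle {G : H.Idx → EuclideanSpace ℝ (Fin d)}
    (hδ : ∀ p ≤ H.P, 0 < H.δ p) (S : H.Sections) (t : ℕ) :
    IsSeparationOracle (H.feasible G) (H.oracle G S t) := by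
  intro x
  rcases TestSystem.resp_full_cases {H.tests G S with pass := H.final G} t x with
    ⟨hadm, h⟩ | ⟨p, hp, j, hj, hf, h⟩ | ⟨hpass, h⟩
  · change H.oracle G S t x = _ at h
    rw [h]
    refine ⟨fun h => by simp [tests] at h, fun g hg x' hx' => ?_⟩
    obtain rfl := Sum.inl_injective hg
    have h1 : ¬ 1 / 4 ≤ inner ℝ (EuclideanSpace.single 0 1) (x : EuclideanSpace ℝ (Fin d)) := hadm
    have h2 := hx'.2.1
    rw [inner_neg_left, inner_sub_right]
    linarith
  · change H.oracle G S t x = _ at h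
    rw [h]
    refine ⟨fun h => by simp [tests] at h, fun g hg x' hx' => ?_⟩
    obtain rfl := Sum.inl_injective hg
    exact inner_violated_sub_neg (exists_of_fail (hδ p hp) hf) fun i =>
      testVec_inner_le hδ hx' S hp _ j i
  · change H.oracle G S t x = H.final G x at h
    rw [h]
    unfold final
    split_ifs with hx
    · exact ⟨fun _ => hx, fun g hg => by simp at hg⟩
    · refine ⟨fun h => by simp at h, fun g hg x' hx' => ?_⟩
      obtain rfl := Sum.inl_injective hg
      refine inner_violated_sub_neg ?_ fun a => hx'.2.2 a
      by_contra! hcon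
      exact hx ⟨mem_closedBall_zero_iff.1 x.2, hpass.1, hcon⟩

end Correctness

/-! ### Runs of the algorithm against the instance -/

section Runs

variable {M : ℕ} (A : Algorithm d M) (s : ℕ → A.Seed)

/-- The query functions of an algorithm with fixed seeds. -/
def _root_.Feasibility.Algorithm.seeded : ℕ → Memory M → Ball d := fun t m => A.query t (s t) m

/-- The update functions of an algorithm with fixed seeds. -/
def _root_.Feasibility.Algorithm.seededUpdate : ℕ → Memory M → Response d → Memory M :=
  fun t m r => A.update t (s t) m (A.query t (s t) m) r

theorem _root_.Feasibility.Algorithm.memory_eq_run (O : ℕ → Ball d → Response d) (t : ℕ) :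
    A.memory O s t = run (A.seeded s) (A.seededUpdate s) O 0 (fun _ => false) t := by
  induction t with
  | zero => rfl
  | succ t ih => simp only [Algorithm.memory, run, ih, Nat.zero_add]; rfl

theorem _root_.Feasibility.Algorithm.queryAt_eq_runQuery (O : ℕ → Ball d → Response d) (t : ℕ) :
    A.queryAt O s t = runQuery (A.seeded s) (A.seededUpdate s) O 0 (fun _ => false) t := by
  rw [Algorithm.queryAt, runQuery, A.memory_eq_run, Nat.zero_add]; rfl

/-- Some query passes all tests. -/
def Wins (G : H.Idx → EuclideanSpace ℝ (Fin d)) (S : H.Sections) : Prop :=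
  ∃ t < H.T, (H.tests G S).Passes (H.P + 1) t (runQuery (A.seeded s) (A.seededUpdate s)
    ((H.tests G S).resp (H.tests G S).full) 0 (fun _ => false) t)

theorem measurable_seeded (t : ℕ) :
    Measurable fun p : (ℕ → A.Seed) × Memory M => A.seeded p.1 t p.2 :=
  (A.measurable_query t).comp (by fun_prop : Measurable
    fun p : (ℕ → A.Seed) × Memory M => (p.1 t, p.2))

theorem measurable_seededUpdate (t : ℕ) :
    Measurable fun p : (ℕ → A.Seed) × Memory M × Response d =>
      A.seededUpdate p.1 t p.2.1 p.2.2 := by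
  have h1 : Measurable fun p : (ℕ → A.Seed) × Memory M × Response d => A.query t (p.1 t) p.2.1 :=
    (A.measurable_query t).comp (by fun_prop : Measurable
      fun p : (ℕ → A.Seed) × Memory M × Response d => (p.1 t, p.2.1))
  have h2 : Measurable fun p : (ℕ → A.Seed) × Memory M × Response d =>
      (p.1 t, p.2.1, A.query t (p.1 t) p.2.1, p.2.2) :=
    ((measurable_pi_apply t).comp measurable_fst).prodMk
      ((measurable_fst.comp measurable_snd).prodMk (h1.prodMk (measurable_snd.comp measurable_snd)))
  have h3 := (A.measurable_update t).comp h2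
  exact h3

/-- For fixed sections, the queries are measurable in the seeds and the vectors. -/
theorem measurable_runQuery_tests (S : H.Sections) (cut : ℕ → ℕ → ℕ) (t₀ : ℕ) (m₀ : Memory M) (n : ℕ) :
    Measurable fun z : (ℕ → A.Seed) × (H.Idx → EuclideanSpace ℝ (Fin d)) =>
      runQuery (A.seeded z.1) (A.seededUpdate z.1) ((H.tests z.2 S).resp cut) t₀ m₀ n := by
  refine measurable_runQuery (q := fun z : (ℕ → A.Seed) × (H.Idx → EuclideanSpace ℝ (Fin d)) =>
    A.seeded z.1) (u := fun z => A.seededUpdate z.1) (O := fun z => (H.tests z.2 S).resp cut)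
    (fun t => ?_) (fun t => ?_) (fun t => ?_) t₀ m₀ n
  · have h0 : Measurable fun w : ((ℕ → A.Seed) × (H.Idx → EuclideanSpace ℝ (Fin d))) × Memory M =>
        (w.1.1, w.2) := (measurable_fst.comp measurable_fst).prodMk measurable_snd
    have h := (measurable_seeded A t).comp h0
    exact h
  · have h0 : Measurable fun w : ((ℕ → A.Seed) × (H.Idx → EuclideanSpace ℝ (Fin d))) ×
        Memory M × Response d => (w.1.1, w.2) :=
      (measurable_fst.comp measurable_fst).prodMk measurable_snd
    have h := (measurable_seededUpdate A t).comp h0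
    exact h
  · have h0 : Measurable fun w : ((ℕ → A.Seed) × (H.Idx → EuclideanSpace ℝ (Fin d))) × Ball d =>
        (w.1.2, w.2) := (measurable_snd.comp measurable_fst).prodMk measurable_snd
    have h := (H.measurable_resp_tests S cut (pass := fun _ _ => Response.success d)
      measurable_const t).comp h0
    exact h

theorem measurable_passes_runQuery_tests (S : H.Sections) (cut : ℕ → ℕ → ℕ) (t₀ : ℕ)
    (m₀ : Memory M) (n p t : ℕ) :
    Measurable fun z : (ℕ → A.Seed) × (H.Idx → EuclideanSpace ℝ (Fin d)) =>
      (H.tests z.2 S).Passes p t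
        (runQuery (A.seeded z.1) (A.seededUpdate z.1) ((H.tests z.2 S).resp cut) t₀ m₀ n) := by
  have hx := measurable_subtype_coe.comp (H.measurable_runQuery_tests A S cut t₀ m₀ n)
  refine Measurable.and (measurableSet_setOfPred.1
    (measurableSet_le measurable_const (measurable_const.inner hx))) ?_
  refine Measurable.forall fun p' => Measurable.forall fun hp' => Measurable.forall fun j => ?_
  by_cases hj : j < H.J p'
  · have h := (H.measurable_rampMean_testVec S p' (t / H.τ p') j).comp
      ((measurable_snd (α := ℕ → A.Seed)).prodMk hx)
    have h' := measurableSet_setOfPred.1 (measurableSet_lt (measurable_const (a := H.θ p' j)) h)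
    convert h'.not using 2 with z
    exact ⟨fun h => h hj, fun h _ => h⟩
  · convert measurable_const (a := True) using 2 with z
    exact iff_true_intro fun h => absurd h hj

theorem measurableSet_wins : MeasurableSet
    {z : H.Sections × ((ℕ → A.Seed) × (H.Idx → EuclideanSpace ℝ (Fin d))) |
      H.Wins A z.2.1 z.2.2 z.1} := by
  have h : ∀ S : H.Sections, MeasurableSet
      {z : (ℕ → A.Seed) × (H.Idx → EuclideanSpace ℝ (Fin d)) | H.Wins A z.1 z.2 S} := fun S =>
    measurableSet_setOfPred.2 (Measurable.exists fun t => measurable_const.and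
      (H.measurable_passes_runQuery_tests A S (TestSystem.full (H.tests (d := d) 0 S)) 0 (fun _ => false) t _ t))
  -- There are only finitely many sections, so measurability for each fixed one is enough.
  refine measurableSet_setOfPred.2 (measurable_from_prod_countable_right fun S => ?_)
  exact measurableSet_setOfPred.1 (h S)

theorem measurable_oracle (G : H.Idx → EuclideanSpace ℝ (Fin d)) (t : ℕ) :
    Measurable fun z : H.Sections × Ball d => H.oracle G z.1 t z.2 := by
  refine measurable_from_prod_countable_right fun S => ?_
  have h := (H.measurable_resp_tests S (TestSystem.full (H.tests (d := d) 0 S)) H.measurable_final t).comp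
    ((measurable_const (a := G)).prodMk measurable_id)
  exact h

end Runs

/-- The feasibility problem given by vectors `G` with random sections. -/
def problem [∀ p : Fin (H.P + 1), NeZero (H.B p)] (G : H.Idx → EuclideanSpace ℝ (Fin d)) {ε : ℝ}
    (hδ : ∀ p ≤ H.P, 0 < H.δ p) (hG : ∃ c, Metric.closedBall c ε ⊆ H.feasible G) :
    Problem d ε where
  Q := H.feasible G
  convex := H.convex_feasible G
  subset_ball _ hx := mem_closedBall_zero_iff.2 hx.1
  contains_ball := hG
  Ω := H.Sections
  law := Measure.pi fun s : H.Slot => sectionLaw (H.l s.1) (H.B s.1)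
  oracle t S := H.oracle G S t
  measurable_oracle := H.measurable_oracle G
  separates t S := isSeparationOracle_oracle hδ S t

/-- A feasible query passes all tests, and by `TestSystem.exists_passes_of_pass` the run against the
placeholder oracle then has such a query as well. -/
theorem le_prod_wins {M : ℕ} {A : Algorithm d M} {ε : ℝ} (hA : A.Solves ε H.T (9 / 10))
    [∀ p : Fin (H.P + 1), NeZero (H.B p)] (hδ : ∀ p ≤ H.P, 0 < H.δ p)
    {G : H.Idx → EuclideanSpace ℝ (Fin d)} (hG : ∃ c, Metric.closedBall c ε ⊆ H.feasible G) :
    ENNReal.ofReal (9 / 10) ≤ ((Measure.infinitePi A.seedLaw).prod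
      (Measure.pi fun s : H.Slot => sectionLaw (H.l s.1) (H.B s.1))) {z | H.Wins A z.1 G z.2} := by
  have h := hA (H.problem G hδ hG)
  rw [Algorithm.successProb, Measure.real] at h
  refine (ENNReal.ofReal_le_of_le_toReal h).trans (measure_mono ?_)
  rintro ⟨s, S⟩ ⟨t, ht, hx⟩
  refine TestSystem.exists_passes_of_pass (S := H.tests G S) (H.final G) _ _ _ ⟨t, ht, ?_⟩
  refine passes_of_mem hδ S t ?_
  rw [A.queryAt_eq_runQuery] at hx
  exact hx

end Params

end

end Feasibility

namespace Feasibility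

noncomputable section

open ProbabilityTheory
open scoped ENNReal

/-! ### Small correlations with many Gaussian vectors are unlikely -/

section SmallRamps

variable {ι E : Type*} [Fintype ι] [NormedAddCommGroup E] [InnerProductSpace ℝ E]
  [FiniteDimensional ℝ E] [MeasurableSpace E] [BorelSpace E]

/-- Markov's inequality for exp(-4 ∑ ramp): the vectors in `A` are independent, and each contributes
at most e^{-3k} by `lintegral_prod_inner_le`. -/
theorem measure_sum_ramp_le (A : Finset ι) {δ η : ℝ} (hδ : 0 < δ) (hη : 60 * δ ≤ η) {k : ℕ}
    {y : ℕ → E} (hy : Robust η k y) (b : ℝ) :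
    (Measure.pi fun _ : ι => stdGaussian E)
      {G | ∑ a ∈ A, ∑ j ∈ Finset.range k, ramp δ (inner ℝ (G a) (y j)) ≤ b}
      ≤ ENNReal.ofReal (Real.exp (4 * b - 3 * k * A.card)) := by
  classical
  have hrm : Measurable (ramp δ) := (continuous_ramp δ).measurable
  set ψ : ℝ → ℝ≥0∞ := fun t => ENNReal.ofReal (Real.exp (-4 * ramp δ t)) with hψ
  have hψm : Measurable ψ := by rw [hψ]; fun_prop
  set f : E → ℝ≥0∞ := fun g => ∏ j ∈ Finset.range k, ψ (inner ℝ g (y j)) with hf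
  have hfm : Measurable f := Finset.measurable_prod _ fun j _ =>
    hψm.comp (measurable_id.inner measurable_const)
  have h1 : ∫⁻ g, f g ∂(stdGaussian E) ≤ ENNReal.ofReal (Real.exp (-3)) ^ k :=
    lintegral_prod_inner_le (by linarith) hψm
      (fun s σ hσ => lintegral_exp_ramp_le hδ hη s σ hσ) k y hy
  have h2 : ∫⁻ G : ι → E, ∏ a ∈ A, f (G a) ∂(Measure.pi fun _ : ι => stdGaussian E)
      ≤ ENNReal.ofReal (Real.exp (-(3 * k * A.card))) := by
    rw [lintegral_pi_prod (fun _ : ι => stdGaussian E) A (f := fun _ => f) fun _ => hfm,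
      Finset.prod_const]
    calc _ ≤ (ENNReal.ofReal (Real.exp (-3)) ^ k) ^ A.card := by gcongr
      _ = _ := by
        rw [← pow_mul, ← ENNReal.ofReal_pow (Real.exp_pos _).le, ← Real.exp_nat_mul]
        congr 2
        push_cast
        ring
  have h3 : ∀ G : ι → E, ∏ a ∈ A, f (G a) = ENNReal.ofReal (Real.exp
      (-4 * ∑ a ∈ A, ∑ j ∈ Finset.range k, ramp δ (inner ℝ (G a) (y j)))) := by
    intro G
    simp only [hf, hψ]
    rw [Finset.mul_sum, Real.exp_sum, ENNReal.ofReal_prod_of_nonneg fun _ _ => (Real.exp_pos _).le]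
    refine Finset.prod_congr rfl fun a _ => ?_
    rw [Finset.mul_sum, Real.exp_sum, ENNReal.ofReal_prod_of_nonneg fun _ _ => (Real.exp_pos _).le]
  have hpos : ENNReal.ofReal (Real.exp (-4 * b)) ≠ 0 := by simp [Real.exp_pos]
  calc _ ≤ (Measure.pi fun _ : ι => stdGaussian E)
        {G | ENNReal.ofReal (Real.exp (-4 * b)) ≤ ∏ a ∈ A, f (G a)} := by
        refine measure_mono fun G hG => ?_
        rw [Set.mem_ofPred_eq] at hG ⊢
        rw [h3]
        exact ENNReal.ofReal_le_ofReal (Real.exp_le_exp.2 (by linarith))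
    _ ≤ (∫⁻ G : ι → E, ∏ a ∈ A, f (G a) ∂(Measure.pi fun _ : ι => stdGaussian E)) /
          ENNReal.ofReal (Real.exp (-4 * b)) :=
        meas_ge_le_lintegral_div (Finset.measurable_prod _ fun a _ =>
          hfm.comp (measurable_pi_apply a)).aemeasurable hpos ENNReal.ofReal_ne_top
    _ ≤ ENNReal.ofReal (Real.exp (-(3 * k * A.card))) / ENNReal.ofReal (Real.exp (-4 * b)) := by
        gcongr
    _ = _ := by
        rw [← ENNReal.ofReal_div_of_pos (Real.exp_pos _), ← Real.exp_sub]
        congr 2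
        ring

end SmallRamps

/-! ### Vectors not used during an epoch -/

namespace Params

variable {H : Params} {d : ℕ} [NeZero d]

theorem τ_succ (p : ℕ) : H.τ (p + 1) = H.τ p * H.N p := Finset.prod_range_succ _ _

/-- The answers at time `t` only depend on the vectors of the tests at this time. -/
theorem resp_tests_congr {G G' : H.Idx → EuclideanSpace ℝ (Fin d)} {S S' : H.Sections}
    {cut : ℕ → ℕ → ℕ} {t : ℕ}
    (h : ∀ p ≤ H.P, ∀ j < cut p (t / H.τ p),
      H.testVec G S p (t / H.τ p) j = H.testVec G' S' p (t / H.τ p) j) (x : Ball d) :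
    (H.tests G S).resp cut t x = (H.tests G' S').resp cut t x := by
  have hf : ∀ p ≤ H.P, ∀ j < cut p (t / H.τ p),
      ((H.tests G S).fail p (t / H.τ p) j x ↔ (H.tests G' S').fail p (t / H.τ p) j x) ∧
      (H.tests G S).val p (t / H.τ p) j x = (H.tests G' S').val p (t / H.τ p) j x := by
    intro p hp j hj
    simp only [tests, h p hp j hj, and_self]
  have key : firstOf (H.P + 1)
        (fun p => ∃ j < cut p (t / H.τ p), (H.tests G S).fail p (t / H.τ p) j x)
        (fun p => firstOf (cut p (t / H.τ p)) (fun j => (H.tests G S).fail p (t / H.τ p) j x)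
          (fun j => (H.tests G S).val p (t / H.τ p) j x) (Response.success d)) (Response.success d)
      = firstOf (H.P + 1)
        (fun p => ∃ j < cut p (t / H.τ p), (H.tests G' S').fail p (t / H.τ p) j x)
        (fun p => firstOf (cut p (t / H.τ p)) (fun j => (H.tests G' S').fail p (t / H.τ p) j x)
          (fun j => (H.tests G' S').val p (t / H.τ p) j x) (Response.success d))
          (Response.success d) := by
    refine firstOf_congr fun p hp _ => ⟨⟨?_, ?_⟩, fun _ => ?_⟩
    · rintro ⟨j, hj, hfj⟩; exact ⟨j, hj, (hf p (by omega) j hj).1.1 hfj⟩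
    · rintro ⟨j, hj, hfj⟩; exact ⟨j, hj, (hf p (by omega) j hj).1.2 hfj⟩
    · exact firstOf_congr fun j hj _ => ⟨(hf p (by omega) j hj).1, fun _ => (hf p (by omega) j hj).2⟩
  unfold TestSystem.resp
  split_ifs with h1 h2 h2
  · exact key
  · exact absurd h1 h2
  · exact absurd h2 h1
  · rfl

/-- The vectors of level `p` that are not used by the tests in the epoch `e` of level `p + 1`. -/
def unused (S : H.Sections) (p : Fin (H.P + 1)) (e : ℕ) :
    Finset (Fin (H.l p) × Fin (H.B p)) :=
  {a | ∀ (e' : Fin H.T) (j : Fin (H.J p)), (e' : ℕ) / H.N p = e → S ⟨p, e', j⟩ a.1 ≠ a.2}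

/-- An epoch of level p + 1 comprises at most `N p` epochs of level p with `J p` sections each, and
a section takes one vector per stratum: at least half of the 2 N J vectors of each stratum remain.
-/
theorem le_card_unused (S : H.Sections) (p : Fin (H.P + 1)) (hN : 0 < H.N p) (e : ℕ) :
    H.l p * H.N p * H.J p ≤ (unused S p e).card := by
  classical
  set E : Finset (Fin H.T) := {e' | (e' : ℕ) / H.N p = e} with hE
  have hEc : E.card ≤ H.N p := by
    have : (E.image fun e' : Fin H.T => (e' : ℕ) % H.N p) ⊆ Finset.range (H.N p) := by
      intro n hn
      obtain ⟨e', _, rfl⟩ := Finset.mem_image.1 hn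
      exact Finset.mem_range.2 (Nat.mod_lt _ hN)
    calc E.card = (E.image fun e' : Fin H.T => (e' : ℕ) % H.N p).card := by
          refine (Finset.card_image_of_injOn fun a ha b hb hab => ?_).symm
          have ha' : (a : ℕ) / H.N p = e := by simpa [hE] using ha
          have hb' : (b : ℕ) / H.N p = e := by simpa [hE] using hb
          have h1 := Nat.div_add_mod (a : ℕ) (H.N p)
          have h2 := Nat.div_add_mod (b : ℕ) (H.N p)
          replace hab : (a : ℕ) % H.N p = b % H.N p := hab
          rw [ha', hab] at h1
          rw [hb'] at h2
          exact Fin.ext (h1.symm.trans h2)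
      _ ≤ _ := by simpa using Finset.card_le_card this
  have hsub : (unused S p e)ᶜ ⊆ (E ×ˢ (Finset.univ : Finset (Fin (H.J p) × Fin (H.l p)))).image
      fun z => (z.2.2, S ⟨p, z.1, z.2.1⟩ z.2.2) := by
    intro a ha
    simp only [unused, Finset.mem_compl, Finset.mem_filter, Finset.mem_univ, true_and] at ha
    push Not at ha
    obtain ⟨e', j, he, hS⟩ := ha
    exact Finset.mem_image.2 ⟨(e', j, a.1), by simp [hE, he], Prod.ext rfl hS⟩
  have h1 : (unused S p e)ᶜ.card ≤ H.N p * (H.J p * H.l p) := by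
    refine (Finset.card_le_card hsub).trans (Finset.card_image_le.trans ?_)
    rw [Finset.card_product, Finset.card_univ, Fintype.card_prod, Fintype.card_fin, Fintype.card_fin]
    exact Nat.mul_le_mul_right _ hEc
  have h2 := Finset.card_add_card_compl (unused S p e)
  rw [Fintype.card_prod, Fintype.card_fin, Fintype.card_fin] at h2
  have h3 : H.l p * H.B p = H.l p * H.N p * H.J p + H.N p * (H.J p * H.l p) := by
    rw [B]; ring
  omega

variable {M : ℕ} (q : ℕ → Memory M → Ball d) (u : ℕ → Memory M → Response d → Memory M)

/-- The queries made from the start of the epoch `e` of level `p + 1`. -/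
def epochQuery (G : H.Idx → EuclideanSpace ℝ (Fin d)) (S : H.Sections) (p e : ℕ) (m : Memory M)
    (n : ℕ) : Ball d :=
  runQuery q u ((H.tests G S).resp (H.tests G S).full) (e * H.τ (p + 1)) m n

/-- With the memory state at the start of the epoch prescribed, the queries see `G` only through the
tests of this epoch, which at level p consult no unused vector. -/
theorem epochQuery_congr {G G' : H.Idx → EuclideanSpace ℝ (Fin d)} {S : H.Sections}
    {p : Fin (H.P + 1)} {e : ℕ}
    (h : ∀ a, (∀ c ∈ unused S p e, a ≠ ⟨p, c⟩) → G a = G' a) (m : Memory M) {n : ℕ}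
    (hn : (e * H.τ (p + 1) + n) / H.τ (p + 1) = e) :
    epochQuery q u G S p e m n = epochQuery q u G' S p e m n := by
  unfold epochQuery
  refine (runQuery_congr (N := n) (fun n' hn' => ?_) n le_rfl).symm
  have hlt : (e * H.τ (p + 1) + n') / H.τ (p + 1) = e := by
    refine le_antisymm ?_ ?_
    · calc _ ≤ (e * H.τ (p + 1) + n) / H.τ (p + 1) := Nat.div_le_div_right (by omega)
        _ = e := hn
    · rcases Nat.eq_zero_or_pos (H.τ (p + 1)) with h0 | h0
      · rw [h0, Nat.div_zero] at hn ⊢; omega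
      · rw [Nat.le_div_iff_mul_le h0]; omega
  refine resp_tests_congr (fun p' hp' j hj => ?_) _
  unfold testVec
  split_ifs with hc
  · funext i
    unfold vec
    rw [dif_pos hc.1, dif_pos hc.1, h]
    rintro ⟨i', b⟩ hmem heq
    obtain ⟨h1, h2⟩ := Sigma.mk.inj_iff.1 heq
    obtain ⟨p, hp⟩ := p
    obtain rfl : p' = p := congrArg Fin.val h1
    obtain ⟨rfl, rfl⟩ := Prod.mk_inj.1 (eq_of_heq h2)
    simp only [unused, Finset.mem_filter, Finset.mem_univ, true_and] at hmem
    refine hmem ⟨_, hc.2.1⟩ ⟨j, hc.2.2⟩ ?_ rfl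
    simp only
    -- The epoch of level p at a given time lies in the epoch of level p + 1 at that time, since τ
    -- (p+1) = τ p · N p.
    rw [Nat.div_div_eq_div_mul, ← τ_succ]
    exact hlt
  · rfl


/-- The means of level `p`. -/
def mean (G : H.Idx → EuclideanSpace ℝ (Fin d)) (p : ℕ) (x : EuclideanSpace ℝ (Fin d)) : ℝ :=
  fullMean (H.δ p) (H.vec G p) x

theorem measurable_mean (p : ℕ) :
    Measurable fun z : (H.Idx → EuclideanSpace ℝ (Fin d)) × EuclideanSpace ℝ (Fin d) =>
      mean z.1 p z.2 := by
  have h0 : Measurable fun G : H.Idx → EuclideanSpace ℝ (Fin d) => H.vec G p :=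
    measurable_pi_lambda _ fun i => measurable_pi_lambda _ fun b => H.measurable_vec p i b
  have h1 : Measurable fun z : (H.Idx → EuclideanSpace ℝ (Fin d)) × EuclideanSpace ℝ (Fin d) =>
      (H.vec z.1 p, z.2) := (h0.comp measurable_fst).prodMk measurable_snd
  have h2 : Measurable fun z : (Fin (H.l p) → Fin (H.B p) → EuclideanSpace ℝ (Fin d)) ×
      EuclideanSpace ℝ (Fin d) => fullMean (H.δ p) z.1 z.2 :=
    (continuous_fullMean (H.δ p)).measurable
  have h3 := h2.comp h1
  exact h3

theorem sum_ramp_le_of_mean_le {G : H.Idx → EuclideanSpace ℝ (Fin d)} {p : Fin (H.P + 1)}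
    (hδ : 0 < H.δ p) (hl : 0 < H.l p) (hB : 0 < H.B p) {x : EuclideanSpace ℝ (Fin d)} {c : ℝ}
    (h : mean G p x ≤ c) (A : Finset (Fin (H.l p) × Fin (H.B p))) :
    ∑ a ∈ A, ramp (H.δ p) (inner ℝ (G ⟨p, a⟩) (trunc (H.D p) x)) ≤ c * (H.l p * H.B p) := by
  have hl' : (0 : ℝ) < H.l p := by exact_mod_cast hl
  have hB' : (0 : ℝ) < H.B p := by exact_mod_cast hB
  calc _ ≤ ∑ a, ramp (H.δ p) (inner ℝ (G ⟨p, a⟩) (trunc (H.D p) x)) :=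
        Finset.sum_le_sum_of_subset_of_nonneg (Finset.subset_univ _)
          fun _ _ _ => ramp_nonneg hδ.le _
    _ = mean G p x * (H.l p * H.B p) := by
        rw [Fintype.sum_prod_type]
        unfold mean fullMean
        simp_rw [← Finset.sum_div]
        rw [div_div, mul_comm (H.l p : ℝ), div_mul_cancel₀ _ (by positivity)]
        refine Finset.sum_congr rfl fun i _ => Finset.sum_congr rfl fun b _ => ?_
        unfold vec
        rw [dif_pos p.2, inner_trunc_left]
    _ ≤ _ := by gcongr

theorem measurableSet_epoch
    (hqu : ∀ (S : H.Sections) (cut : ℕ → ℕ → ℕ) (t₀ : ℕ) (m : Memory M) (n : ℕ),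
      Measurable fun G : H.Idx → EuclideanSpace ℝ (Fin d) =>
        runQuery q u ((H.tests G S).resp cut) t₀ m n)
    (S : H.Sections) (p : ℕ) (η : ℝ) (e : ℕ) (m : Memory M) (k : ℕ) (r : ℕ → ℕ) :
    MeasurableSet {G : H.Idx → EuclideanSpace ℝ (Fin d) |
      Robust η k (fun j => trunc (H.D p) (epochQuery q u G S p e m (r j) :
          EuclideanSpace ℝ (Fin d))) ∧
        ∀ j < k, mean G p (epochQuery q u G S p e m (r j)) ≤ 1 / 8} := by
  have hx : ∀ n, Measurable fun G : H.Idx → EuclideanSpace ℝ (Fin d) =>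
      (epochQuery q u G S p e m n : EuclideanSpace ℝ (Fin d)) := fun n =>
    measurable_subtype_coe.comp (hqu S (fun p _ => H.J p) _ m n)
  refine measurableSet_setOfPred.2 (Measurable.and ?_ (Measurable.forall fun j =>
    Measurable.forall fun _ => ?_))
  · have h1 : Measurable fun G : H.Idx → EuclideanSpace ℝ (Fin d) => fun j =>
        trunc (H.D p) (epochQuery q u G S p e m (r j) : EuclideanSpace ℝ (Fin d)) :=
      measurable_pi_lambda _ fun j => (trunc (H.D p)).continuous.measurable.comp (hx (r j))
    exact measurableSet_setOfPred.1 (h1 (isClosed_robust η k).measurableSet)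
  · have h1 := (measurable_mean (H := H) (d := d) p).comp (measurable_id.prodMk (hx (r j)))
    exact measurableSet_setOfPred.1 (measurableSet_le h1 (measurable_const (a := (1 / 8 : ℝ))))

/-- The unused vectors are redrawn while the queries stay put. Small means bound the sum of their
ramps by k · (1/8) · l · B = k l N J / 4, and `measure_sum_ramp_le` gives the exponent k l N J - 3 k
l N J. -/
theorem measure_epoch_le
    (hqu : ∀ (S : H.Sections) (cut : ℕ → ℕ → ℕ) (t₀ : ℕ) (m : Memory M) (n : ℕ),
      Measurable fun G : H.Idx → EuclideanSpace ℝ (Fin d) =>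
        runQuery q u ((H.tests G S).resp cut) t₀ m n)
    (S : H.Sections) (p : Fin (H.P + 1)) (hδ : 0 < H.δ p) (hl : 0 < H.l p) (hN : 0 < H.N p)
    (hJ : 0 < H.J p) {η : ℝ} (hη : 60 * H.δ p ≤ η) (e : ℕ) (m : Memory M) (k : ℕ) (r : ℕ → ℕ)
    (hr : ∀ j < k, (e * H.τ (p + 1) + r j) / H.τ (p + 1) = e) :
    (Measure.pi fun _ : H.Idx => stdGaussian (EuclideanSpace ℝ (Fin d)))
      {G | Robust η k (fun j => trunc (H.D p) (epochQuery q u G S p e m (r j) :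
          EuclideanSpace ℝ (Fin d))) ∧
        ∀ j < k, mean G p (epochQuery q u G S p e m (r j)) ≤ 1 / 8}
      ≤ ENNReal.ofReal (Real.exp (-(2 * k * (H.l p * H.N p * H.J p)))) := by
  classical
  have hmeas := measurableSet_epoch q u hqu S p η e m k r
  set A : Finset H.Idx := (unused S p e).map (Function.Embedding.sigmaMk p) with hA
  refine measure_pi_le_of_resample _ (A : Set H.Idx) hmeas fun G₀ => ?_
  have hq : ∀ (G : H.Idx → EuclideanSpace ℝ (Fin d)), ∀ j < k,
      epochQuery q u (resample (A : Set H.Idx) G₀ G) S p e m (r j)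
        = epochQuery q u G₀ S p e m (r j) := by
    intro G j hj
    refine epochQuery_congr q u (fun a ha => ?_) m (hr j hj)
    rw [resample, if_neg]
    intro hmem
    obtain ⟨c, hc, rfl⟩ := Finset.mem_map.1 (Finset.mem_coe.1 hmem)
    exact ha c hc rfl
  set y : ℕ → EuclideanSpace ℝ (Fin d) := fun j =>
    trunc (H.D p) (epochQuery q u G₀ S p e m (r j) : EuclideanSpace ℝ (Fin d)) with hy
  by_cases hrob : Robust η k y
  · refine (measure_mono fun G hG => ?_).trans ((measure_sum_ramp_le A hδ hη hrob
      (k * (1 / 8 * (H.l p * H.B p)))).trans (ENNReal.ofReal_le_ofReal (Real.exp_le_exp.2 ?_)))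
    · obtain ⟨-, hG⟩ := hG
      rw [Set.mem_ofPred_eq, Finset.sum_comm]
      calc _ ≤ ∑ j ∈ Finset.range k, 1 / 8 * ((H.l p : ℝ) * (H.B p : ℕ)) := by
            refine Finset.sum_le_sum fun j hj => ?_
            have h1 := hG j (Finset.mem_range.1 hj)
            rw [hq G j (Finset.mem_range.1 hj)] at h1
            refine le_trans (le_of_eq ?_) (sum_ramp_le_of_mean_le hδ hl (by positivity) h1
              (unused S p e))
            rw [Finset.sum_map]
            refine Finset.sum_congr rfl fun c hc => ?_
            simp only [hy]
            have hmem : (⟨p, c⟩ : H.Idx) ∈ (A : Set H.Idx) :=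
              Finset.mem_coe.2 (Finset.mem_map.2 ⟨c, hc, rfl⟩)
            have hval : resample (A : Set H.Idx) G₀ G ⟨p, c⟩ = G ⟨p, c⟩ := if_pos hmem
            rw [hval]
            rfl
        _ = _ := by simp
    · have h1 : ((H.l p * H.N p * H.J p : ℕ) : ℝ) ≤ A.card := by
        rw [hA, Finset.card_map]
        exact_mod_cast le_card_unused S p hN e
      push_cast at h1 ⊢
      have h2 := mul_le_mul_of_nonneg_left h1 (by positivity : (0 : ℝ) ≤ 3 * k)
      nlinarith
  -- The frozen queries are not robustly independent, so the event is empty.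
  · refine le_trans (le_of_eq ?_) zero_le
    rw [measure_eq_zero_iff_ae_notMem]
    refine Filter.Eventually.of_forall fun G hG => hrob ?_
    have hyq : ∀ j < k, trunc (H.D p) (epochQuery q u (resample (A : Set H.Idx) G₀ G) S p e m (r j) :
        EuclideanSpace ℝ (Fin d)) = y j := fun j hj => by rw [hq G j hj]
    intro i hi c
    have h1 := hG.1 i hi c
    simp only at h1
    rwa [hyq i hi, Finset.sum_congr rfl fun j hj => by
      rw [hyq j ((Finset.mem_range.1 hj).trans hi)]] at h1

end Params

end

end Feasibility

namespace Feasibility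

noncomputable section

open ProbabilityTheory
open scoped ENNReal

/-! ### Correlation bounds for families of Gaussian vectors -/

section Correlations

variable {d : ℕ} {ι : Type*} [Fintype ι]

/-- With the right signs, the ℓ₁-norm of the correlations is the inner product of `r` with a signed
sum. Each of the 2^l signed sums is √l times a standard Gaussian vector, and 2^l ≤ e^l. -/
theorem measure_not_corrBound_le {l : ℕ} (hl : 0 < l) (n : ℕ) {f : Fin l → ι}
    (hf : Function.Injective f) :
    (Measure.pi fun _ : ι => stdGaussian (EuclideanSpace ℝ (Fin d)))
      {G | ¬ CorrBound (4 * √(l * n)) fun i => trunc n (G (f i))}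
      ≤ ENNReal.ofReal (Real.exp (l - 3.5 * n)) := by
  classical
  set sg : Bool → ℝ := fun b => if b then 1 else -1 with hsg
  have hsg2 : ∀ b, sg b ^ 2 = 1 := fun b => by cases b <;> simp [hsg]
  set c : (Fin l → Bool) → ι → ℝ := fun σ => Function.extend f (fun i => sg (σ i)) 0 with hc
  have hcf : ∀ σ i, c σ (f i) = sg (σ i) := fun σ i => hf.extend_apply _ _ i
  have hc0 : ∀ σ, ∀ a ∉ Set.range f, c σ a = 0 := fun σ a ha =>
    Function.extend_apply' _ _ a fun ⟨i, hi⟩ => ha ⟨i, hi⟩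
  have hsum : ∀ σ, ∑ a, c σ a ^ 2 = (l : ℝ) := by
    intro σ
    rw [← Fintype.sum_of_injective f hf (fun i => sg (σ i) ^ 2) _
      (fun a ha => by rw [hc0 σ a ha]; simp) fun i => by rw [hcf]]
    simp [hsg2]
  have hvec : ∀ σ (G : ι → EuclideanSpace ℝ (Fin d)),
      ∑ a, c σ a • G a = ∑ i, sg (σ i) • G (f i) := fun σ G =>
    (Fintype.sum_of_injective f hf _ _ (fun a ha => by rw [hc0 σ a ha, zero_smul])
      fun i => by rw [hcf]).symm
  have hsub : {G : ι → EuclideanSpace ℝ (Fin d) |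
      ¬ CorrBound (4 * √(l * n)) fun i => trunc n (G (f i))} ⊆
      ⋃ σ : Fin l → Bool, {G | 4 * √(l * n) < ‖trunc n (∑ a, c σ a • G a)‖} := by
    intro G hG
    rw [Set.mem_iUnion]
    by_contra! hcon
    refine hG fun r => ?_
    set σ : Fin l → Bool := fun i => decide (0 ≤ inner ℝ (trunc n (G (f i))) r) with hσ
    have h1 : ∑ i, |inner ℝ (trunc n (G (f i))) r| = inner ℝ (trunc n (∑ a, c σ a • G a)) r := by
      rw [hvec, map_sum, sum_inner]
      refine Finset.sum_congr rfl fun i _ => ?_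
      rw [map_smul, real_inner_smul_left]
      by_cases h : 0 ≤ inner ℝ (trunc n (G (f i))) r
      · simp [hσ, hsg, h, abs_of_nonneg h]
      · simp [hσ, hsg, h, abs_of_neg (not_le.1 h)]
    have h2 := hcon σ
    rw [Set.mem_ofPred_eq, not_lt] at h2
    rw [h1]
    exact (real_inner_le_norm _ _).trans (mul_le_mul_of_nonneg_right h2 (norm_nonneg _))
  have hl' : (0 : ℝ) < l := by exact_mod_cast hl
  calc _ ≤ ∑ σ : Fin l → Bool, ENNReal.ofReal (Real.exp (-3.5 * n)) :=
        (measure_mono hsub).trans ((measure_iUnion_fintype_le _ _).trans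
          (Finset.sum_le_sum fun σ _ => measure_norm_trunc_sum_le n (c σ) hl' (hsum σ)))
    _ = ENNReal.ofReal (2 ^ l * Real.exp (-3.5 * n)) := by
        rw [Finset.sum_const, Finset.card_univ, Fintype.card_fun, Fintype.card_bool,
          Fintype.card_fin, nsmul_eq_mul, ENNReal.ofReal_mul (by positivity),
          ENNReal.ofReal_pow (by norm_num)]
        simp
    _ ≤ _ := by
        refine ENNReal.ofReal_le_ofReal ?_
        rw [show (l : ℝ) - 3.5 * n = l * 1 + -3.5 * n by ring, Real.exp_add, Real.exp_nat_mul]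
        have : (2 : ℝ) ≤ Real.exp 1 := by linarith [Real.add_one_le_exp (1 : ℝ)]
        gcongr

theorem measure_norm_trunc_le (n : ℕ) (a : ι) :
    (Measure.pi fun _ : ι => stdGaussian (EuclideanSpace ℝ (Fin d)))
      {G | 4 * √n < ‖trunc n (G a)‖} ≤ ENNReal.ofReal (Real.exp (-3.5 * n)) := by
  classical
  have h := measure_norm_trunc_sum_le (d := d) n (Pi.single a (1 : ℝ)) one_pos (by
    rw [Finset.sum_eq_single a] <;> simp +contextual)
  have h2 : ∀ G : ι → EuclideanSpace ℝ (Fin d), ∑ i, (Pi.single a (1 : ℝ) : ι → ℝ) i • G i = G a := by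
    intro G
    rw [Finset.sum_eq_single a] <;> simp +contextual
  simpa only [h2, one_mul] using h

end Correlations

namespace Params

variable {H : Params} {d : ℕ} [NeZero d] {M : ℕ}

/-- Only the section in the slot (p, e, j) is redrawn. The run cut at i ≤ j never consults it, so
the span of the i + 1 ≤ J p queries is frozen and the bound for a single section applies. -/
theorem measure_near_span_deviation_le [∀ p : Fin (H.P + 1), NeZero (H.B p)]
    (q : ℕ → Memory M → Ball d) (u : ℕ → Memory M → Response d → Memory M) (m₀ : Memory M)
    (G : H.Idx → EuclideanSpace ℝ (Fin d)) (p : Fin (H.P + 1)) (e : Fin H.T) {i : ℕ}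
    (j : Fin (H.J p)) (hij : i ≤ j) (r : ℕ → ℕ) {Λ η α : ℝ} {Q : ℕ} (hl : 0 < H.l p)
    (hδ : 0 < H.δ p) (hQ : √(H.J p) ≤ η * Q) (hQ0 : 0 < Q) (hα : 0 ≤ α)
    (hΛ : 8 * η * Λ ≤ α * (H.l p * H.δ p)) :
    (Measure.pi fun s : H.Slot => sectionLaw (H.l s.1) (H.B s.1))
      {S | (∀ b, CorrBound Λ fun i => H.vec G p i b) ∧ CorrBound Λ (H.testVec G S p e j) ∧
        ∃ z : EuclideanSpace ℝ (Fin d), ‖z‖ ≤ 1 ∧ (∃ c : ℕ → ℝ, ‖z - ∑ a ∈ Finset.range (i + 1),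
          c a • ((runQuery q u ((H.tests G S).resp ((H.tests G S).cutAt p e i)) 0 m₀ (r a) : Ball d) :
            EuclideanSpace ℝ (Fin d))‖ ≤ η) ∧
          α < |rampMean (H.δ p) (H.testVec G S p e j) z - mean G p z|}
      ≤ ENNReal.ofReal ((2 * Q + 1) ^ (H.J p) * (2 * Real.exp (-(H.l p * α ^ 2 / 2)))) := by
  classical
  set sl : H.Slot := ⟨p, e, j⟩ with hsl
  refine measure_pi_le_of_resample _ {sl} (Set.to_countable _).measurableSet fun S₀ => ?_
  by_cases hv : ∀ b, CorrBound Λ fun i => H.vec G p i b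
  swap
  · refine le_trans (le_of_eq ?_) zero_le
    rw [measure_eq_zero_iff_ae_notMem]
    exact Filter.Eventually.of_forall fun S hS => hv hS.1
  set y : ℕ → EuclideanSpace ℝ (Fin d) := fun a =>
    (runQuery q u ((H.tests G S₀).resp ((H.tests G S₀).cutAt p e i)) 0 m₀ (r a) : Ball d) with hy
  have hrun : ∀ S : H.Sections, ∀ a, ((runQuery q u ((H.tests G (resample {sl} S₀ S)).resp
      ((H.tests G (resample {sl} S₀ S)).cutAt p e i)) 0 m₀ (r a) : Ball d) :
        EuclideanSpace ℝ (Fin d)) = y a := by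
    intro S a
    have h : (H.tests G (resample {sl} S₀ S)).resp ((H.tests G (resample {sl} S₀ S)).cutAt p e i)
        = (H.tests G S₀).resp ((H.tests G S₀).cutAt p e i) := by
      funext t x
      refine resp_tests_congr (fun p' hp' j' hj' => ?_) x
      unfold testVec
      split_ifs with hc
      · have hne : (⟨⟨p', hc.1⟩, ⟨t / H.τ p', hc.2.1⟩, ⟨j', hc.2.2⟩⟩ : H.Slot) ∉ ({sl} : Set _) := by
          intro hmem
          rw [Set.mem_singleton_iff, hsl] at hmem
          obtain ⟨h1, h2⟩ := Sigma.mk.inj_iff.1 hmem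
          obtain ⟨p, hp⟩ := p
          obtain rfl : p' = p := congrArg Fin.val h1
          obtain ⟨h3, h4⟩ := Prod.mk_inj.1 (eq_of_heq h2)
          have h3' : t / H.τ p' = e := congrArg Fin.val h3
          have h4' : j' = j := congrArg Fin.val h4
          unfold TestSystem.cutAt at hj'
          rw [if_pos ⟨rfl, h3'⟩] at hj'
          omega
        have hval : resample {sl} S₀ S ⟨⟨p', hc.1⟩, ⟨t / H.τ p', hc.2.1⟩, ⟨j', hc.2.2⟩⟩
            = S₀ ⟨⟨p', hc.1⟩, ⟨t / H.τ p', hc.2.1⟩, ⟨j', hc.2.2⟩⟩ := if_neg hne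
        rw [hval]
      · rfl
    rw [h]
  have htest : ∀ S : H.Sections, H.testVec G (resample {sl} S₀ S) p e j
      = fun i => H.vec G p i (S sl i) := by
    intro S
    unfold testVec
    rw [dif_pos ⟨p.2, e.2, j.2⟩]
    have hval : resample {sl} S₀ S sl = S sl := if_pos (Set.mem_singleton _)
    funext i
    exact congrArg (fun f => H.vec G p i (f i)) hval
  set V : Submodule ℝ (EuclideanSpace ℝ (Fin d)) :=
    Submodule.span ℝ ((Finset.range (i + 1)).image y : Set (EuclideanSpace ℝ (Fin d))) with hV
  have hfin : Module.finrank ℝ V ≤ H.J p := by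
    refine (finrank_span_finset_le_card _).trans (Finset.card_image_le.trans ?_)
    rw [Finset.card_range]
    have := j.2
    omega
  have key := sectionLaw_exists_deviation_le (B := H.B p) hl (H.vec G p) V hfin hδ hQ hQ0 hα hΛ hv
  refine le_trans ?_ key
  rw [← (measurePreserving_eval (fun s : H.Slot => sectionLaw (H.l s.1) (H.B s.1))
    sl).measure_preimage (Set.to_countable _).measurableSet.nullMeasurableSet]
  refine measure_mono fun S hS => ?_
  obtain ⟨-, h1, z, hz, ⟨c, hcz⟩, h2⟩ := hS
  rw [htest S] at h1 h2
  refine ⟨h1, z, hz, ⟨_, ?_, hcz⟩, h2⟩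
  refine Submodule.sum_mem _ fun a ha => Submodule.smul_mem _ _ ?_
  rw [hrun S a]
  exact Submodule.subset_span (Finset.mem_coe.2 (Finset.mem_image_of_mem _ ha))

end Params

end

end Feasibility

namespace Feasibility

noncomputable section

open ProbabilityTheory
open scoped ENNReal

/-! ### A centre for the feasible set -/

section Center

variable {d : ℕ} {ι : Type*} [Fintype ι]

/-- The span of truncated vectors. -/
def vecSpan (n : ι → ℕ) (G : ι → EuclideanSpace ℝ (Fin d)) :
    Submodule ℝ (EuclideanSpace ℝ (Fin d)) :=
  Submodule.span ℝ (Set.range fun a => trunc (n a) (G a))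

theorem measurable_norm_sub_starProjection_vecSpan (n : ι → ℕ) (u : EuclideanSpace ℝ (Fin d)) :
    Measurable fun G : ι → EuclideanSpace ℝ (Fin d) =>
      ‖u - (vecSpan n G).starProjection u‖ := by
  refine measurable_of_Ici fun c => IsClosed.measurableSet ?_
  have : (fun G : ι → EuclideanSpace ℝ (Fin d) =>
      ‖u - (vecSpan n G).starProjection u‖) ⁻¹' Set.Ici c
      = ⋂ k : ι → ℝ, {G | c ≤ ‖u - ∑ a, k a • trunc (n a) (G a)‖} := by
    ext G
    simp only [Set.mem_preimage, Set.mem_Ici, Set.mem_iInter, Set.mem_ofPred_eq]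
    constructor
    · intro h k
      exact h.trans (norm_sub_starProjection_le _ _
        ((Submodule.mem_span_range_iff_exists_fun ℝ).2 ⟨k, rfl⟩))
    · intro h
      obtain ⟨k, hk⟩ := (Submodule.mem_span_range_iff_exists_fun ℝ).1
        (Submodule.starProjection_apply_mem (vecSpan n G) u)
      rw [← hk]
      exact h k
  rw [this]
  refine isClosed_iInter fun k => ?_
  exact isClosed_le (by fun_prop) (by fun_prop)

theorem measure_norm_sq_starProjection_bot_le {n : ℕ} (hn0 : 0 < n) (hnd : n ≤ d) (s : Finset ι)
    {u : EuclideanSpace ℝ (Fin d)} (hu1 : ‖u‖ ≤ 1) (hun : trunc n u = u) {c : ℝ} (hc : 0 < c) :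
    (Measure.pi fun _ : ι => stdGaussian (EuclideanSpace ℝ (Fin d)))
      {G | c ≤ ‖(truncSpan ⊥ s n G).starProjection u‖ ^ 2}
      ≤ ENNReal.ofReal (s.card / (n * c)) := by
  set b : Fin n → EuclideanSpace ℝ (Fin d) := fun i =>
    EuclideanSpace.single (Fin.castLE hnd i) (1 : ℝ) with hb
  refine measure_norm_sq_starProjection_le hn0 ⊥ s n (b := b) ?_ (by simp) (fun i => ?_) hu1
    (by simp) hun hc
  · have h := (EuclideanSpace.basisFun (Fin d) ℝ).orthonormal.comp _ (Fin.castLE_injective hnd)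
    have h2 : b = EuclideanSpace.basisFun (Fin d) ℝ ∘ Fin.castLE hnd := by
      funext i
      simp [hb]
    rw [h2]
    exact h
  · ext j
    rw [trunc_apply]
    split_ifs with h
    · rfl
    · have hne : j ≠ Fin.castLE hnd i := by
        rintro rfl
        exact h (by simp)
      simp [hb, hne]

theorem measure_norm_sq_starProjection_orthogonal_le (V₀ : Submodule ℝ (EuclideanSpace ℝ (Fin d)))
    {t : ℕ} (ht : Module.finrank ℝ V₀ ≤ t) (htd : t < d) (s : Finset ι)
    {u : EuclideanSpace ℝ (Fin d)} (hu1 : ‖u‖ ≤ 1) (hu : u ∈ V₀ᗮ) {c : ℝ} (hc : 0 < c) :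
    (Measure.pi fun _ : ι => stdGaussian (EuclideanSpace ℝ (Fin d)))
      {G | c ≤ ‖(truncSpan V₀ s d G).starProjection u‖ ^ 2}
      ≤ ENNReal.ofReal (s.card / ((d - t) * c)) := by
  have hfin : Module.finrank ℝ V₀ + Module.finrank ℝ V₀ᗮ = d := by
    rw [Submodule.finrank_add_finrank_orthogonal, finrank_euclideanSpace, Fintype.card_fin]
  have hr : 0 < Module.finrank ℝ V₀ᗮ := by omega
  refine (measure_norm_sq_starProjection_le hr V₀ s d
    (b := fun i => (stdOrthonormalBasis ℝ V₀ᗮ i : EuclideanSpace ℝ (Fin d)))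
    ((stdOrthonormalBasis ℝ V₀ᗮ).orthonormal.comp_linearIsometry V₀ᗮ.subtypeₗᵢ)
    (fun i => (stdOrthonormalBasis ℝ V₀ᗮ i).2) (fun i => trunc_of_le le_rfl _) hu1 hu
    (trunc_of_le le_rfl _) hc).trans (ENNReal.ofReal_le_ofReal ?_)
  have h1 : (0 : ℝ) < d - t := by
    have : (t : ℝ) < d := by exact_mod_cast htd
    linarith
  have h2 : (d : ℝ) - t ≤ Module.finrank ℝ V₀ᗮ := by
    have : (d : ℝ) ≤ t + Module.finrank ℝ V₀ᗮ := by
      exact_mod_cast (by omega : d ≤ t + Module.finrank ℝ V₀ᗮ)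
    linarith
  gcongr

/-- With high probability there is a point far from the origin in a given direction that is
orthogonal to random vectors. -/
theorem measure_not_exists_center_le [NeZero d] (n : ι → ℕ) (top : Finset ι) {n₀ : ℕ}
    (hn0 : 0 < n₀) (hnd : n₀ ≤ d) (htop : ∀ a ∈ top, n a = n₀) (hlow : ∀ a ∉ top, d ≤ n a)
    (hcard : top.card < d) :
    (Measure.pi fun _ : ι => stdGaussian (EuclideanSpace ℝ (Fin d)))
      {G | ¬ ∃ c : EuclideanSpace ℝ (Fin d), ‖c‖ ≤ 1 / 2 ∧
        3 / 8 ≤ inner ℝ (EuclideanSpace.single 0 1) c ∧ ∀ a, inner ℝ (trunc (n a) (G a)) c = 0}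
      ≤ ENNReal.ofReal (top.card / (n₀ * (1 / 16))) +
        ENNReal.ofReal ((Fintype.card ι : ℝ) / ((d - top.card) * (1 / 16))) := by
  classical
  set u : EuclideanSpace ℝ (Fin d) := EuclideanSpace.single 0 1 with hu
  have hu1 : ‖u‖ = 1 := by simp [hu]
  have hun : trunc n₀ u = u := by
    ext j
    rw [trunc_apply]
    split_ifs with h
    · rfl
    · have hne : j ≠ 0 := by
        rintro rfl
        exact h (by simpa using hn0)
      simp [hu, hne]
  -- Passing to the orthogonal complement of the top vectors, and then of the others given these,
  -- may each cost 1/16 of the squared length. Two stages are needed because the top vectors are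
  -- confined to `n₀` coordinates.
  set D₁ : Set (ι → EuclideanSpace ℝ (Fin d)) :=
    {G | 1 / 16 ≤ ‖(truncSpan ⊥ top n₀ G).starProjection u‖ ^ 2} with hD₁
  set D₂ : Set (ι → EuclideanSpace ℝ (Fin d)) :=
    {G | ‖u - (vecSpan n G).starProjection u‖ ^ 2 ≤
      ‖u - (truncSpan ⊥ top n₀ G).starProjection u‖ ^ 2 - 1 / 16} with hD₂
  have hD₂m : MeasurableSet D₂ :=
    measurableSet_le ((measurable_norm_sub_starProjection_vecSpan n u).pow_const 2)
      (((measurable_norm_sub_starProjection ⊥ top n₀ u).pow_const 2).sub_const _)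
  have hsub : {G : ι → EuclideanSpace ℝ (Fin d) | ¬ ∃ c : EuclideanSpace ℝ (Fin d), ‖c‖ ≤ 1 / 2 ∧
        3 / 8 ≤ inner ℝ u c ∧ ∀ a, inner ℝ (trunc (n a) (G a)) c = 0} ⊆ D₁ ∪ D₂ := by
    intro G hG
    by_contra hcon
    rw [Set.mem_union, not_or] at hcon
    obtain ⟨h1, h2⟩ := hcon
    rw [hD₁, Set.mem_ofPred_eq, not_le, norm_sq_starProjection] at h1
    rw [hD₂, Set.mem_ofPred_eq, not_le] at h2
    set W := vecSpan n G with hW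
    have h3 := norm_sq_starProjection W u
    rw [hu1] at h1 h3
    have horth : ∀ w ∈ W, inner ℝ w (u - W.starProjection u) = 0 := fun w hw => by
      rw [real_inner_comm]
      exact W.starProjection_inner_eq_zero u w hw
    -- The residual has squared length above 7/8, so its half has inner product above 7/16 with `u`,
    -- and it leaves room for a ball around it.
    refine hG ⟨(1 / 2 : ℝ) • (u - W.starProjection u), ?_, ?_, fun a => ?_⟩
    · rw [norm_smul]
      have h4 : ‖u - W.starProjection u‖ ≤ 1 := by
        have := norm_sub_starProjection_le W u W.zero_mem
        rwa [sub_zero, hu1] at this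
      rw [Real.norm_eq_abs, abs_of_pos (by norm_num : (0 : ℝ) < 1 / 2)]
      linarith
    · have h4 : inner ℝ u (u - W.starProjection u) = ‖u - W.starProjection u‖ ^ 2 := by
        rw [← real_inner_self_eq_norm_sq]
        conv_rhs => rw [inner_sub_left, horth _ (W.starProjection_apply_mem u), sub_zero]
      rw [real_inner_smul_right, h4]
      linarith
    · rw [real_inner_smul_right, horth _ (Submodule.subset_span ⟨a, rfl⟩), mul_zero]
  refine (measure_mono hsub).trans ((measure_union_le _ _).trans (add_le_add
    (measure_norm_sq_starProjection_bot_le hn0 hnd top hu1.le hun (by norm_num)) ?_))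
  refine measure_pi_le_of_resample _ ((topᶜ : Finset ι) : Set ι) hD₂m fun G₀ => ?_
  set V₀ := truncSpan ⊥ top n₀ G₀ with hV₀
  have hfin : Module.finrank ℝ V₀ ≤ top.card := by
    rw [hV₀, truncSpan, bot_sup_eq, ← Finset.coe_image]
    exact (finrank_span_finset_le_card _).trans Finset.card_image_le
  refine (measure_mono fun G hG => ?_).trans ((measure_norm_sq_starProjection_orthogonal_le V₀ hfin
    hcard topᶜ (u := u - V₀.starProjection u) ?_ ?_ (by norm_num : (0 : ℝ) < 1 / 16)).trans
    (ENNReal.ofReal_le_ofReal ?_))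
  · set G' := resample ((topᶜ : Finset ι) : Set ι) G₀ G with hG'
    have hG't : ∀ a ∈ top, G' a = G₀ a := fun a ha => by
      rw [hG', resample, if_neg (by simpa using ha)]
    have hG'l : ∀ a ∉ top, G' a = G a := fun a ha => by
      rw [hG', resample, if_pos (by simpa using ha)]
    have hV : truncSpan ⊥ top n₀ G' = V₀ := by
      rw [hV₀, truncSpan, truncSpan]
      congr 2
      exact Set.image_congr fun a ha => by rw [hG't a ha]
    set W := truncSpan V₀ topᶜ d G with hW
    -- An inclusion suffices: enlarging the subspace can only decrease the distance.
    have hle : vecSpan n G' ≤ W := by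
      refine Submodule.span_le.2 ?_
      rintro _ ⟨a, rfl⟩
      by_cases ha : a ∈ top
      · refine (le_sup_left : V₀ ≤ W) ?_
        rw [← hV]
        simp only [htop a ha]
        exact (le_sup_right : _ ≤ truncSpan ⊥ top n₀ G') (Submodule.subset_span ⟨a, ha, rfl⟩)
      · refine (le_sup_right : _ ≤ W) (Submodule.subset_span ⟨a, by simpa using ha, ?_⟩)
        simp only
        rw [hG'l a ha, trunc_of_le le_rfl, trunc_of_le (hlow a ha)]
    rw [Set.mem_ofPred_eq] at hG
    have hG2 : ‖u - (vecSpan n G').starProjection u‖ ^ 2 ≤ ‖u - V₀.starProjection u‖ ^ 2 - 1 / 16 := by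
      rw [← hV]; exact hG
    have h1 : ‖u - W.starProjection u‖ ≤ ‖u - (vecSpan n G').starProjection u‖ :=
      norm_sub_starProjection_le W u (hle (Submodule.starProjection_apply_mem _ u))
    have h2 := norm_sq_starProjection W (u - V₀.starProjection u)
    have h3 : W.starProjection (V₀.starProjection u) = V₀.starProjection u :=
      Submodule.starProjection_eq_self_iff.2
        ((le_sup_left : V₀ ≤ W) (Submodule.starProjection_apply_mem V₀ u))
    have h4 : u - V₀.starProjection u - W.starProjection (u - V₀.starProjection u)
        = u - W.starProjection u := by
      rw [map_sub, h3]; abel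
    rw [h4] at h2
    have h5 : ‖u - W.starProjection u‖ ^ 2 ≤ ‖u - (vecSpan n G').starProjection u‖ ^ 2 := by gcongr
    rw [Set.mem_ofPred_eq]
    linarith
  · have := norm_sub_starProjection_le V₀ u V₀.zero_mem
    rwa [sub_zero, hu1] at this
  · exact V₀.sub_starProjection_mem_orthogonal u
  · have h1 : (0 : ℝ) < d - top.card := by
      have : (top.card : ℝ) < d := by exact_mod_cast hcard
      linarith
    have h2 : (topᶜ.card : ℝ) ≤ Fintype.card ι := by exact_mod_cast Finset.card_le_univ _
    gcongr

end Center

end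

end Feasibility

namespace Feasibility

noncomputable section

open ProbabilityTheory
open scoped ENNReal

/-! ### Union bounds and the failure events -/

/-- In this form a chain of existential quantifiers turns into a sum of exponents. -/
theorem measure_exists_le_exp {α κ : Type*} [MeasurableSpace α] [Fintype κ] (μ : Measure α)
    {p : κ → α → Prop} {a b : ℝ} (hκ : (Fintype.card κ : ℝ) ≤ Real.exp a)
    (h : ∀ i, μ {x | p i x} ≤ ENNReal.ofReal (Real.exp b)) :
    μ {x | ∃ i, p i x} ≤ ENNReal.ofReal (Real.exp (a + b)) := by
  have hsub : {x | ∃ i, p i x} = ⋃ i, {x | p i x} := by ext; simp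
  rw [hsub]
  calc _ ≤ ∑ _ : κ, ENNReal.ofReal (Real.exp b) :=
        (measure_iUnion_fintype_le _ _).trans (Finset.sum_le_sum fun i _ => h i)
    _ = ENNReal.ofReal (Fintype.card κ * Real.exp b) := by
        rw [Finset.sum_const, Finset.card_univ, nsmul_eq_mul, ENNReal.ofReal_mul (by positivity)]
        simp
    _ ≤ _ := by
        rw [Real.exp_add]
        exact ENNReal.ofReal_le_ofReal (by gcongr)

theorem measure_le_exp_of_imp {α : Type*} [MeasurableSpace α] (μ : Measure α) {c : Prop}
    {p : α → Prop} {b : ℝ} (h : c → μ {x | p x} ≤ ENNReal.ofReal (Real.exp b)) :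
    μ {x | c ∧ p x} ≤ ENNReal.ofReal (Real.exp b) := by
  by_cases hc : c
  · exact (measure_mono fun x hx => hx.2).trans (h hc)
  · simp [hc]

theorem robust_congr {E : Type*} [NormedAddCommGroup E] [InnerProductSpace ℝ E] {η : ℝ} {k : ℕ}
    {y y' : ℕ → E} (h : ∀ j < k, y j = y' j) (hy : Robust η k y) : Robust η k y' := by
  intro i hi c
  have hs : ∑ j ∈ Finset.range i, c j • y j = ∑ j ∈ Finset.range i, c j • y' j :=
    Finset.sum_congr rfl fun j hj => by rw [h j ((Finset.mem_range.1 hj).trans hi)]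
  rw [← h i hi, ← hs]
  exact hy i hi c

theorem exp_neg_three_le : Real.exp (-3) ≤ 1 / 16 := by
  have h1 : (16 : ℝ) ≤ Real.exp 3 := by
    have h2 : (2.7 : ℝ) ≤ Real.exp 1 := by linarith [Real.exp_one_gt_d9]
    calc (16 : ℝ) ≤ 2.7 ^ 3 := by norm_num
      _ ≤ Real.exp 1 ^ 3 := by gcongr
      _ = Real.exp 3 := by rw [← Real.exp_nat_mul]; norm_num
  rw [Real.exp_neg, one_div]
  exact inv_anti₀ (by norm_num) h1

/-- A finite sequence, continued by `0`. -/
def extendFin {k T : ℕ} (r : Fin k → Fin T) (n : ℕ) : ℕ := if h : n < k then r ⟨n, h⟩ else 0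

theorem exists_extendFin {k T : ℕ} {r : ℕ → ℕ} (hr : ∀ j < k, r j < T) :
    ∃ r' : Fin k → Fin T, ∀ j < k, extendFin r' j = r j :=
  ⟨fun j => ⟨r j, hr j j.2⟩, fun j hj => by simp [extendFin, hj]⟩

theorem card_fun_fin_le {k T : ℕ} {Y : ℝ} (hT : (T : ℝ) ≤ Real.exp Y) :
    (Fintype.card (Fin k → Fin T) : ℝ) ≤ Real.exp (k * Y) := by
  rw [Fintype.card_fun, Fintype.card_fin, Fintype.card_fin, Real.exp_nat_mul]
  push_cast
  gcongr

namespace Params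

/-- Conditions on the parameters under which the hard instance is hard for `M`-bit algorithms:
`Y` bounds the logarithms of all the quantities that are counted. -/
structure Suitable (H : Params) (d M : ℕ) (ε Y : ℝ) : Prop where
  J_zero : H.J 0 = 1
  J_pos : ∀ p ≤ H.P, 0 < H.J p
  N_pos : ∀ p ≤ H.P, 0 < H.N p
  l_pos : ∀ p ≤ H.P, 0 < H.l p
  δ_pos : ∀ p ≤ H.P, 0 < H.δ p
  η_pos : ∀ p ≤ H.P, 0 < H.η p
  η_le : ∀ p ≤ H.P, H.η p ≤ 1 / 4
  D_top_pos : 0 < H.D H.P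
  D_top_le : H.D H.P ≤ d
  le_D : ∀ p < H.P, d ≤ H.D p
  -- Independence at the scale of level p + 1 makes correlations at the scale of level p spread out;
  -- 60 is the ratio in `lintegral_exp_ramp_le`.
  gap : ∀ p < H.P, 60 * H.δ p ≤ H.η (p + 1)
  gap_top : 60 * H.δ H.P ≤ 1 / 4
  corr : ∀ p ≤ H.P, 8 * H.η p * (4 * √(H.l p * H.D p)) ≤ H.α p * (H.l p * H.δ p)
  ε_pos : 0 < ε
  ε_le : ε ≤ 1 / 8
  ε_mul_le : ∀ p ≤ H.P, ε * (4 * √(H.D p)) ≤ 1 / 24 * H.δ p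
  one_le_Y : 1 ≤ Y
  P_le : (H.P + 1 : ℝ) ≤ Real.exp Y
  T_le : (H.T : ℝ) ≤ Real.exp Y
  B_le : ∀ p ≤ H.P, (H.B p : ℝ) ≤ Real.exp Y
  l_le : ∀ p ≤ H.P, (H.l p : ℝ) ≤ Real.exp Y
  net : ∀ p ≤ H.P, ∃ Q : ℕ, 0 < Q ∧ √(H.J p) ≤ H.η p * Q ∧ (2 * Q + 1 : ℝ) ≤ Real.exp Y
  -- Hoeffding's exponent pays for T^J choices of times, a net of size e^{JY}, and the choices of
  -- level, epoch and two tests.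
  tests_le : ∀ p ≤ H.P, (2 * H.J p + 8) * Y ≤ H.l p * H.α p ^ 2 / 2
  -- The union bound over 2^M memory states and T^J choices of times, with a margin for levels and
  -- epochs.
  memory_le : ∀ p < H.P, M + (H.J (p + 1) + 6) * Y
    ≤ 2 * H.J (p + 1) * (H.l p * H.N p * H.J p)
  top_le : 5 * Y ≤ 2 * (H.l H.P * H.N H.P * H.J H.P)
  l_add_le : ∀ p ≤ H.P, H.l p + 8 * Y ≤ 3.5 * H.D p
  top_card_le : 320 * (H.l H.P * H.B H.P : ℝ) ≤ H.D H.P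
  card_le : 640 * ∑ p ∈ Finset.range (H.P + 1), (H.l p * H.B p : ℝ) ≤ d

variable {H : Params} {d M : ℕ} [NeZero d] {ε Y : ℝ}

namespace Suitable

theorem J_le (h : H.Suitable d M ε Y) {p : ℕ} (hp : p ≤ H.P) : (H.J p : ℝ) ≤ Real.exp Y := by
  refine le_trans ?_ (h.B_le p hp)
  have := h.N_pos p hp
  exact_mod_cast (by unfold B; nlinarith [Nat.zero_le (H.J p)] : H.J p ≤ H.B p)

variable (q : ℕ → Memory M → Ball d) (u : ℕ → Memory M → Response d → Memory M) (m₀ : Memory M)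

/-- Some epoch has, from some memory state, robustly independent queries with small means. -/
def EpochFailure (G : H.Idx → EuclideanSpace ℝ (Fin d)) (S : H.Sections) : Prop :=
  ∃ p : Fin H.P, ∃ e : Fin H.T, ∃ m : Memory M, ∃ r : Fin (H.J (p + 1)) → Fin H.T,
    (∀ j < H.J (p + 1), (e * H.τ (p + 1) + extendFin r j) / H.τ (p + 1) = e) ∧
      (Robust (H.η (p + 1)) (H.J (p + 1)) (fun j => trunc (H.D p)
        (epochQuery q u G S p e m (extendFin r j) : EuclideanSpace ℝ (Fin d))) ∧
        ∀ j < H.J (p + 1), mean G p (epochQuery q u G S p e m (extendFin r j)) ≤ 1 / 8)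

/-- Some query that is not close to the origin has a small mean at the top level. -/
def TopFailure (G : H.Idx → EuclideanSpace ℝ (Fin d)) (S : H.Sections) : Prop :=
  ∃ t : Fin H.T, Robust (1 / 4) 1 (fun _ => trunc (H.D H.P)
      (epochQuery q u G S H.P 0 m₀ t : EuclideanSpace ℝ (Fin d))) ∧
    ∀ j < 1, mean G H.P (epochQuery q u G S H.P 0 m₀ t) ≤ 1 / 8

/-- Some family of vectors is too correlated. -/
def CorrFailure (G : H.Idx → EuclideanSpace ℝ (Fin d)) (S : H.Sections) : Prop :=
  ∃ p : Fin (H.P + 1), (∃ b, ¬ CorrBound (4 * √(H.l p * H.D p)) fun i => H.vec G p i b) ∨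
    ∃ e : Fin H.T, ∃ j : Fin (H.J p),
      ¬ CorrBound (4 * √(H.l p * H.D p)) (H.testVec G S p e j)

/-- Some test is not representative near the span of earlier queries. -/
def TestFailure (G : H.Idx → EuclideanSpace ℝ (Fin d)) (S : H.Sections) : Prop :=
  ∃ p : Fin (H.P + 1), ∃ e : Fin H.T, ∃ i : Fin (H.J p), ∃ r : Fin (H.J p) → Fin H.T,
    ∃ j : Fin (H.J p), (i : ℕ) ≤ j ∧ ((∀ b, CorrBound (4 * √(H.l p * H.D p)) fun i => H.vec G p i b) ∧
      CorrBound (4 * √(H.l p * H.D p)) (H.testVec G S p e j) ∧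
      ∃ z : EuclideanSpace ℝ (Fin d), ‖z‖ ≤ 1 ∧
        (∃ c : ℕ → ℝ, ‖z - ∑ a ∈ Finset.range (i + 1),
          c a • ((runQuery q u ((H.tests G S).resp ((H.tests G S).cutAt p e i)) 0 m₀
            (extendFin r a) : Ball d) : EuclideanSpace ℝ (Fin d))‖ ≤ H.η p) ∧
        H.α p < |rampMean (H.δ p) (H.testVec G S p e j) z - mean G p z|)

variable {q u m₀}

/-- Without failures, `TestSystem.not_passes` applies with Θ = 1/8: all thresholds plus α stay below
1/12. -/
theorem not_passes_of_not_failure (h : H.Suitable d M ε Y) {G : H.Idx → EuclideanSpace ℝ (Fin d)}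
    {S : H.Sections} (h1 : ¬ EpochFailure q u G S) (h2 : ¬ TopFailure q u m₀ G S)
    (h3 : ¬ CorrFailure G S) (h4 : ¬ TestFailure q u m₀ G S) :
    ∀ t < H.T, ¬ (H.tests G S).Passes (H.P + 1) t
      (runQuery q u ((H.tests G S).resp (H.tests G S).full) 0 m₀ t) := by
  have hc : ∀ p : Fin (H.P + 1), (∀ b, CorrBound (4 * √(H.l p * H.D p)) fun i => H.vec G p i b) ∧
      ∀ (e : Fin H.T) (j : Fin (H.J p)),
        CorrBound (4 * √(H.l p * H.D p)) (H.testVec G S p e j) := by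
    intro p
    unfold CorrFailure at h3
    push Not at h3
    exact h3 p
  have hnorm : ∀ x : Ball d, ‖(x : EuclideanSpace ℝ (Fin d))‖ ≤ 1 := fun x =>
    mem_closedBall_zero_iff.1 x.2
  have hadm : ∀ x : Ball d, (H.tests G S).adm x → 1 / 4 ≤ ‖(x : EuclideanSpace ℝ (Fin d))‖ := by
    intro x hx
    have h5 := real_inner_le_norm (EuclideanSpace.single 0 1) (x : EuclideanSpace ℝ (Fin d))
    rw [show ‖EuclideanSpace.single (0 : Fin d) (1 : ℝ)‖ = 1 by simp, one_mul] at h5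
    exact (show (1 / 4 : ℝ) ≤ _ from hx).trans h5
  refine TestSystem.not_passes (S := H.tests G S) q u m₀
    (fun x => (x : EuclideanSpace ℝ (Fin d))) hnorm
    (fun p e j z => rampMean (H.δ p) (H.testVec G S p e j) z) (fun p z => mean G p z) H.θ H.α H.η
    (1 / 8) H.T (fun _ _ _ _ _ _ _ => Iff.rfl) (by simp [tests, τ]) h.J_zero
    (fun p => by unfold α; positivity) (fun p j => le_of_eq ?_) (fun p hp j hj => ?_)
    (fun p hp => (h.η_pos p hp).le) (fun x hx p hp => (h.η_le p hp).trans (hadm x hx))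
    ?_ ?_ ?_
  · unfold θ α; push_cast; ring
  · have hJ : (0 : ℝ) < H.J p := by exact_mod_cast h.J_pos p hp
    have hj' : (j : ℝ) + 1 ≤ H.J p := by exact_mod_cast hj
    unfold θ α
    have h5 : (j : ℝ) / H.J p ≤ 1 - 1 / H.J p := by
      rw [div_le_iff₀ hJ, sub_mul, one_div, inv_mul_cancel₀ hJ.ne']; linarith
    have h6 : (1 : ℝ) / (48 * H.J p) = 1 / 48 * (1 / H.J p) := by ring
    have h7 : (0 : ℝ) < 1 / H.J p := by positivity
    rw [h6]
    linarith
  · intro p hp e he i hi r hr z hz hspan j hij hj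
    by_contra hcon
    rw [not_le] at hcon
    have hr' : ∀ a < H.J p, (fun a => if a ≤ i then r a else 0) a < H.T := by
      intro a _
      simp only
      split_ifs with h5
      · exact hr a h5
      · omega
    obtain ⟨r', hr'⟩ := exists_extendFin hr'
    refine h4 ⟨⟨p, Nat.lt_succ_of_le hp⟩, ⟨e, he⟩, ⟨i, hi⟩, r', ⟨j, hj⟩, hij, (hc _).1, (hc _).2 _ _, z, hz, ?_,
      hcon⟩
    obtain ⟨c, hc⟩ := hspan
    refine ⟨c, le_trans (le_of_eq ?_) hc⟩
    congr 2
    refine Finset.sum_congr rfl fun a ha => ?_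
    have ha' : a ≤ i := by have := Finset.mem_range.1 ha; omega
    have hi' : i < H.J p := hi
    simp only
    rw [hr' a (by omega), if_pos ha']
  · intro p hp e he m r hr ⟨hrob, hmean⟩
    obtain ⟨r', hr'⟩ := exists_extendFin (k := H.J (p + 1)) (T := H.T) (r := r)
      fun j hj => by have := (hr j hj).1; omega
    have hq : ∀ j < H.J (p + 1), epochQuery q u G S p e m (extendFin r' j)
        = runQuery q u ((H.tests G S).resp (H.tests G S).full) (e * (H.tests G S).τ (p + 1)) m
          (r j) := fun j hj => by rw [hr' j hj]; rfl
    refine h1 ⟨⟨p, hp⟩, ⟨e, he⟩, m, r', fun j hj => ?_, ?_, fun j hj => ?_⟩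
    · simp only
      rw [hr' j hj]
      exact (hr j hj).2
    · refine robust_congr (fun j hj => ?_) hrob
      simp only
      -- Below the top level nothing is truncated, so the queries themselves are robustly
      -- independent.
      rw [trunc_of_le (h.le_D p hp), hq j hj]
    · simp only
      rw [hq j hj]
      exact hmean j hj
  · intro t ht hx hmean
    have hq : epochQuery q u G S H.P 0 m₀ t
        = runQuery q u ((H.tests G S).resp (H.tests G S).full) 0 m₀ t := by
      rw [epochQuery, Nat.zero_mul]
    refine h2 ⟨⟨t, ht⟩, ?_, fun j _ => ?_⟩
    · intro i hi c
      obtain rfl : i = 0 := by omega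
      rw [Finset.range_zero, Finset.sum_empty, sub_zero]
      simp only
      rw [hq]
      set x := runQuery q u ((H.tests G S).resp (H.tests G S).full) 0 m₀ t
      have h5 := real_inner_le_norm (EuclideanSpace.single 0 1)
        (trunc (H.D H.P) (x : EuclideanSpace ℝ (Fin d)))
      rw [show ‖EuclideanSpace.single (0 : Fin d) (1 : ℝ)‖ = 1 by simp, one_mul, ← inner_trunc_left] at h5
      -- The truncation keeps the first coordinate, so an admissible query keeps norm at least 1/4
      -- at the top level.
      have h6 : trunc (H.D H.P) (EuclideanSpace.single (0 : Fin d) (1 : ℝ))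
          = EuclideanSpace.single 0 1 := by
        ext j
        rw [trunc_apply]
        split_ifs with h7
        · rfl
        · have hne : j ≠ 0 := by
            rintro rfl
            exact h7 (by simpa using h.D_top_pos)
          simp [hne]
      rw [h6] at h5
      exact (show (1 / 4 : ℝ) ≤ _ from hx).trans h5
    · simp only
      rw [hq]
      exact hmean

theorem measure_epochFailure_le (h : H.Suitable d M ε Y)
    (hqu : ∀ (S : H.Sections) (cut : ℕ → ℕ → ℕ) (t₀ : ℕ) (m : Memory M) (n : ℕ),
      Measurable fun G : H.Idx → EuclideanSpace ℝ (Fin d) =>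
        runQuery q u ((H.tests G S).resp cut) t₀ m n) (S : H.Sections) :
    (Measure.pi fun _ : H.Idx => stdGaussian (EuclideanSpace ℝ (Fin d)))
      {G | EpochFailure q u G S} ≤ ENNReal.ofReal (Real.exp (-3)) := by
  have hY := h.one_le_Y
  have hP : (Fintype.card (Fin H.P) : ℝ) ≤ Real.exp Y := by
    rw [Fintype.card_fin]; linarith [h.P_le]
  have hT : (Fintype.card (Fin H.T) : ℝ) ≤ Real.exp Y := by rw [Fintype.card_fin]; exact h.T_le
  have hM : (Fintype.card (Memory M) : ℝ) ≤ Real.exp M := by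
    rw [Fintype.card_fun, Fintype.card_bool, Fintype.card_fin, ← mul_one (M : ℝ), Real.exp_nat_mul]
    push_cast
    have : (2 : ℝ) ≤ Real.exp 1 := by linarith [Real.add_one_le_exp (1 : ℝ)]
    gcongr
  refine (measure_exists_le_exp _ hP (b := -4 * Y) fun p => ?_).trans
    (ENNReal.ofReal_le_ofReal (Real.exp_le_exp.2 (by linarith)))
  have hp := p.2
  set k := H.J (p + 1) with hk
  refine (measure_exists_le_exp _ hT (b := M + (k * Y + -(2 * k * (H.l p * H.N p * H.J p))))
    fun e => ?_).trans (ENNReal.ofReal_le_ofReal (Real.exp_le_exp.2 ?_))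
  · refine measure_exists_le_exp _ hM fun m => ?_
    refine measure_exists_le_exp _ (card_fun_fin_le h.T_le) fun r => ?_
    refine measure_le_exp_of_imp _ fun hr => ?_
    exact measure_epoch_le q u hqu S ⟨p, by omega⟩ (h.δ_pos p hp.le) (h.l_pos p hp.le)
      (h.N_pos p hp.le) (h.J_pos p hp.le) (h.gap p hp) e m k (extendFin r) hr
  · have := h.memory_le p hp
    rw [← hk] at this
    linarith

theorem measure_topFailure_le (h : H.Suitable d M ε Y)
    (hqu : ∀ (S : H.Sections) (cut : ℕ → ℕ → ℕ) (t₀ : ℕ) (m : Memory M) (n : ℕ),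
      Measurable fun G : H.Idx → EuclideanSpace ℝ (Fin d) =>
        runQuery q u ((H.tests G S).resp cut) t₀ m n) (S : H.Sections) :
    (Measure.pi fun _ : H.Idx => stdGaussian (EuclideanSpace ℝ (Fin d)))
      {G | TopFailure q u m₀ G S} ≤ ENNReal.ofReal (Real.exp (-3)) := by
  have hY := h.one_le_Y
  have hT : (Fintype.card (Fin H.T) : ℝ) ≤ Real.exp Y := by rw [Fintype.card_fin]; exact h.T_le
  refine (measure_exists_le_exp _ hT (b := -(2 * (H.l H.P * H.N H.P * H.J H.P))) fun t => ?_).trans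
    (ENNReal.ofReal_le_ofReal (Real.exp_le_exp.2 (by linarith [h.top_le])))
  -- All T = τ (P+1) times form one epoch above the top level, with known initial memory; one query
  -- suffices, and no union over memory states is needed.
  have key := measure_epoch_le q u hqu S ⟨H.P, by omega⟩ (h.δ_pos _ le_rfl) (h.l_pos _ le_rfl)
    (h.N_pos _ le_rfl) (h.J_pos _ le_rfl) h.gap_top 0 m₀ 1 (fun _ => t) (fun j _ => by
      rw [Nat.zero_mul, Nat.zero_add]
      exact Nat.div_eq_of_lt t.2)
  rw [Nat.cast_one, mul_one] at key
  exact key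

theorem measure_corrFailure_le (h : H.Suitable d M ε Y) (S : H.Sections) :
    (Measure.pi fun _ : H.Idx => stdGaussian (EuclideanSpace ℝ (Fin d)))
      {G | CorrFailure G S} ≤ ENNReal.ofReal (Real.exp (-3)) := by
  have hY := h.one_le_Y
  have hP : (Fintype.card (Fin (H.P + 1)) : ℝ) ≤ Real.exp Y := by
    rw [Fintype.card_fin]; exact_mod_cast h.P_le
  have hT : (Fintype.card (Fin H.T) : ℝ) ≤ Real.exp Y := by rw [Fintype.card_fin]; exact h.T_le
  refine (measure_exists_le_exp _ hP (b := 1 - 6 * Y) fun p => ?_).trans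
    (ENNReal.ofReal_le_ofReal (Real.exp_le_exp.2 (by linarith)))
  have hp : (p : ℕ) ≤ H.P := Nat.lt_succ_iff.1 p.2
  have hJ : (Fintype.card (Fin (H.J p)) : ℝ) ≤ Real.exp Y := by
    rw [Fintype.card_fin]; exact h.J_le hp
  have hB : (Fintype.card (Fin (H.B p)) : ℝ) ≤ Real.exp Y := by
    rw [Fintype.card_fin]; exact h.B_le p hp
  have hvec : ∀ f : Fin (H.l p) → Fin (H.B p),
      (Measure.pi fun _ : H.Idx => stdGaussian (EuclideanSpace ℝ (Fin d)))
        {G | ¬ CorrBound (4 * √(H.l p * H.D p)) fun i => H.vec G p i (f i)}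
      ≤ ENNReal.ofReal (Real.exp (-8 * Y)) := by
    intro f
    have h1 := measure_not_corrBound_le (d := d) (h.l_pos p hp) (H.D p)
      (f := fun i => (⟨p, i, f i⟩ : H.Idx)) (fun i i' hii => by
        have := eq_of_heq (Sigma.mk.inj_iff.1 hii).2
        exact (Prod.mk_inj.1 this).1)
    have h2 : ∀ G : H.Idx → EuclideanSpace ℝ (Fin d), (fun i => H.vec G p i (f i))
        = fun i => trunc (H.D p) (G ⟨p, i, f i⟩) := by
      intro G; funext i; unfold vec; rw [dif_pos p.2]
    simp only [h2]
    exact h1.trans (ENNReal.ofReal_le_ofReal (Real.exp_le_exp.2 (by linarith [h.l_add_le p hp])))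
  have h1 : (Measure.pi fun _ : H.Idx => stdGaussian (EuclideanSpace ℝ (Fin d)))
      {G | ∃ b, ¬ CorrBound (4 * √(H.l p * H.D p)) fun i => H.vec G p i b}
      ≤ ENNReal.ofReal (Real.exp (-6 * Y)) :=
    (measure_exists_le_exp _ hB fun b => hvec fun _ => b).trans
      (ENNReal.ofReal_le_ofReal (Real.exp_le_exp.2 (by linarith)))
  have h2 : (Measure.pi fun _ : H.Idx => stdGaussian (EuclideanSpace ℝ (Fin d)))
      {G | ∃ e : Fin H.T, ∃ j : Fin (H.J p),
        ¬ CorrBound (4 * √(H.l p * H.D p)) (H.testVec G S p e j)}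
      ≤ ENNReal.ofReal (Real.exp (-6 * Y)) := by
    refine (measure_exists_le_exp _ hT fun e => measure_exists_le_exp _ hJ fun j => ?_).trans
      (ENNReal.ofReal_le_ofReal (Real.exp_le_exp.2 (by linarith : Y + (Y + -8 * Y) ≤ _)))
    have h3 : ∀ G : H.Idx → EuclideanSpace ℝ (Fin d), H.testVec G S p e j
        = fun i => H.vec G p i (S ⟨p, e, j⟩ i) := by
      intro G; unfold testVec; rw [dif_pos ⟨p.2, e.2, j.2⟩]
    simp only [h3]
    exact hvec _
  calc _ ≤ ENNReal.ofReal (Real.exp (-6 * Y)) + ENNReal.ofReal (Real.exp (-6 * Y)) :=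
        (measure_union_le _ _).trans (add_le_add h1 h2)
    _ = ENNReal.ofReal (2 * Real.exp (-6 * Y)) := by
        rw [← ENNReal.ofReal_add (Real.exp_pos _).le (Real.exp_pos _).le]; congr 1; ring
    _ ≤ _ := by
        refine ENNReal.ofReal_le_ofReal ?_
        rw [show (1 : ℝ) - 6 * Y = 1 + -6 * Y by ring, Real.exp_add]
        have : (2 : ℝ) ≤ Real.exp 1 := by linarith [Real.add_one_le_exp (1 : ℝ)]
        gcongr

/-- Here the vectors are fixed and the sections random, unlike in the three other failures. -/
theorem measure_testFailure_le [∀ p : Fin (H.P + 1), NeZero (H.B p)] (h : H.Suitable d M ε Y)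
    (G : H.Idx → EuclideanSpace ℝ (Fin d)) :
    (Measure.pi fun s : H.Slot => sectionLaw (H.l s.1) (H.B s.1))
      {S | TestFailure q u m₀ G S} ≤ ENNReal.ofReal (Real.exp (-3)) := by
  have hY := h.one_le_Y
  have hP : (Fintype.card (Fin (H.P + 1)) : ℝ) ≤ Real.exp Y := by
    rw [Fintype.card_fin]; exact_mod_cast h.P_le
  have hT : (Fintype.card (Fin H.T) : ℝ) ≤ Real.exp Y := by rw [Fintype.card_fin]; exact h.T_le
  refine (measure_exists_le_exp _ hP (b := 1 - 5 * Y) fun p => ?_).trans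
    (ENNReal.ofReal_le_ofReal (Real.exp_le_exp.2 (by linarith)))
  have hp : (p : ℕ) ≤ H.P := Nat.lt_succ_iff.1 p.2
  have hJ : (Fintype.card (Fin (H.J p)) : ℝ) ≤ Real.exp Y := by
    rw [Fintype.card_fin]; exact h.J_le hp
  obtain ⟨Q, hQ0, hQ, hQY⟩ := h.net p hp
  refine (measure_exists_le_exp _ hT fun e => measure_exists_le_exp _ hJ fun i =>
    measure_exists_le_exp _ (card_fun_fin_le h.T_le) fun r => measure_exists_le_exp _ hJ
    (b := H.J p * Y + (1 - H.l p * H.α p ^ 2 / 2)) fun j => measure_le_exp_of_imp _ fun hij => ?_).trans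
    (ENNReal.ofReal_le_ofReal (Real.exp_le_exp.2 (by linarith [h.tests_le p hp])))
  refine (measure_near_span_deviation_le q u m₀ G p e j hij (extendFin r) (h.l_pos p hp)
    (h.δ_pos p hp) hQ hQ0 (by unfold α; positivity) (h.corr p hp)).trans
    (ENNReal.ofReal_le_ofReal ?_)
  rw [Real.exp_add, sub_eq_add_neg, Real.exp_add, Real.exp_nat_mul]
  have : (2 : ℝ) ≤ Real.exp 1 := by linarith [Real.add_one_le_exp (1 : ℝ)]
  gcongr

theorem measurableSet_epochFailure
    (hqu : ∀ (S : H.Sections) (cut : ℕ → ℕ → ℕ) (t₀ : ℕ) (m : Memory M) (n : ℕ),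
      Measurable fun G : H.Idx → EuclideanSpace ℝ (Fin d) =>
        runQuery q u ((H.tests G S).resp cut) t₀ m n) (S : H.Sections) :
    MeasurableSet {G : H.Idx → EuclideanSpace ℝ (Fin d) | EpochFailure q u G S} := by
  refine measurableSet_setOfPred.2 (Measurable.exists fun p => Measurable.exists fun e =>
    Measurable.exists fun m => Measurable.exists fun r => measurable_const.and ?_)
  exact measurableSet_setOfPred.1 (measurableSet_epoch q u hqu S p _ e m _ (extendFin r))

theorem measurableSet_topFailure
    (hqu : ∀ (S : H.Sections) (cut : ℕ → ℕ → ℕ) (t₀ : ℕ) (m : Memory M) (n : ℕ),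
      Measurable fun G : H.Idx → EuclideanSpace ℝ (Fin d) =>
        runQuery q u ((H.tests G S).resp cut) t₀ m n) (S : H.Sections) :
    MeasurableSet {G : H.Idx → EuclideanSpace ℝ (Fin d) | TopFailure q u m₀ G S} := by
  refine measurableSet_setOfPred.2 (Measurable.exists fun t => ?_)
  exact measurableSet_setOfPred.1 (measurableSet_epoch q u hqu S H.P _ 0 m₀ 1 fun _ => t)

theorem measurableSet_corrFailure (S : H.Sections) :
    MeasurableSet {G : H.Idx → EuclideanSpace ℝ (Fin d) | CorrFailure G S} := by
  refine measurableSet_setOfPred.2 (Measurable.exists fun p => Measurable.or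
    (Measurable.exists fun b => Measurable.not ?_)
    (Measurable.exists fun e => Measurable.exists fun j => Measurable.not ?_))
  · have h1 : Measurable fun G : H.Idx → EuclideanSpace ℝ (Fin d) => fun i => H.vec G p i b :=
      measurable_pi_lambda _ fun i => H.measurable_vec p i b
    exact measurableSet_setOfPred.1 (h1 (isClosed_corrBound _).measurableSet)
  · exact measurableSet_setOfPred.1
      (H.measurable_testVec (d := d) S p e j (isClosed_corrBound _).measurableSet)

/-- For fixed seeds, some query passes all tests with probability less than a quarter. -/
theorem lintegral_measure_passes_le [∀ p : Fin (H.P + 1), NeZero (H.B p)]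
    (h : H.Suitable d M ε Y)
    (hqu : ∀ (S : H.Sections) (cut : ℕ → ℕ → ℕ) (t₀ : ℕ) (m : Memory M) (n : ℕ),
      Measurable fun G : H.Idx → EuclideanSpace ℝ (Fin d) =>
        runQuery q u ((H.tests G S).resp cut) t₀ m n) :
    ∫⁻ G, (Measure.pi fun s : H.Slot => sectionLaw (H.l s.1) (H.B s.1)) {S | ∃ t < H.T,
        (H.tests G S).Passes (H.P + 1) t
          (runQuery q u ((H.tests G S).resp (H.tests G S).full) 0 m₀ t)}
      ∂(Measure.pi fun _ : H.Idx => stdGaussian (EuclideanSpace ℝ (Fin d)))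
      ≤ ENNReal.ofReal (1 / 4) := by
  set σ := Measure.pi fun s : H.Slot => sectionLaw (H.l s.1) (H.B s.1) with hσ
  set γ := Measure.pi fun _ : H.Idx => stdGaussian (EuclideanSpace ℝ (Fin d)) with hγ
  set F : (H.Idx → EuclideanSpace ℝ (Fin d)) → H.Sections → Prop := fun G S =>
    EpochFailure q u G S ∨ TopFailure q u m₀ G S ∨ CorrFailure G S with hF
  have hFm : ∀ S, MeasurableSet {G | F G S} := fun S =>
    (measurableSet_epochFailure hqu S).union
      ((measurableSet_topFailure hqu S).union (measurableSet_corrFailure S))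
  have hFm' : MeasurableSet {z : H.Sections × (H.Idx → EuclideanSpace ℝ (Fin d)) | F z.2 z.1} :=
    measurableSet_setOfPred.2 (measurable_from_prod_countable_right fun S =>
      measurableSet_setOfPred.1 (hFm S))
  set c := ENNReal.ofReal (Real.exp (-3)) with hc
  have hF3 : ∀ S, γ {G | F G S} ≤ c + (c + c) := fun S =>
    (measure_union_le _ _).trans (add_le_add (measure_epochFailure_le h hqu S)
      ((measure_union_le _ _).trans (add_le_add (measure_topFailure_le h hqu S)
        (measure_corrFailure_le h S))))
  -- These failures were bounded over the vectors for each choice of sections; Tonelli exchanges the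
  -- order.
  have hswap : ∫⁻ G, σ {S | F G S} ∂γ ≤ c + (c + c) := by
    calc ∫⁻ G, σ {S | F G S} ∂γ
        = (σ.prod γ) {z : H.Sections × (H.Idx → EuclideanSpace ℝ (Fin d)) | F z.2 z.1} :=
          (Measure.prod_apply_symm hFm').symm
      _ = ∫⁻ S, γ {G | F G S} ∂σ := Measure.prod_apply hFm'
      _ ≤ ∫⁻ _, c + (c + c) ∂σ := lintegral_mono hF3
      _ = _ := by simp
  calc _ ≤ ∫⁻ G, (σ {S | F G S} + c) ∂γ := by
        refine lintegral_mono fun G => ?_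
        refine (measure_mono fun S hS => ?_).trans ((measure_union_le {S | F G S}
          {S | TestFailure q u m₀ G S}).trans (add_le_add le_rfl (measure_testFailure_le h G)))
        by_contra hcon
        rw [Set.mem_union, not_or] at hcon
        obtain ⟨hcon1, hcon2⟩ := hcon
        obtain ⟨t, ht, hpass⟩ := hS
        exact not_passes_of_not_failure h (fun hh => hcon1 (Or.inl hh))
          (fun hh => hcon1 (Or.inr (Or.inl hh))) (fun hh => hcon1 (Or.inr (Or.inr hh))) hcon2
          t ht hpass
    _ = ∫⁻ G, σ {S | F G S} ∂γ + c := by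
        rw [lintegral_add_right _ measurable_const]; simp
    _ ≤ c + (c + c) + c := by gcongr
    _ = ENNReal.ofReal (4 * Real.exp (-3)) := by
        rw [hc, ← ENNReal.ofReal_add, ← ENNReal.ofReal_add, ← ENNReal.ofReal_add]
        · congr 1; ring
        all_goals positivity
    _ ≤ _ := by
        refine ENNReal.ofReal_le_ofReal ?_
        linarith [exp_neg_three_le]

/-- If no vector is too long, moving by ε from a centre orthogonal to all vectors changes a
correlation by at most ε · 4√D ≤ δ/24. The failure probability is at most e⁻³ + 1/20 + 1/20. -/
theorem measure_not_closedBall_subset_le (h : H.Suitable d M ε Y) :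
    (Measure.pi fun _ : H.Idx => stdGaussian (EuclideanSpace ℝ (Fin d)))
      {G | ¬ ∃ c, Metric.closedBall c ε ⊆ H.feasible G} ≤ ENNReal.ofReal (1 / 4) := by
  classical
  have hY := h.one_le_Y
  set γ := Measure.pi fun _ : H.Idx => stdGaussian (EuclideanSpace ℝ (Fin d)) with hγ
  have hP : (Fintype.card (Fin (H.P + 1)) : ℝ) ≤ Real.exp Y := by
    rw [Fintype.card_fin]; exact_mod_cast h.P_le
  set top : Finset H.Idx := (Finset.univ : Finset (Fin (H.l H.P) × Fin (H.B H.P))).map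
    (Function.Embedding.sigmaMk (⟨H.P, by omega⟩ : Fin (H.P + 1))) with htop
  have hmem : ∀ a : H.Idx, a ∈ top ↔ (a.1 : ℕ) = H.P := by
    rintro ⟨⟨p, hp⟩, c⟩
    rw [htop, Finset.mem_map]
    constructor
    · rintro ⟨c', -, hc'⟩
      exact (congrArg (fun a : H.Idx => (a.1 : ℕ)) hc').symm
    · rintro heq
      obtain rfl : p = H.P := heq
      exact ⟨c, Finset.mem_univ _, rfl⟩
  have hcard : (top.card : ℝ) = H.l H.P * H.B H.P := by
    rw [htop, Finset.card_map, Finset.card_univ, Fintype.card_prod, Fintype.card_fin,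
      Fintype.card_fin]
    push_cast; ring
  have hidx : (Fintype.card H.Idx : ℝ) = ∑ p ∈ Finset.range (H.P + 1), (H.l p * H.B p : ℝ) := by
    rw [Fintype.card_sigma, Finset.sum_range]
    push_cast
    exact Finset.sum_congr rfl fun p _ => by
      rw [Fintype.card_prod, Fintype.card_fin, Fintype.card_fin]; push_cast; ring
  have hd : (0 : ℝ) < d := by exact_mod_cast Nat.pos_of_ne_zero (NeZero.ne d)
  have hDd : (H.D H.P : ℝ) ≤ d := by exact_mod_cast h.D_top_le
  have hD0 : (0 : ℝ) < H.D H.P := by exact_mod_cast h.D_top_pos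
  have htc := h.top_card_le
  rw [← hcard] at htc
  have hcl := h.card_le
  rw [← hidx] at hcl
  have htd : top.card < d := by
    have h1 : (top.card : ℝ) < d := by linarith [(Nat.cast_nonneg top.card : (0 : ℝ) ≤ top.card)]
    exact_mod_cast h1
  have h1 := measure_not_exists_center_le (d := d) (fun a : H.Idx => H.D a.1) top h.D_top_pos
    h.D_top_le (fun a ha => by rw [(hmem a).1 ha]) (fun a ha => h.le_D _ (by
      have h2 := a.1.2
      have h3 : (a.1 : ℕ) ≠ H.P := fun h3 => ha ((hmem a).2 h3)
      omega)) htd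
  have h2 : γ {G | ∃ p : Fin (H.P + 1), ∃ i : Fin (H.l p), ∃ b : Fin (H.B p),
      4 * √(H.D p) < ‖trunc (H.D p) (G ⟨p, i, b⟩)‖} ≤ ENNReal.ofReal (Real.exp (-3)) := by
    refine (measure_exists_le_exp _ hP (b := -6 * Y) fun p => ?_).trans
      (ENNReal.ofReal_le_ofReal (Real.exp_le_exp.2 (by linarith)))
    have hp : (p : ℕ) ≤ H.P := Nat.lt_succ_iff.1 p.2
    refine (measure_exists_le_exp _ (by rw [Fintype.card_fin]; exact h.l_le p hp)
      fun i => measure_exists_le_exp _ (by rw [Fintype.card_fin]; exact h.B_le p hp)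
      fun b => measure_norm_trunc_le (H.D p) _).trans
      (ENNReal.ofReal_le_ofReal (Real.exp_le_exp.2 ?_))
    have hl : (0 : ℝ) ≤ H.l p := by positivity
    linarith [h.l_add_le p hp]
  have hsub : {G : H.Idx → EuclideanSpace ℝ (Fin d) | ¬ ∃ c, Metric.closedBall c ε ⊆ H.feasible G} ⊆
      {G | ∃ p : Fin (H.P + 1), ∃ i : Fin (H.l p), ∃ b : Fin (H.B p),
        4 * √(H.D p) < ‖trunc (H.D p) (G ⟨p, i, b⟩)‖} ∪
      {G | ¬ ∃ c : EuclideanSpace ℝ (Fin d), ‖c‖ ≤ 1 / 2 ∧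
        3 / 8 ≤ inner ℝ (EuclideanSpace.single 0 1) c ∧
        ∀ a : H.Idx, inner ℝ (trunc (H.D a.1) (G a)) c = 0} := by
    intro G hG
    by_contra hcon
    rw [Set.mem_union, not_or] at hcon
    obtain ⟨hn, hc⟩ := hcon
    rw [Set.mem_ofPred_eq] at hn hc
    push Not at hn
    rw [not_not] at hc
    obtain ⟨c, hc1, hc2, hc3⟩ := hc
    refine hG ⟨c, fun y hy => ?_⟩
    rw [mem_closedBall_iff_norm] at hy
    have hyc : y = c + (y - c) := by abel
    have hε := h.ε_le
    refine ⟨?_, ?_, fun a => ?_⟩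
    · rw [hyc]
      exact (norm_add_le _ _).trans (by linarith)
    · rw [hyc, inner_add_right]
      have h3 := abs_real_inner_le_norm (EuclideanSpace.single (0 : Fin d) (1 : ℝ)) (y - c)
      rw [show ‖EuclideanSpace.single (0 : Fin d) (1 : ℝ)‖ = 1 by simp, one_mul] at h3
      linarith [(abs_le.1 h3).1]
    · have hp : (a.1 : ℕ) ≤ H.P := Nat.lt_succ_iff.1 a.1.2
      have hv : H.vec G a.1 a.2.1 a.2.2 = trunc (H.D a.1) (G a) := by
        unfold vec; rw [dif_pos a.1.2]
      rw [hv, hyc, inner_add_right, hc3 a, zero_add]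
      refine (abs_real_inner_le_norm _ _).trans (le_trans ?_ (h.ε_mul_le _ hp))
      rw [mul_comm ε]
      exact mul_le_mul (hn a.1 a.2.1 a.2.2) hy (norm_nonneg _) (by positivity)
  refine (measure_mono hsub).trans ((measure_union_le _ _).trans ((add_le_add h2 h1).trans ?_))
  rw [← ENNReal.ofReal_add (by positivity) (div_nonneg (by positivity) (by
      have : (top.card : ℝ) ≤ d := by exact_mod_cast htd.le
      linarith)), ← ENNReal.ofReal_add (by positivity) (add_nonneg (by positivity)
      (div_nonneg (by positivity) (by
      have : (top.card : ℝ) ≤ d := by exact_mod_cast htd.le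
      linarith)))]
  refine ENNReal.ofReal_le_ofReal ?_
  have h3 : (top.card : ℝ) / (H.D H.P * (1 / 16)) ≤ 1 / 20 := by
    rw [div_le_iff₀ (by positivity)]; linarith
  have h4 : (Fintype.card H.Idx : ℝ) / ((d - top.card) * (1 / 16)) ≤ 1 / 20 := by
    rw [div_le_iff₀ (by linarith)]; linarith
  linarith [exp_neg_three_le]

/-- The hard instance defeats every algorithm with few bits of memory. -/
theorem not_solves (h : H.Suitable d M ε Y) (A : Algorithm d M) : ¬ A.Solves ε H.T (9 / 10) := by
  intro hA
  have : ∀ p : Fin (H.P + 1), NeZero (H.B p) := fun p => ⟨by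
    have h1 := h.N_pos p (Nat.lt_succ_iff.1 p.2)
    have h2 := h.J_pos p (Nat.lt_succ_iff.1 p.2)
    unfold B
    positivity⟩
  set σ := Measure.pi fun s : H.Slot => sectionLaw (H.l s.1) (H.B s.1) with hσ
  set γ := Measure.pi fun _ : H.Idx => stdGaussian (EuclideanSpace ℝ (Fin d)) with hγ
  set ν := Measure.infinitePi A.seedLaw with hν
  set f : (ℕ → A.Seed) → (H.Idx → EuclideanSpace ℝ (Fin d)) → ℝ≥0∞ := fun s G =>
    σ {S | H.Wins A s G S} with hf
  have hW := H.measurableSet_wins (d := d) A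
  have hfm : Measurable (Function.uncurry f) := measurable_measure_prodMk_right hW
  have hup : ∫⁻ G, ∫⁻ s, f s G ∂ν ∂γ ≤ ENNReal.ofReal (1 / 4) := by
    rw [← lintegral_lintegral_swap hfm.aemeasurable]
    calc _ ≤ ∫⁻ _, ENNReal.ofReal (1 / 4) ∂ν := by
          refine lintegral_mono fun s => ?_
          refine lintegral_measure_passes_le h fun S cut t₀ m n => ?_
          exact (H.measurable_runQuery_tests A S cut t₀ m n).comp
            ((measurable_const (a := s)).prodMk measurable_id)
      _ = _ := by simp
  have hlow : ∀ G, (∃ c, Metric.closedBall c ε ⊆ H.feasible G) →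
      ENNReal.ofReal (9 / 10) ≤ ∫⁻ s, f s G ∂ν := by
    intro G hG
    refine (le_prod_wins H hA h.δ_pos hG).trans (le_of_eq ?_)
    have hm : MeasurableSet {z : (ℕ → A.Seed) × H.Sections | H.Wins A z.1 G z.2} :=
      (measurable_snd.prodMk (measurable_fst.prodMk measurable_const) : Measurable
        fun z : (ℕ → A.Seed) × H.Sections => (z.2, z.1, G)) hW
    exact Measure.prod_apply hm
  -- At least 3/4 of the instances contain an ε-ball and are won with probability 9/10, but the
  -- average winning probability is at most 1/4 < 27/40.
  have hmark := (mul_meas_ge_le_lintegral (μ := γ) (hfm.lintegral_prod_left (μ := ν))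
    (ENNReal.ofReal (9 / 10))).trans hup
  have hcov : (1 : ℝ≥0∞) ≤ γ {G | ENNReal.ofReal (9 / 10) ≤ ∫⁻ s, f s G ∂ν} +
      ENNReal.ofReal (1 / 4) := by
    calc (1 : ℝ≥0∞) = γ Set.univ := measure_univ.symm
      _ ≤ γ ({G | ENNReal.ofReal (9 / 10) ≤ ∫⁻ s, f s G ∂ν} ∪
          {G | ¬ ∃ c, Metric.closedBall c ε ⊆ H.feasible G}) := by
          refine measure_mono fun G _ => ?_
          by_cases hG : ∃ c, Metric.closedBall c ε ⊆ H.feasible G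
          · exact Or.inl (hlow G hG)
          · exact Or.inr hG
      _ ≤ _ := (measure_union_le _ _).trans
          (add_le_add le_rfl (measure_not_closedBall_subset_le h))
  replace hmark : ENNReal.ofReal (9 / 10) * γ {G | ENNReal.ofReal (9 / 10) ≤ ∫⁻ s, f s G ∂ν}
      ≤ ENNReal.ofReal (1 / 4) := hmark
  set x := γ {G | ENNReal.ofReal (9 / 10) ≤ ∫⁻ s, f s G ∂ν} with hx
  have hxt : x ≠ ∞ := measure_ne_top _ _
  obtain ⟨y, hy⟩ : ∃ y : NNReal, (y : ℝ≥0∞) = x := ⟨x.toNNReal, ENNReal.coe_toNNReal hxt⟩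
  rw [← hy] at hcov hmark
  have h1 : (1 : ℝ) ≤ y + 1 / 4 := by
    have := ENNReal.toReal_mono (by finiteness) hcov
    rw [ENNReal.toReal_add (by finiteness) (by finiteness),
      ENNReal.toReal_ofReal (by norm_num)] at this
    simpa using this
  have h2 : (9 / 10 : ℝ) * y ≤ 1 / 4 := by
    have := ENNReal.toReal_mono (by finiteness) hmark
    rw [ENNReal.toReal_mul, ENNReal.toReal_ofReal (by norm_num),
      ENNReal.toReal_ofReal (by norm_num)] at this
    simpa using this
  linarith

end Suitable

end Params

end

end Feasibility

namespace Feasibility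

noncomputable section

namespace Params

/-- The parameters of the hard instance for algorithms with `κ * d` bits of memory. -/
def standard (Λ κ d P D' : ℕ) : Params where
  P := P
  -- Since l N J ≥ d / (2560 Λ) below the top, this makes 2 J (p+1) l N J at least 2κd, twice the
  -- memory. Throughout, `Λ` bounds the logarithms and the number of levels.
  J p := if p = 0 then 1 else 2560 * Λ * κ
  N p := (if p < P then d else D') /
    (1280 * Λ * (46080 * (if p = 0 then 1 else 2560 * Λ * κ) ^ 3 * Λ) *
      (if p = 0 then 1 else 2560 * Λ * κ))
  -- With α = 1/(48 J), the Hoeffding exponent l α² / 2 equals 10 J Λ.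
  l p := 46080 * (if p = 0 then 1 else 2560 * Λ * κ) ^ 3 * Λ
  D p := if p < P then d else D'
  -- From the top down, each scale is the previous one divided by 120000 √D = 60 · 2000 √D: 2000 √D
  -- passes from δ to η, and 60 to the δ of the level below.
  δ p := if p < P then 1 / (240 * (120000 * √D') * (120000 * √d) ^ (P - 1 - p)) else 1 / 240
  η p := (if p < P then 1 / (240 * (120000 * √D') * (120000 * √d) ^ (P - 1 - p)) else 1 / 240) /
    (2000 * √(if p < P then d else D' : ℕ))

/-! ### The choice of the parameters -/

section Standard

variable {Λ κ d P D' M : ℕ} {ε : ℝ}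

/-- The largest block size of the standard parameters. -/
def maxBlock (Λ κ : ℕ) : ℕ :=
  1280 * Λ * (46080 * (2560 * Λ * κ) ^ 3 * Λ) * (2560 * Λ * κ)

/-- The block size of a level. -/
def block (Λ κ p : ℕ) : ℕ :=
  1280 * Λ * (46080 * (if p = 0 then 1 else 2560 * Λ * κ) ^ 3 * Λ) *
    (if p = 0 then 1 else 2560 * Λ * κ)

theorem block_le (hΛ : 0 < Λ) (hκ : 0 < κ) (p : ℕ) : block Λ κ p ≤ maxBlock Λ κ := by
  have h : (if p = 0 then 1 else 2560 * Λ * κ) ≤ 2560 * Λ * κ := by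
    split_ifs
    · have := Nat.mul_pos hΛ hκ; nlinarith
    · exact le_rfl
  unfold block maxBlock
  gcongr

theorem block_pos (hΛ : 0 < Λ) (hκ : 0 < κ) (p : ℕ) : 0 < block Λ κ p := by
  unfold block
  split_ifs <;> positivity

theorem standard_N (p : ℕ) :
    (standard Λ κ d P D').N p = (standard Λ κ d P D').D p / block Λ κ p := rfl

theorem block_eq (p : ℕ) : block Λ κ p =
    1280 * Λ * ((standard Λ κ d P D').l p * (standard Λ κ d P D').J p) := by
  simp only [block, standard]; ring

theorem standard_J_pos (hΛ : 0 < Λ) (hκ : 0 < κ) (p : ℕ) : 0 < (standard Λ κ d P D').J p := by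
  simp only [standard]
  split_ifs
  · norm_num
  · positivity

theorem le_standard_D (hD' : D' ≤ d) (hw : maxBlock Λ κ ≤ D') (p : ℕ) :
    maxBlock Λ κ ≤ (standard Λ κ d P D').D p := by
  simp only [standard]
  split_ifs
  · exact hw.trans hD'
  · exact hw

theorem standard_D_le (hD' : D' ≤ d) (p : ℕ) : (standard Λ κ d P D').D p ≤ d := by
  simp only [standard]
  split_ifs
  · exact le_rfl
  · exact hD'

/-- The quotient is at least 1, so rounding it down loses at most a factor 2. -/
theorem le_two_mul_block_mul_N (hΛ : 0 < Λ) (hκ : 0 < κ) (hD' : D' ≤ d)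
    (hw : maxBlock Λ κ ≤ D') (p : ℕ) :
    (standard Λ κ d P D').D p ≤ 2 * (block Λ κ p * (standard Λ κ d P D').N p) := by
  have h1 := (block_le hΛ hκ p).trans (le_standard_D (P := P) hD' hw p)
  have h2 := block_pos hΛ hκ p
  have h3 := Nat.div_add_mod ((standard Λ κ d P D').D p) (block Λ κ p)
  have h4 := Nat.mod_lt ((standard Λ κ d P D').D p) h2
  have h5 : 1 ≤ (standard Λ κ d P D').D p / block Λ κ p := Nat.div_pos h1 h2
  rw [standard_N]
  have h6 := Nat.mul_le_mul_left (block Λ κ p) h5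
  omega

theorem block_mul_N_le (p : ℕ) :
    block Λ κ p * (standard Λ κ d P D').N p ≤ (standard Λ κ d P D').D p := by
  rw [standard_N]; exact Nat.mul_div_le _ _

theorem standard_T_le :
    (standard Λ κ d P D').T ≤ d ^ P * D' := by
  have hN : ∀ p, (standard Λ κ d P D').N p ≤ (standard Λ κ d P D').D p := fun p => by
    rw [standard_N]; exact Nat.div_le_self _ _
  change ∏ p ∈ Finset.range (P + 1), (standard Λ κ d P D').N p ≤ _
  calc ∏ p ∈ Finset.range (P + 1), (standard Λ κ d P D').N p ≤ ∏ p ∈ Finset.range (P + 1), (standard Λ κ d P D').D p :=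
        Finset.prod_le_prod' fun p _ => hN p
    _ = d ^ P * D' := by
        rw [Finset.prod_range_succ]
        congr 1
        · rw [Finset.prod_congr rfl (g := fun _ => d) fun p hp => by
            simp [standard, Finset.mem_range.1 hp]]
          simp
        · simp [standard]

set_option maxHeartbeats 2000000 in
theorem suitable_standard (hΛ : 0 < Λ) (hκ : 0 < κ) (hM : M ≤ κ * d) (hε0 : 0 < ε)
    (hεΛ : (1 / ε) ^ 5 ≤ Real.exp Λ) (hd : (d : ℝ) ≤ (1 / ε) ^ 2) (hD' : D' ≤ d)
    (hw : maxBlock Λ κ ≤ D') (hP : P + 1 ≤ Λ)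
    (hε : (23040 ^ 2 : ℝ) * D' * (120000 ^ 2 * d) ^ P ≤ (1 / ε) ^ 2) :
    (standard Λ κ d P D').Suitable d M ε Λ := by
  set H := standard Λ κ d P D' with hH
  have hΛ1 : (1 : ℝ) ≤ Λ := by exact_mod_cast hΛ
  have hJ : ∀ p, 0 < H.J p := standard_J_pos hΛ hκ
  have hD : ∀ p, maxBlock Λ κ ≤ H.D p := le_standard_D hD' hw
  have hDd : ∀ p, H.D p ≤ d := standard_D_le hD'
  have hbD : ∀ p, block Λ κ p ≤ H.D p := fun p => (block_le hΛ hκ p).trans (hD p)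
  have hl : ∀ p, H.l p = 46080 * (H.J p) ^ 3 * Λ := fun p => rfl
  have hlpos : ∀ p, 0 < H.l p := fun p => by rw [hl]; have := hJ p; positivity
  have hb : ∀ p, block Λ κ p = 1280 * Λ * (H.l p * H.J p) := fun p => block_eq p
  have hNpos : ∀ p, 0 < H.N p := fun p => Nat.div_pos (hbD p) (block_pos hΛ hκ p)
  have hlarge : 64 * Λ ≤ maxBlock Λ κ := by
    refine le_trans ?_ (block_le hΛ hκ 0)
    simp only [block, if_true]
    nlinarith
  have hD'pos : 0 < D' := by omega
  have hD'1 : (1 : ℝ) ≤ D' := by exact_mod_cast hD'pos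
  have hd64 : (64 : ℝ) ≤ d := by exact_mod_cast (by omega : 64 ≤ d)
  set x : ℝ := 1 / ε with hx
  have hx0 : 0 < x := by positivity
  have hx8 : 8 ≤ x := by nlinarith
  have hx1 : 1 ≤ x := by linarith
  have hεx : ε * x = 1 := by rw [hx]; field_simp
  have hx25 : x ^ 2 ≤ Real.exp Λ := (pow_le_pow_right₀ hx1 (by norm_num)).trans hεΛ
  have hdY : (d : ℝ) ≤ Real.exp Λ := hd.trans hx25
  have hsd : (1 : ℝ) ≤ √d := by rw [Real.one_le_sqrt]; linarith
  have hsD' : (1 : ℝ) ≤ √D' := by rw [Real.one_le_sqrt]; exact hD'1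
  have hU : ε * (23040 * √D' * (120000 * √d) ^ P) ≤ 1 := by
    have h1 : (23040 * √D' * (120000 * √d) ^ P) ^ 2 ≤ x ^ 2 := by
      refine le_trans (le_of_eq ?_) hε
      rw [mul_pow, mul_pow, Real.sq_sqrt (by linarith), ← pow_mul, mul_comm P 2, pow_mul, mul_pow,
        Real.sq_sqrt (by linarith)]
    have h2 := (sq_le_sq₀ (by positivity) hx0.le).1 h1
    calc _ ≤ ε * x := by gcongr
      _ = 1 := hεx
  have hεδ : ∀ p ≤ P, ε * (96 * √(H.D p)) ≤ H.δ p := by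
    intro p hp
    have hpow : ∀ m ≤ P, (120000 * √(d : ℝ)) ^ m ≤ (120000 * √d) ^ P := fun m hm =>
      pow_le_pow_right₀ (by linarith) hm
    simp only [hH, standard]
    split_ifs with h
    · rw [le_div_iff₀ (by positivity)]
      have h1 : (120000 * √(d : ℝ)) ^ (P - 1 - p) * (120000 * √d) = (120000 * √d) ^ (P - p) := by
        rw [← pow_succ]; congr 1; omega
      calc _ = ε * (23040 * √D' * ((120000 * √(d : ℝ)) ^ (P - 1 - p) * (120000 * √d))) := by ring
        _ ≤ ε * (23040 * √D' * (120000 * √d) ^ P) := by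
            rw [h1]
            have := hpow (P - p) (by omega)
            gcongr
        _ ≤ 1 := hU
    · have := hpow 0 (by omega)
      rw [pow_zero] at this
      have h2 : ε * (23040 * √D' * 1) ≤ ε * (23040 * √D' * (120000 * √d) ^ P) := by gcongr
      linarith
  have hδ : ∀ p, 0 < H.δ p := by
    intro p
    simp only [hH, standard]
    split_ifs <;> positivity
  have hsD : ∀ p, (1 : ℝ) ≤ √(H.D p) := fun p => by
    rw [Real.one_le_sqrt]; exact_mod_cast (by have := hD p; omega : 1 ≤ H.D p)
  have hηδ : ∀ p, H.η p = H.δ p / (2000 * √(H.D p)) := fun p => rfl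
  have hδtop : ∀ p, H.δ p ≤ 1 / 240 := by
    intro p
    simp only [hH, standard]
    split_ifs
    · refine one_div_le_one_div_of_le (by norm_num) ?_
      have h1 : (1 : ℝ) ≤ (120000 * √d) ^ (P - 1 - p) := one_le_pow₀ (by linarith)
      nlinarith
    · exact le_rfl
  have hηpos : ∀ p, 0 < H.η p := fun p => by
    rw [hηδ]; have := hδ p; have := hsD p; positivity
  have hsum : ∀ p, (1280 * Λ * (H.l p * H.N p * H.J p) : ℝ) ≤ H.D p := by
    intro p
    have h1 := block_mul_N_le (Λ := Λ) (κ := κ) (d := d) (P := P) (D' := D') p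
    rw [← hH, hb p] at h1
    have h2 : ((1280 * Λ * (H.l p * H.J p) * H.N p : ℕ) : ℝ) ≤ H.D p := by exact_mod_cast h1
    push_cast at h2
    linarith
  have hBcast : ∀ p, ((H.B p : ℕ) : ℝ) = 2 * H.N p * H.J p := fun p => by push_cast; ring
  have hl1 : ∀ p, (1 : ℝ) ≤ H.l p := fun p => by exact_mod_cast hlpos p
  have hJ1 : ∀ p, (1 : ℝ) ≤ H.J p := fun p => by exact_mod_cast hJ p
  have hN1 : ∀ p, (1 : ℝ) ≤ H.N p := fun p => by exact_mod_cast hNpos p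
  have hlb : ∀ p, (H.l p : ℝ) + 8 * Λ ≤ 3.5 * H.D p := by
    intro p
    have h1 := hbD p
    rw [hb p] at h1
    have h2 : ((1280 * Λ * (H.l p * H.J p) : ℕ) : ℝ) ≤ H.D p := by exact_mod_cast h1
    push_cast at h2
    have h3 : (64 * Λ : ℝ) ≤ H.D p := by exact_mod_cast hlarge.trans (hD p)
    have h4 : (H.l p : ℝ) ≤ 1280 * Λ * (H.l p * H.J p) := by
      have := hl1 p; have := hJ1 p
      have h5 : (H.l p : ℝ) * 1 ≤ H.l p * H.J p := by gcongr
      nlinarith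
    linarith
  refine
    { J_zero := by simp [hH, standard]
      J_pos := fun p _ => hJ p
      N_pos := fun p _ => hNpos p
      l_pos := fun p _ => hlpos p
      δ_pos := fun p _ => hδ p
      η_pos := fun p _ => hηpos p
      η_le := fun p _ => ?_
      D_top_pos := by have := hD H.P; omega
      D_top_le := hDd _
      le_D := fun p hp => by
        have : p < P := hp
        simp [hH, standard, this]
      gap := fun p hp => ?_
      gap_top := by have := hδtop H.P; linarith
      corr := fun p _ => ?_
      ε_pos := hε0
      ε_le := ?_
      ε_mul_le := fun p hp => by have := hεδ p hp; linarith
      one_le_Y := hΛ1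
      P_le := ?_
      T_le := ?_
      B_le := fun p _ => ?_
      l_le := fun p _ => ?_
      net := fun p hp => ?_
      tests_le := fun p _ => ?_
      memory_le := fun p hp => ?_
      top_le := ?_
      l_add_le := fun p _ => hlb p
      top_card_le := ?_
      card_le := ?_ }
  · rw [hηδ, div_le_iff₀ (by have := hsD p; positivity)]
    have := hδtop p; have := hsD p
    linarith
  · have hp' : p < P := hp
    rw [hηδ]
    simp only [hH, standard, if_pos hp']
    by_cases h : p + 1 < P
    · simp only [if_pos h]
      have h1 : P - 1 - p = (P - 1 - (p + 1)) + 1 := by omega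
      rw [h1, pow_succ]
      refine le_of_eq ?_
      field_simp
      norm_num
    · simp only [if_neg h]
      have h1 : P - 1 - p = 0 := by omega
      rw [h1]
      refine le_of_eq ?_
      field_simp
      norm_num
  · rw [hηδ, Real.sqrt_mul (by positivity)]
    have h1 : (H.J p : ℝ) ≤ √(H.l p) := by
      rw [Real.le_sqrt (by positivity) (by positivity), hl p]
      have h2 := hJ p
      have h3 : H.J p ^ 2 ≤ 46080 * H.J p ^ 3 * Λ := by
        calc H.J p ^ 2 ≤ H.J p ^ 3 := Nat.pow_le_pow_right h2 (by norm_num)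
          _ ≤ _ := by nlinarith [pow_pos h2 3]
      exact_mod_cast h3
    have h4 : (H.l p : ℝ) = √(H.l p) * √(H.l p) := (Real.mul_self_sqrt (by positivity)).symm
    have hs : (0 : ℝ) < √(H.l p) := by have := hJ1 p; linarith
    have h5 := hδ p
    have h6 := hsD p
    have h7 := hJ1 p
    unfold α
    calc 8 * (H.δ p / (2000 * √(H.D p))) * (4 * (√(H.l p) * √(H.D p)))
        = 2 / 125 * (H.δ p * √(H.l p)) := by field_simp; norm_num
      _ ≤ √(H.l p) / (48 * H.J p) * (H.δ p * √(H.l p)) := by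
          have : (2 / 125 : ℝ) ≤ √(H.l p) / (48 * H.J p) := by
            rw [le_div_iff₀ (by positivity)]
            linarith
          gcongr
      _ = 1 / (48 * H.J p) * (√(H.l p) * √(H.l p) * H.δ p) := by ring
      _ = _ := by rw [← h4]
  · nlinarith
  · have h1 : ((P + 1 : ℕ) : ℝ) ≤ Λ := by exact_mod_cast hP
    push_cast at h1
    have h2 := Real.add_one_le_exp (Λ : ℝ)
    change (P : ℝ) + 1 ≤ _
    linarith
  · have h1 : ((H.T : ℕ) : ℝ) ≤ ((d ^ P * D' : ℕ) : ℝ) := by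
      exact_mod_cast standard_T_le (Λ := Λ) (κ := κ)
    push_cast at h1
    refine h1.trans (le_trans ?_ hx25)
    refine le_trans ?_ hε
    have h2 : (d : ℝ) ^ P ≤ (120000 ^ 2 * d) ^ P := by gcongr; nlinarith
    calc (d : ℝ) ^ P * D' ≤ (120000 ^ 2 * d) ^ P * D' := by gcongr
      _ ≤ 23040 ^ 2 * ((120000 ^ 2 * d) ^ P * D') :=
          le_mul_of_one_le_left (by positivity) (by norm_num)
      _ = _ := by ring
  · rw [hBcast]
    refine le_trans ?_ ((Nat.cast_le.2 (hDd p)).trans hdY)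
    refine le_trans ?_ (hsum p)
    have h1 := hl1 p; have h2 := hN1 p; have h3 := hJ1 p
    have h4 : (H.N p * H.J p : ℝ) ≤ H.l p * H.N p * H.J p := by
      have : (1 : ℝ) * (H.N p * H.J p) ≤ H.l p * (H.N p * H.J p) := by gcongr
      linarith
    have h5 : (0 : ℝ) ≤ H.N p * H.J p := by positivity
    nlinarith
  · refine le_trans ?_ ((Nat.cast_le.2 (hDd p)).trans hdY)
    refine le_trans ?_ (hsum p)
    have h1 := hl1 p; have h2 := hN1 p; have h3 := hJ1 p
    have h4 : (H.l p : ℝ) * 1 * 1 ≤ H.l p * H.N p * H.J p := by gcongr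
    nlinarith
  -- As √J ≤ x and 1/η ≤ 21x with x = 1/ε, the grid parameter is below 21x² + 1. This explains the
  -- fifth power in `hεΛ`, since 512 x² ≤ x⁵.
  · refine ⟨⌈√(H.J p) / H.η p⌉₊, Nat.ceil_pos.2 (div_pos (Real.sqrt_pos.2 (by
      have := hJ1 p; linarith)) (hηpos p)), ?_, ?_⟩
    · have h1 := Nat.le_ceil (√(H.J p) / H.η p)
      rw [div_le_iff₀ (hηpos p)] at h1
      linarith
    · have h1 := Nat.ceil_lt_add_one (div_nonneg (Real.sqrt_nonneg (H.J p)) (hηpos p).le)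
      have h2 : 1 / H.η p ≤ 21 * x := by
        rw [hηδ, one_div_div, div_le_iff₀ (hδ p)]
        have h3 := hεδ p hp
        calc 2000 * √(H.D p : ℝ) ≤ 21 * (96 * √(H.D p)) := by
              have := hsD p; linarith
          _ = 21 * x * (ε * (96 * √(H.D p))) := by
              rw [show 21 * x * (ε * (96 * √(H.D p : ℝ))) = 21 * (96 * √(H.D p)) * (ε * x) by ring, hεx,
                mul_one]
          _ ≤ _ := by gcongr
      have h3 : √(H.J p) ≤ x := by
        rw [Real.sqrt_le_left hx0.le]
        refine le_trans ?_ hd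
        refine le_trans ?_ ((hsum p).trans (Nat.cast_le.2 (hDd p)))
        have h1 := hl1 p; have h2 := hN1 p; have h3 := hJ1 p
        have h4 : 1 * 1 * (H.J p : ℝ) ≤ H.l p * H.N p * H.J p := by gcongr
        nlinarith
      have h4 : √(H.J p) / H.η p ≤ 21 * x ^ 2 := by
        rw [div_eq_mul_one_div]
        calc _ ≤ x * (21 * x) := mul_le_mul h3 h2 (one_div_pos.2 (hηpos p)).le hx0.le
          _ = _ := by ring
      have h5 : (8 : ℝ) ^ 3 * x ^ 2 ≤ x ^ 5 := by
        calc (8 : ℝ) ^ 3 * x ^ 2 ≤ x ^ 3 * x ^ 2 := by gcongr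
          _ = _ := by ring
      refine le_trans ?_ hεΛ
      nlinarith
  · have h1 := hJ1 p
    have h2 : (H.l p : ℝ) = 46080 * H.J p ^ 3 * Λ := by rw [hl p]; push_cast; ring
    unfold α
    rw [h2, show (46080 * (H.J p : ℝ) ^ 3 * Λ) * (1 / (48 * H.J p)) ^ 2 / 2 = 10 * H.J p * Λ by
      field_simp; norm_num]
    nlinarith
  · have hp' : p < P := hp
    have hJ' : H.J (p + 1) = 2560 * Λ * κ := by simp [hH, standard]
    have hDp : H.D p = d := by simp [hH, standard, hp']
    have h1 := le_two_mul_block_mul_N (P := P) hΛ hκ hD' hw p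
    rw [← hH, hb p, hDp] at h1
    have h2 : (d : ℝ) ≤ 2 * (1280 * Λ * (H.l p * H.J p) * H.N p) := by exact_mod_cast h1
    have h3 : (M : ℝ) ≤ κ * d := by exact_mod_cast hM
    have hκ1 : (1 : ℝ) ≤ κ := by exact_mod_cast hκ
    rw [hJ']
    push_cast
    have h4 : (2560 * 7 * Λ * Λ : ℝ) ≤ d := by
      have h5 : 2560 * 7 * Λ * Λ ≤ maxBlock Λ κ := by
        refine le_trans ?_ (block_le hΛ hκ 0)
        simp only [block, if_true]
        nlinarith
      exact_mod_cast h5.trans (hw.trans hD')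
    have h6 : (2560 * Λ * κ + 6 : ℝ) * Λ ≤ κ * d := by
      have h7 : (1 : ℝ) ≤ Λ * κ := by nlinarith
      calc (2560 * Λ * κ + 6 : ℝ) * Λ ≤ (2560 * 7 * Λ * κ) * Λ := by
            gcongr
            nlinarith
        _ = κ * (2560 * 7 * Λ * Λ) := by ring
        _ ≤ _ := by gcongr
    have h8 : (2 * κ * d : ℝ) ≤ 2 * (2560 * Λ * κ) * (H.l p * H.N p * H.J p) := by
      calc (2 * κ * d : ℝ) ≤ 2 * κ * (2 * (1280 * Λ * (H.l p * H.J p) * H.N p)) := by gcongr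
        _ = _ := by ring
    linarith
  · have h1 := hN1 H.P; have h2 := hJ1 H.P
    have h3 : (H.l H.P : ℝ) * 1 * 1 ≤ H.l H.P * H.N H.P * H.J H.P := by gcongr
    have h4 : (46080 * Λ : ℝ) ≤ H.l H.P := by
      have h5 : 46080 * Λ ≤ H.l H.P := by
        rw [hl]
        have h6 := Nat.one_le_pow 3 _ (hJ H.P)
        nlinarith [Nat.mul_le_mul_right Λ h6]
      exact_mod_cast h5
    linarith
  · have h1 := hsum H.P
    have h2 : (0 : ℝ) ≤ H.l H.P * H.N H.P * H.J H.P := by positivity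
    rw [hBcast]
    nlinarith
  -- Each level takes only a fraction 1/Λ of the budget, and there are at most Λ levels.
  · have h1 : ∀ p, (640 * Λ : ℝ) * (H.l p * (H.B p : ℕ)) ≤ d := by
      intro p
      rw [hBcast]
      have h2 := (hsum p).trans (Nat.cast_le.2 (hDd p))
      linarith
    have h2 : (Λ : ℝ) * (640 * ∑ p ∈ Finset.range (H.P + 1), (H.l p * (H.B p : ℕ) : ℝ)) ≤ Λ * d := by
      calc _ = ∑ p ∈ Finset.range (H.P + 1), (640 * Λ : ℝ) * (H.l p * (H.B p : ℕ)) := by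
            rw [← Finset.mul_sum]; ring
        _ ≤ ∑ p ∈ Finset.range (H.P + 1), (d : ℝ) := Finset.sum_le_sum fun p _ => h1 p
        _ = ((P + 1 : ℕ) : ℝ) * d := by simp [hH, standard]
        _ ≤ _ := by gcongr
    exact le_of_mul_le_mul_left h2 (by linarith)

end Standard

end Params

end

end Feasibility

namespace Feasibility

noncomputable section

theorem Algorithm.Solves.mono {d M : ℕ} {A : Algorithm d M} {ε q : ℝ} {T T' : ℕ}
    (h : A.Solves ε T q) (hT : T ≤ T') : A.Solves ε T' q := by
  intro F
  refine (h F).trans ?_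
  refine measureReal_mono ?_ (measure_ne_top _ _)
  rintro p ⟨t, ht, hx⟩
  exact ⟨t, ht.trans_le hT, hx⟩

/-! ### The number of queries -/

namespace Params

/-- Each level loses a factor of twice its block size. As `J 0 = 1`, the block of level 0 is free of
`K`, so `K ^ 4` is lost only P times. -/
theorem le_standard_T {Λ κ d P D' : ℕ} (hΛ : 0 < Λ) (hκ : 0 < κ) (hD' : D' ≤ d)
    (hw : maxBlock Λ κ ≤ D') {G K : ℝ} (h0 : 2 * (block Λ κ 0 : ℝ) ≤ G)
    (h1 : 2 * (maxBlock Λ κ : ℝ) ≤ G * K ^ 4) :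
    (d : ℝ) ^ P * D' ≤ (standard Λ κ d P D').T * (G ^ (P + 1) * (K ^ 4) ^ P) := by
  set H := standard Λ κ d P D' with hH
  have hN : ∀ p, (H.D p : ℝ) ≤ H.N p * (G * if p = 0 then 1 else K ^ 4) := by
    intro p
    have h2 : (H.D p : ℝ) ≤ 2 * (block Λ κ p * H.N p) := by
      exact_mod_cast le_two_mul_block_mul_N hΛ hκ hD' hw p
    have h3 : 2 * (block Λ κ p : ℝ) ≤ G * if p = 0 then 1 else K ^ 4 := by
      split_ifs with hp
      · rw [hp, mul_one]; exact h0
      · exact le_trans (by have := block_le hΛ hκ p; gcongr) h1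
    calc (H.D p : ℝ) ≤ H.N p * (2 * block Λ κ p) := by linarith
      _ ≤ _ := by gcongr
  have hD : ∏ p ∈ Finset.range (P + 1), (H.D p : ℝ) = d ^ P * D' := by
    rw [Finset.prod_range_succ]
    congr 1
    · rw [Finset.prod_congr rfl (g := fun _ => (d : ℝ)) fun p hp => by
        simp [hH, standard, Finset.mem_range.1 hp]]
      simp
    · simp [hH, standard]
  calc (d : ℝ) ^ P * D' = ∏ p ∈ Finset.range (P + 1), (H.D p : ℝ) := hD.symm
    _ ≤ ∏ p ∈ Finset.range (P + 1), (H.N p * (G * if p = 0 then 1 else K ^ 4) : ℝ) :=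
        Finset.prod_le_prod (fun _ _ => by positivity) fun p _ => hN p
    _ = ((∏ p ∈ Finset.range (P + 1), H.N p : ℕ) : ℝ) * (G ^ (P + 1) * (K ^ 4) ^ P) := by
        rw [Finset.prod_mul_distrib, Finset.prod_mul_distrib, Finset.prod_const, Finset.card_range,
          Finset.prod_range_succ' (fun p => if p = 0 then (1 : ℝ) else K ^ 4)]
        simp
    _ = _ := rfl

set_option maxHeartbeats 1000000 in
/-- The hard instances exist with a number of queries close to `ε⁻²`. -/
theorem exists_le_T_mul {d M : ℕ} [NeZero d] {ε L K : ℝ} (hε0 : 0 < ε) (hL : L = Real.log (1 / ε))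
    (hL0 : 10 ^ 28 ≤ L) (hd0 : Real.exp 1 ≤ d) (hd : (d : ℝ) ≤ (1 / ε) ^ 2) (hK : 1 ≤ K)
    (hM : (M : ℝ) ≤ K * d) (hKL : K ^ 4 * L ^ 28 ≤ d) :
    ∃ T n : ℕ, (d : ℝ) ^ n ≤ (1 / ε) ^ 2 ∧ (1 / ε) ^ 2 ≤ T * (K ^ 4 * L ^ 28) ^ n ∧
      ∀ A : Algorithm d M, ¬ A.Solves ε T (9 / 10) := by
  have hL1 : (1 : ℝ) ≤ L := le_trans (by norm_num) hL0
  set x : ℝ := 1 / ε with hx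
  have hx0 : 0 < x := by positivity
  have hexpL : Real.exp L = x := by rw [hL, Real.exp_log hx0]
  set Λ := ⌈5 * L⌉₊ with hΛdef
  set κ := ⌈K⌉₊ with hκdef
  have hΛ : 0 < Λ := Nat.ceil_pos.2 (by linarith)
  have hκ : 0 < κ := Nat.ceil_pos.2 (by linarith)
  have hΛle : 5 * L ≤ Λ := Nat.le_ceil _
  have hΛ6 : (Λ : ℝ) ≤ 6 * L := by
    have := Nat.ceil_lt_add_one (by linarith : 0 ≤ 5 * L)
    linarith
  have hκ2 : (κ : ℝ) ≤ 2 * K := by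
    have := Nat.ceil_lt_add_one (by linarith : 0 ≤ K)
    linarith
  have hMκ : M ≤ κ * d := by
    have h1 : (M : ℝ) ≤ κ * d := hM.trans (by have := Nat.le_ceil K; gcongr)
    exact_mod_cast h1
  set G : ℝ := L ^ 7 with hG
  have hG0 : 0 < G := by positivity
  have hLG : L ≤ G := by rw [hG]; exact le_self_pow₀ hL1 (by norm_num)
  have hG1 : 1 ≤ G := hL1.trans hLG
  have hK0 : 0 < K := by linarith
  have hK41 : 1 ≤ K ^ 4 := one_le_pow₀ hK
  have hb0 : 2 * (block Λ κ 0 : ℝ) ≤ G := by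
    have h1 : (block Λ κ 0 : ℝ) = 58982400 * (Λ : ℝ) ^ 2 := by
      simp only [block, if_true]; push_cast; ring
    rw [h1]
    calc 2 * (58982400 * (Λ : ℝ) ^ 2) ≤ 2 * (58982400 * (6 * L) ^ 2) := by gcongr
      _ = 4246732800 * L ^ 2 := by ring
      _ ≤ L * L ^ 2 := by gcongr; linarith
      _ = L ^ 3 := by ring
      _ ≤ G := pow_le_pow_right₀ hL1 (by norm_num)
  have hb1 : 2 * (maxBlock Λ κ : ℝ) ≤ G * K ^ 4 := by
    have h1 : (maxBlock Λ κ : ℝ) = 58982400 * 2560 ^ 4 * ((Λ : ℝ) ^ 6 * (κ : ℝ) ^ 4) := by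
      simp only [maxBlock]; push_cast; ring
    rw [h1]
    calc 2 * (58982400 * 2560 ^ 4 * ((Λ : ℝ) ^ 6 * (κ : ℝ) ^ 4))
        ≤ 2 * (58982400 * 2560 ^ 4 * ((6 * L) ^ 6 * (2 * K) ^ 4)) := by gcongr
      _ = (2 * 58982400 * 2560 ^ 4 * 6 ^ 6 * 2 ^ 4) * (L ^ 6 * K ^ 4) := by ring
      _ ≤ L * (L ^ 6 * K ^ 4) := by
          gcongr
          refine le_trans ?_ hL0
          norm_num
      _ = G * K ^ 4 := by rw [hG]; ring
  have hmBpos : 0 < maxBlock Λ κ := by unfold maxBlock; positivity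
  have hmB : (maxBlock Λ κ : ℝ) ≤ G * K ^ 4 := by
    have : (0 : ℝ) ≤ maxBlock Λ κ := by positivity
    linarith
  have hmBd : maxBlock Λ κ ≤ d := by
    have h1 : (maxBlock Λ κ : ℝ) ≤ d := by
      refine hmB.trans (le_trans ?_ hKL)
      rw [mul_comm]
      have : G ≤ L ^ 28 := pow_le_pow_right₀ hL1 (by norm_num)
      gcongr
    exact_mod_cast h1
  set a : ℝ := 23040 ^ 2 with ha
  set b : ℝ := 120000 ^ 2 with hb
  have haL : 2 * a ≤ L := le_trans (by rw [ha]; norm_num) hL0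
  have hbL : b ≤ L := le_trans (by rw [hb]; norm_num) hL0
  have haG : 2 * a ≤ G := haL.trans hLG
  have hbG : b ≤ G := hbL.trans hLG
  have ha1 : 1 ≤ a := by rw [ha]; norm_num
  have hb1' : 1 ≤ b := by rw [hb]; norm_num
  have hd1 : 1 < (d : ℝ) := by
    have := Real.add_one_lt_exp (one_ne_zero (α := ℝ)); linarith
  -- P is taken maximal such that a top level of the smallest admissible size `maxBlock` still fits
  -- above P full levels.
  have hex : ∃ n : ℕ, x ^ 2 < a * maxBlock Λ κ * (b * d) ^ n := by
    obtain ⟨n, hn⟩ := pow_unbounded_of_one_lt (x ^ 2) (by nlinarith : 1 < b * d)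
    refine ⟨n, hn.trans_le (le_mul_of_one_le_left (by positivity) ?_)⟩
    have : (1 : ℝ) ≤ maxBlock Λ κ := by exact_mod_cast hmBpos
    nlinarith
  classical
  have hfind0 : Nat.find hex ≠ 0 := by
    intro h0
    have h1 := Nat.find_spec hex
    rw [h0, pow_zero, mul_one] at h1
    refine absurd h1 (not_lt.2 ?_)
    refine le_trans ?_ hd
    refine le_trans ?_ hKL
    calc a * maxBlock Λ κ ≤ L * (G * K ^ 4) := by gcongr; linarith
      _ = K ^ 4 * L ^ 8 := by rw [hG]; ring
      _ ≤ _ := by gcongr; norm_num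
  obtain ⟨P, hPdef⟩ := Nat.exists_eq_succ_of_ne_zero hfind0
  have hP1 : x ^ 2 < a * maxBlock Λ κ * (b * d) ^ (P + 1) := by
    have := Nat.find_spec hex; rwa [hPdef] at this
  have hP0 : a * maxBlock Λ κ * (b * d) ^ P ≤ x ^ 2 := by
    have := Nat.find_min hex (m := P) (by omega); rwa [not_lt] at this
  have habP : 0 < a * (b * d) ^ P := by positivity
  set D' := min d ⌊x ^ 2 / (a * (b * d) ^ P)⌋₊ with hD'
  have hD'd : D' ≤ d := min_le_left _ _
  have hwf : maxBlock Λ κ ≤ ⌊x ^ 2 / (a * (b * d) ^ P)⌋₊ := by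
    refine Nat.le_floor ?_
    rw [le_div_iff₀ habP]
    linarith
  have hwD : maxBlock Λ κ ≤ D' := le_min hmBd hwf
  have hfl : a * (⌊x ^ 2 / (a * (b * d) ^ P)⌋₊ : ℝ) * (b * d) ^ P ≤ x ^ 2 := by
    have := Nat.floor_le (by positivity : 0 ≤ x ^ 2 / (a * (b * d) ^ P))
    rw [le_div_iff₀ habP] at this
    linarith
  have hεP : a * D' * (b * d) ^ P ≤ x ^ 2 := by
    refine le_trans ?_ hfl
    have : (D' : ℝ) ≤ ⌊x ^ 2 / (a * (b * d) ^ P)⌋₊ := by exact_mod_cast min_le_right _ _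
    gcongr
  have hdP : (d : ℝ) ^ P ≤ x ^ 2 := by
    refine le_trans ?_ hP0
    have h1 : (1 : ℝ) ≤ maxBlock Λ κ := by exact_mod_cast hmBpos
    have h2 : (1 : ℝ) ≤ a * maxBlock Λ κ := by nlinarith
    calc (d : ℝ) ^ P ≤ (b * d) ^ P := by gcongr; nlinarith
      _ ≤ _ := le_mul_of_one_le_left (by positivity) h2
  have hPΛ : P + 1 ≤ Λ := by
    have h1 : (Real.exp 1) ^ P ≤ Real.exp L ^ 2 := by
      rw [hexpL]; exact le_trans (by gcongr) hdP
    rw [← Real.exp_nat_mul, ← Real.exp_nat_mul, Real.exp_le_exp] at h1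
    push_cast at h1
    have h2 : ((P + 1 : ℕ) : ℝ) ≤ Λ := by push_cast; linarith
    exact_mod_cast h2
  have hεΛ : x ^ 5 ≤ Real.exp Λ := by
    rw [← hexpL, ← Real.exp_nat_mul]
    exact Real.exp_le_exp.2 (by push_cast; linarith)
  have hsuit := suitable_standard (P := P) hΛ hκ hMκ hε0 hεΛ hd hD'd hwD hPΛ hεP
  set T := (standard Λ κ d P D').T with hT
  have hTle := le_standard_T (P := P) hΛ hκ hD'd hwD hb0 hb1
  rw [← hT] at hTle
  have hZ : K ^ 4 * L ^ 28 = K ^ 4 * G ^ 4 := by rw [hG]; ring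
  have hnot : ∀ A : Algorithm d M, ¬ A.Solves ε T (9 / 10) := fun A => hsuit.not_solves A
  rw [hZ]
  have hT0 : (0 : ℝ) ≤ T := by positivity
  -- If the top level is capped at `d`, there are P + 1 full levels, and maximality of P bounds the
  -- loss. Otherwise D' nearly exhausts ε⁻², and P factors suffice; the witness is max P 1 so that
  -- the leftover powers of `G` are covered also for P = 0.
  rcases le_or_gt d ⌊x ^ 2 / (a * (b * d) ^ P)⌋₊ with hcase | hcase
  · have hD'eq : D' = d := min_eq_left hcase
    refine ⟨T, P + 1, ?_, ?_, hnot⟩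
    · refine le_trans ?_ hεP
      rw [hD'eq]
      calc (d : ℝ) ^ (P + 1) = d * d ^ P := by ring
        _ ≤ a * d * (b * d) ^ P := by
          have h1 : (d : ℝ) ^ P ≤ (b * d) ^ P := by gcongr; nlinarith
          have h2 : (d : ℝ) ≤ a * d := by nlinarith
          gcongr
    · rw [hD'eq] at hTle
      calc x ^ 2 ≤ a * (G * K ^ 4) * (b * d) ^ (P + 1) := by
            refine hP1.le.trans ?_; gcongr
        _ = (a * G * K ^ 4 * b ^ (P + 1)) * (d ^ P * d) := by rw [mul_pow]; ring
        _ ≤ (G * G * K ^ 4 * G ^ (P + 1)) * (T * (G ^ (P + 1) * (K ^ 4) ^ P)) := by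
            gcongr
            linarith
        _ = T * ((K ^ 4) ^ (P + 1) * G ^ (2 * P + 4)) := by ring
        _ ≤ T * ((K ^ 4) ^ (P + 1) * G ^ (4 * (P + 1))) := by
            gcongr
            omega
        _ = _ := by rw [mul_pow, pow_mul]
  · have hD'eq : D' = ⌊x ^ 2 / (a * (b * d) ^ P)⌋₊ := min_eq_right hcase.le
    have hX : x ^ 2 ≤ 2 * a * (b * d) ^ P * D' := by
      have h1 := Nat.lt_floor_add_one (x ^ 2 / (a * (b * d) ^ P))
      rw [← hD'eq, div_lt_iff₀ habP] at h1
      have h2 : (1 : ℝ) ≤ D' := by exact_mod_cast (by omega : 1 ≤ D')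
      nlinarith
    have hX' : x ^ 2 ≤ T * ((K ^ 4) ^ P * G ^ (2 * P + 2)) := by
      calc x ^ 2 ≤ 2 * a * (b * d) ^ P * D' := hX
        _ = (2 * a * b ^ P) * (d ^ P * D') := by rw [mul_pow]; ring
        _ ≤ (G * G ^ P) * (T * (G ^ (P + 1) * (K ^ 4) ^ P)) := by gcongr
        _ = _ := by ring
    refine ⟨T, max P 1, ?_, hX'.trans ?_, hnot⟩
    · rcases le_total P 1 with h | h
      · rw [max_eq_right h, pow_one]; exact hd
      · rw [max_eq_left h]; exact hdP
    · rw [mul_pow, ← pow_mul G]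
      gcongr
      · exact le_max_left _ _
      · omega

end Params

end

end Feasibility

namespace Feasibility

noncomputable section

open scoped ENNReal

/-! ### Packing bound for small memory -/

/-- Greedy choice: by volume, n balls of radius 3ε cannot cover the ball of radius 1/2. -/
theorem exists_separated {d : ℕ} {ε : ℝ} (hε : 0 < ε) (n : ℕ) (hn : n * (3 * ε) ^ d ≤ (1 / 2) ^ d) :
    ∃ c : Fin n → EuclideanSpace ℝ (Fin d), (∀ i, ‖c i‖ ≤ 1 / 2) ∧
      ∀ i j, i ≠ j → 2 * ε < ‖c i - c j‖ := by
  induction n with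
  | zero => exact ⟨fun i => i.elim0, fun i => i.elim0, fun i => i.elim0⟩
  | succ n ih =>
    have hlt : (n : ℝ) * (3 * ε) ^ d < (1 / 2) ^ d := by
      refine lt_of_lt_of_le ?_ hn
      push_cast
      have : (0 : ℝ) < (3 * ε) ^ d := by positivity
      linarith
    obtain ⟨c, hc1, hc2⟩ := ih hlt.le
    obtain ⟨x, hx1, hx2⟩ : ∃ x : EuclideanSpace ℝ (Fin d), ‖x‖ ≤ 1 / 2 ∧ ∀ i, 2 * ε < ‖x - c i‖ := by
      by_contra! hcon
      have hsub : Metric.closedBall (0 : EuclideanSpace ℝ (Fin d)) (1 / 2) ⊆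
          ⋃ i, Metric.closedBall (c i) (3 * ε) := by
        intro x hx
        obtain ⟨i, hi⟩ := hcon x (mem_closedBall_zero_iff.1 hx)
        refine Set.mem_iUnion.2 ⟨i, mem_closedBall_iff_norm.2 (hi.trans (by linarith))⟩
      have h1 := (measure_mono (μ := volume) hsub).trans (measure_iUnion_fintype_le _ _)
      simp_rw [Measure.addHaar_closedBall' volume _ (by positivity : 0 ≤ 3 * ε)] at h1
      rw [Measure.addHaar_closedBall' volume _ (by norm_num : (0 : ℝ) ≤ 1 / 2), Finset.sum_const,
        Finset.card_univ, Fintype.card_fin, nsmul_eq_mul, ← mul_assoc, finrank_euclideanSpace,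
        Fintype.card_fin, ← ENNReal.ofReal_natCast, ← ENNReal.ofReal_mul (by positivity)] at h1
      have hpos : volume (Metric.closedBall (0 : EuclideanSpace ℝ (Fin d)) 1) ≠ 0 :=
        (Metric.measure_closedBall_pos volume _ one_pos).ne'
      have h2 := (ENNReal.mul_le_mul_iff_left hpos measure_closedBall_lt_top.ne).1 h1
      rw [ENNReal.ofReal_le_ofReal_iff (by positivity)] at h2
      linarith
    refine ⟨Fin.snoc c x, fun i => ?_, fun i j => ?_⟩
    · refine Fin.lastCases ?_ (fun i => ?_) i
      · simpa using hx1
      · simpa using hc1 i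
    · refine Fin.lastCases ?_ (fun i => ?_) i <;> refine Fin.lastCases ?_ (fun j => ?_) j
      · intro h; exact absurd rfl h
      · intro _; simpa using hx2 j
      · intro _; simpa [norm_sub_rev] using hx2 i
      · intro h
        simpa using hc2 i j fun hij => h (by rw [hij])

open Classical in
/-- The problem whose feasible set is a ball. -/
def ballProblem {d : ℕ} {ε : ℝ} (c : EuclideanSpace ℝ (Fin d)) (hc : ‖c‖ + ε ≤ 1) :
    Problem d ε where
  Q := Metric.closedBall c ε
  convex := convex_closedBall _ _
  subset_ball := Metric.closedBall_subset_closedBall' (by rw [dist_zero_right]; linarith)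
  contains_ball := ⟨c, le_rfl⟩
  Ω := Unit
  law := Measure.dirac ()
  oracle _ _ x := if (x : EuclideanSpace ℝ (Fin d)) ∈ Metric.closedBall c ε then Response.success d
    else Sum.inl (x - c)
  measurable_oracle _ := by
    have h1 : Measurable fun p : Unit × Ball d => (p.2 : EuclideanSpace ℝ (Fin d)) :=
      measurable_subtype_coe.comp measurable_snd
    refine Measurable.ite (h1 Metric.isClosed_closedBall.measurableSet) measurable_const ?_
    exact measurable_inl.comp (h1.sub_const c)
  separates _ _ x := by
    beta_reduce
    split_ifs with h
    · exact ⟨fun _ => h, fun g hg => by simp at hg⟩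
    · refine ⟨fun h => by simp at h, fun g hg x' hx' => ?_⟩
      obtain rfl := Sum.inl_injective hg
      rw [mem_closedBall_iff_norm, not_le] at h
      rw [mem_closedBall_iff_norm] at hx'
      have h1 : x' - (x : EuclideanSpace ℝ (Fin d)) = (x' - c) - (x - c) := by abel
      rw [h1, inner_sub_right, real_inner_self_eq_norm_sq]
      have h2 := real_inner_le_norm ((x : EuclideanSpace ℝ (Fin d)) - c) (x' - c)
      have h3 : 0 ≤ ‖x' - c‖ := norm_nonneg _
      nlinarith

/-- An algorithm with `M` bits only makes `2 ^ M` different queries at each time. -/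
theorem Algorithm.Solves.card_le {d M T n : ℕ} {A : Algorithm d M} {ε q : ℝ}
    (h : A.Solves ε T q) (hε : ε ≤ 1 / 2) {c : Fin n → EuclideanSpace ℝ (Fin d)}
    (hc : ∀ i, ‖c i‖ ≤ 1 / 2) (hsep : ∀ i j, i ≠ j → 2 * ε < ‖c i - c j‖) :
    q * n ≤ T * 2 ^ M := by
  classical
  set ν := Measure.infinitePi A.seedLaw with hν
  -- All memory states are admitted, so this event does not depend on the oracle and contains
  -- success against every ball centred at `c i`.
  set hit : Fin n → Set (ℕ → A.Seed) := fun i => {s | ∃ t : Fin T, ∃ m : Memory M,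
    (A.query t (s t) m : EuclideanSpace ℝ (Fin d)) ∈ Metric.closedBall (c i) ε} with hhit
  have hm : ∀ i, MeasurableSet (hit i) := by
    intro i
    refine measurableSet_setOfPred.2 (Measurable.exists fun t => Measurable.exists fun m => ?_)
    have h0 : Measurable fun s : ℕ → A.Seed => (s t, m) :=
      (measurable_pi_apply (t : ℕ)).prodMk measurable_const
    have h1 := measurable_subtype_coe.comp ((A.measurable_query t).comp h0)
    exact measurableSet_setOfPred.1 (h1 (Metric.isClosed_closedBall (x := c i) (ε := ε)).measurableSet)
  have hq : ∀ i, q ≤ ν.real (hit i) := by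
    intro i
    refine (h (ballProblem (c i) (by linarith [hc i]))).trans ?_
    have h1 : ν.real (hit i) = (ν.prod (Measure.dirac ())).real (hit i ×ˢ Set.univ) := by
      rw [measureReal_prod_prod]; simp
    rw [h1]
    refine measureReal_mono ?_ (measure_ne_top _ _)
    rintro ⟨s, w⟩ ⟨t, ht, hx⟩
    exact ⟨⟨⟨t, ht⟩, _, hx⟩, trivial⟩
  have hcount : ∀ s, ∑ i, (hit i).indicator (fun _ => (1 : ℝ)) s ≤ T * 2 ^ M := by
    intro s
    have h1 : ∑ i, (hit i).indicator (fun _ => (1 : ℝ)) s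
        = ((Finset.univ.filter fun i => s ∈ hit i).card : ℝ) := by
      rw [Finset.card_filter]
      push_cast
      exact Finset.sum_congr rfl fun i _ => by simp [Set.indicator_apply]
    rw [h1]
    have h2 : ∀ i : {i // s ∈ hit i}, ∃ z : Fin T × Memory M,
        (A.query z.1 (s z.1) z.2 : EuclideanSpace ℝ (Fin d)) ∈ Metric.closedBall (c i) ε := by
      rintro ⟨i, t, m, htm⟩
      exact ⟨(t, m), htm⟩
    choose f hf using h2
    -- The balls are disjoint, so a pair of a time and a memory state, which determines a query,
    -- hits at most one of them.
    have h3 : (Finset.univ.filter fun i => s ∈ hit i).card ≤ Fintype.card (Fin T × Memory M) := by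
      rw [← Fintype.card_subtype]
      refine Fintype.card_le_of_injective f fun i j hij => ?_
      by_contra hne
      have hi := mem_closedBall_iff_norm.1 (hf i)
      have hj := mem_closedBall_iff_norm.1 (hf j)
      rw [← hij] at hj
      have h4 := norm_sub_le_norm_sub_add_norm_sub (c i)
        (A.query (f i).1 (s (f i).1) (f i).2 : EuclideanSpace ℝ (Fin d)) (c j)
      have h5 := norm_sub_rev (c i)
        (A.query (f i).1 (s (f i).1) (f i).2 : EuclideanSpace ℝ (Fin d))
      rw [h5] at h4
      linarith [hsep i j fun h => hne (Subtype.ext h)]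
    rw [Fintype.card_prod, Fintype.card_fin, Fintype.card_fun, Fintype.card_bool,
      Fintype.card_fin] at h3
    exact_mod_cast h3
  have hint : ∀ i, Integrable ((hit i).indicator fun _ => (1 : ℝ)) ν := fun i =>
    (integrable_const 1).indicator (hm i)
  calc q * n = ∑ _ : Fin n, q := by simp [mul_comm]
    _ ≤ ∑ i, ν.real (hit i) := Finset.sum_le_sum fun i _ => hq i
    _ = ∫ s, ∑ i, (hit i).indicator (fun _ => (1 : ℝ)) s ∂ν := by
        rw [integral_finsetSum _ fun i _ => hint i]
        refine Finset.sum_congr rfl fun i _ => ?_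
        rw [integral_indicator_const _ (hm i)]
        simp
    _ ≤ ∫ _, (T * 2 ^ M : ℝ) ∂ν :=
        integral_mono (integrable_finsetSum _ fun i _ => hint i) (integrable_const _) hcount
    _ = T * 2 ^ M := by simp

/-- Algorithms with at most one bit per dimension need many queries. -/
theorem Algorithm.Solves.pow_le {d M T : ℕ} {A : Algorithm d M} {ε : ℝ}
    (h : A.Solves ε T (9 / 10)) (hε0 : 0 < ε) (hε : 144 ≤ 1 / ε) (hd : 32 ≤ d) (hM : M ≤ d) :
    (1 / ε) ^ 14 ≤ T := by
  set x := 1 / ε with hx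
  have hεx : ε * x = 1 := by rw [hx]; field_simp
  have hx0 : 0 < x := by linarith
  have hεx' : ε = 1 / x := by rw [hx]; simp
  set n := ⌊(x / 6) ^ d⌋₊ with hn
  have hn1 : (n : ℝ) ≤ (x / 6) ^ d := Nat.floor_le (by positivity)
  have h1 : (n : ℝ) * (3 * ε) ^ d ≤ (1 / 2) ^ d := by
    calc (n : ℝ) * (3 * ε) ^ d ≤ (x / 6) ^ d * (3 * ε) ^ d := by gcongr
      _ = (1 / 2 * (ε * x)) ^ d := by rw [← mul_pow]; congr 1; ring
      _ = _ := by rw [hεx, mul_one]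
  obtain ⟨c, hc1, hc2⟩ := exists_separated hε0 n h1
  have hε2 : ε ≤ 1 / 2 := by
    rw [hεx']; exact one_div_le_one_div_of_le (by norm_num) (by linarith)
  have h2 := h.card_le hε2 hc1 hc2
  have h3 : (x / 6) ^ d ≤ 2 * n := by
    have h4 := Nat.lt_floor_add_one ((x / 6) ^ d)
    rw [← hn] at h4
    have h5 : (1 : ℝ) ≤ (x / 6) ^ d := one_le_pow₀ (by linarith)
    have h6 : 1 ≤ n := Nat.le_floor (by simpa using h5)
    have h7 : (1 : ℝ) ≤ n := by exact_mod_cast h6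
    linarith
  have h4 : (x / 12) ^ d * 2 ^ d = (x / 6) ^ d := by rw [← mul_pow]; congr 1; ring
  -- 144 ≤ x gives x ≤ (x/12)², and 32 ≤ d does the rest. Two of the 16 powers then absorb the
  -- factor 9/20.
  have h5 : x ^ 16 ≤ (x / 12) ^ d := by
    calc x ^ 16 ≤ ((x / 12) ^ 2) ^ 16 := by gcongr; nlinarith
      _ = (x / 12) ^ 32 := by ring
      _ ≤ (x / 12) ^ d := pow_le_pow_right₀ (by linarith) hd
  have h6 : (2 : ℝ) ^ M ≤ 2 ^ d := pow_le_pow_right₀ (by norm_num) hM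
  have h7 : 9 / 20 * (x / 12) ^ d * 2 ^ d ≤ T * 2 ^ d := by
    calc 9 / 20 * (x / 12) ^ d * 2 ^ d = 9 / 20 * (x / 6) ^ d := by rw [mul_assoc, h4]
      _ ≤ 9 / 10 * n := by linarith
      _ ≤ T * 2 ^ M := h2
      _ ≤ T * 2 ^ d := by gcongr
  have h8 := le_of_mul_le_mul_right h7 (by positivity)
  have h9 : 144 ^ 2 * x ^ 14 ≤ x ^ 16 := by
    calc (144 : ℝ) ^ 2 * x ^ 14 ≤ x ^ 2 * x ^ 14 := by gcongr
      _ = _ := by ring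
  have h10 : 0 < x ^ 14 := by positivity
  linarith

theorem Algorithm.Solves.pos {d M T : ℕ} {A : Algorithm d M} {ε : ℝ}
    (h : A.Solves ε T (9 / 10)) (hε : ε ≤ 1) : 1 ≤ T := by
  by_contra hT
  obtain rfl : T = 0 := by omega
  have h1 := h (ballProblem 0 (by simpa using hε))
  simp [Algorithm.successProb] at h1
  norm_num at h1

end

end Feasibility

namespace Feasibility

noncomputable section

/-! ### The exponents of the theorem -/

theorem log_le_two_mul_log_one_div {d : ℕ} {ε : ℝ} (hd : 1 ≤ d) (hε0 : 0 < ε)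
    (hε : ε ≤ 1 / Real.sqrt d) : Real.log d ≤ 2 * Real.log (1 / ε) := by
  have hd0 : (0 : ℝ) < d := by exact_mod_cast hd
  have h1 : Real.sqrt d ≤ 1 / ε := by
    rw [le_div_iff₀ (Real.sqrt_pos.2 hd0)] at hε
    rw [le_div_iff₀ hε0]
    linarith
  have h2 := Real.log_le_log (Real.sqrt_pos.2 hd0) h1
  rw [Real.log_sqrt hd0.le] at h2
  linarith

/-- The query lower bound for algorithms with `M ≤ exp k * d` bits. -/
theorem Algorithm.Solves.exp_le {d M T : ℕ} {A : Algorithm d M} {ε k : ℝ}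
    (h : A.Solves ε T (9 / 10)) (hd : Real.exp (2 * 10 ^ 28) ≤ d) (hε0 : 0 < ε)
    (hε : ε ≤ 1 / Real.sqrt d) (hk : 0 ≤ k) (hM : (M : ℝ) ≤ Real.exp k * d) :
    Real.exp (2 * Real.log (1 / ε)
      - 2 * Real.log (1 / ε) / Real.log d * (4 * k + 28 * Real.log (Real.log (1 / ε)))) ≤ T := by
  have hd0 : (0 : ℝ) < d := (Real.exp_pos _).trans_le hd
  have hd1 : 1 ≤ d := by exact_mod_cast hd0
  have : NeZero d := ⟨by omega⟩
  have hl : 2 * 10 ^ 28 ≤ Real.log d := (Real.le_log_iff_exp_le hd0).2 hd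
  have hlL := log_le_two_mul_log_one_div hd1 hε0 hε
  set L := Real.log (1 / ε) with hL
  set l := Real.log d with hldef
  have hL28 : 10 ^ 28 ≤ L := by linarith
  have hLpos : 0 < L := by linarith
  have hlpos : 0 < l := by linarith
  have hx : 1 / ε = Real.exp L := (Real.exp_log (by positivity)).symm
  have hdl : (d : ℝ) = Real.exp l := (Real.exp_log hd0).symm
  have hε1 : ε ≤ 1 := hε.trans (div_le_one_of_le₀ (Real.one_le_sqrt.2 (by exact_mod_cast hd1))
    (Real.sqrt_nonneg _))
  have hZ : Real.exp k ^ 4 * L ^ 28 = Real.exp (4 * k + 28 * Real.log L) := by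
    rw [Real.exp_add, ← Real.exp_nat_mul]
    congr 1
    rw [mul_comm (28 : ℝ), Real.exp_mul, Real.exp_log hLpos]
    norm_cast
  have hX : (1 / ε) ^ 2 = Real.exp (2 * L) := by
    rw [hx, ← Real.exp_nat_mul]; norm_num
  set z := 4 * k + 28 * Real.log L with hz
  have hz0 : 0 ≤ z := by
    have := Real.log_nonneg (by linarith : 1 ≤ L)
    positivity
  -- If z > ln d, the hard instance is not available, but the claimed bound is at most 1.
  rcases le_or_gt z l with hzl | hzl
  · obtain ⟨T', n, hn, hT', hnot⟩ := Params.exists_le_T_mul (M := M) hε0 hL hL28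
      ((Real.exp_le_exp.2 (by norm_num)).trans hd) (by rw [hX, hdl]; exact Real.exp_le_exp.2 hlL)
      (Real.one_le_exp hk) hM (by rw [hZ, hdl]; exact Real.exp_le_exp.2 hzl)
    rw [hX] at hn hT'
    rw [hZ, ← Real.exp_nat_mul] at hT'
    rw [hdl, ← Real.exp_nat_mul] at hn
    have hn' := Real.exp_le_exp.1 hn
    -- The loss occurs once for each factor `d` that fits into ε⁻².
    have hnR : (n : ℝ) ≤ 2 * L / l := (le_div_iff₀ hlpos).2 hn'
    have hTT : T' ≤ T := by
      by_contra! hlt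
      exact hnot A (h.mono hlt.le)
    have h1 : Real.exp (2 * L - n * z) ≤ T' := by
      rw [Real.exp_sub]
      exact (div_le_iff₀ (Real.exp_pos _)).2 hT'
    calc Real.exp (2 * L - 2 * L / l * z) ≤ Real.exp (2 * L - n * z) := by gcongr
      _ ≤ T' := h1
      _ ≤ T := by exact_mod_cast hTT
  · have h1 : 2 * L ≤ 2 * L / l * z := by
      rw [div_mul_eq_mul_div, le_div_iff₀ hlpos]
      gcongr
    calc Real.exp (2 * L - 2 * L / l * z) ≤ 1 := Real.exp_le_one_iff.2 (by linarith)
      _ ≤ T := by exact_mod_cast h.pos hε1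

/-- The two error terms of `phi` add up to ln ln(1/ε) / ln d, because ln(L/l) + ln l = ln L. -/
theorem one_div_rpow_phi {d M : ℕ} {ε C : ℝ} (hε0 : 0 < ε) (hd : 0 < Real.log d)
    (hL : 0 < Real.log (1 / ε)) :
    1 / ε ^ (2 * phi C d M ε) = Real.exp (2 * Real.log (1 / ε)
      - 2 * Real.log (1 / ε) / Real.log d
        * (4 * Real.log ((M : ℝ) / d) + C * Real.log (Real.log (1 / ε)))) := by
  rw [Real.rpow_def_of_pos hε0, one_div, ← Real.exp_neg, phi, Real.log_div hL.ne' hd.ne']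
  have h1 : Real.log ε = -Real.log (1 / ε) := by simp
  rw [h1]
  congr 1
  field_simp
  ring

/-- For M ≥ d the factor (d/M)² is at most 1. For M < d the target can exceed ε⁻², but with l = ln d
≤ 2L it is at most exp(2l + 10L) ≤ ε⁻¹⁴, within reach of the packing bound. -/
theorem Algorithm.Solves.phi_le {d M T : ℕ} {A : Algorithm d M} {ε : ℝ}
    (h : A.Solves ε T (9 / 10)) (hd : Real.exp (2 * 10 ^ 28) ≤ d) (hM : 1 ≤ M) (hε0 : 0 < ε)
    (hε : ε ≤ 1 / Real.sqrt d) :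
    ((d : ℝ) / M) ^ 2 * (1 / ε ^ (2 * phi 28 d M ε)) ≤ T := by
  have hd0 : (0 : ℝ) < d := (Real.exp_pos _).trans_le hd
  have hd1 : 1 ≤ d := by exact_mod_cast hd0
  have hM1 : (1 : ℝ) ≤ M := by exact_mod_cast hM
  have hl : 2 * 10 ^ 28 ≤ Real.log d := (Real.le_log_iff_exp_le hd0).2 hd
  have hlL := log_le_two_mul_log_one_div hd1 hε0 hε
  rw [one_div_rpow_phi hε0 (by linarith) (by linarith)]
  rcases le_or_gt (d : ℝ) M with hdM | hdM
  · have hK : 1 ≤ (M : ℝ) / d := (one_le_div hd0).2 hdM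
    have h1 := h.exp_le hd hε0 hε (Real.log_nonneg hK)
      (by rw [Real.exp_log (by linarith), div_mul_cancel₀ _ hd0.ne'])
    refine le_trans ?_ h1
    refine mul_le_of_le_one_left (Real.exp_pos _).le (pow_le_one₀ (by positivity) ?_)
    exact div_le_one_of_le₀ hdM (by positivity)
  · have hx : 1 / ε = Real.exp (Real.log (1 / ε)) := (Real.exp_log (by positivity)).symm
    set L := Real.log (1 / ε) with hL
    set l := Real.log d with hldef
    have hdl : (d : ℝ) = Real.exp l := (Real.exp_log hd0).symm
    have hx144 : 144 ≤ 1 / ε := by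
      have := Real.add_one_le_exp L
      rw [hx]; linarith
    have hd32 : (32 : ℝ) ≤ d := by
      have := Real.add_one_le_exp l
      rw [hdl]; linarith
    have h14 := h.pow_le hε0 hx144 (by exact_mod_cast hd32) (by exact_mod_cast hdM.le)
    refine le_trans ?_ h14
    rw [hx, ← Real.exp_nat_mul]
    have h2 : ((d : ℝ) / M) ^ 2 ≤ Real.exp (2 * l) := by
      calc ((d : ℝ) / M) ^ 2 ≤ d ^ 2 := by gcongr; exact div_le_self hd0.le hM1
        _ = Real.exp (2 * l) := by rw [hdl, ← Real.exp_nat_mul]; norm_num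
    have h3 : -l ≤ Real.log ((M : ℝ) / d) := by
      rw [Real.log_div (by positivity) hd0.ne']
      linarith [Real.log_nonneg hM1]
    have h4 : 0 ≤ Real.log L := Real.log_nonneg (by linarith)
    have hR : 0 ≤ 2 * L / l := div_nonneg (by linarith) (by linarith)
    have h5 : -(8 * L) ≤ 2 * L / l * (4 * Real.log ((M : ℝ) / d) + 28 * Real.log L) := by
      calc -(8 * L) = 2 * L / l * (4 * -l) := by field_simp; ring
        _ ≤ _ := by gcongr; linarith
    calc _ ≤ Real.exp (2 * l) * Real.exp (2 * L + 8 * L) := by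
          gcongr; linarith
      _ ≤ _ := by
          rw [← Real.exp_add]
          exact Real.exp_le_exp.2 (by push_cast; linarith)

/-- The parameter condition with a large constant forces the dimension to be large. -/
theorem le_dim_of_condition {D : ℝ} (hD : 0 < D) {d M : ℕ} {ε : ℝ} (hd : 2 ≤ d) (hM : 1 ≤ M)
    (hε0 : 0 < ε) (hε : ε ≤ 1 / Real.sqrt d)
    (h : 256 * D ^ 4 * ((M : ℝ) / d) * Real.log (1 / ε) ^ (3 + 1 / 4 : ℝ)
      ≤ (d : ℝ) ^ (1 / 4 : ℝ) * Real.log d ^ 2) : D ≤ d := by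
  have hd2 : (2 : ℝ) ≤ d := by exact_mod_cast hd
  have hd0 : (0 : ℝ) < d := by linarith
  have hM1 : (1 : ℝ) ≤ M := by exact_mod_cast hM
  have hL : 1 / 4 ≤ Real.log (1 / ε) := by
    have h1 := log_le_two_mul_log_one_div (by omega) hε0 hε
    have h2 := Real.log_le_log (by norm_num) hd2
    linarith [Real.log_two_gt_d9]
  have hLp : 1 / 256 ≤ Real.log (1 / ε) ^ (3 + 1 / 4 : ℝ) := by
    calc (1 / 256 : ℝ) = (1 / 4 : ℝ) ^ (4 : ℝ) := by norm_num
      _ ≤ (1 / 4 : ℝ) ^ (3 + 1 / 4 : ℝ) :=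
        Real.rpow_le_rpow_of_exponent_ge (by norm_num) (by norm_num) (by norm_num)
      _ ≤ _ := Real.rpow_le_rpow (by norm_num) hL (by norm_num)
  have h1 : (d : ℝ) ^ (1 / 4 : ℝ) * Real.log d ^ 2 ≤ d * d ^ 2 := by
    have h2 : (d : ℝ) ^ (1 / 4 : ℝ) ≤ d :=
      Real.rpow_le_self_of_one_le (by linarith) (by norm_num)
    have h3 : 0 ≤ Real.log d := Real.log_nonneg (by linarith)
    have h4 : Real.log d ≤ d := Real.log_le_self hd0.le
    gcongr
  have h2 : 256 * D ^ 4 * (1 / d) * (1 / 256)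
      ≤ 256 * D ^ 4 * ((M : ℝ) / d) * Real.log (1 / ε) ^ (3 + 1 / 4 : ℝ) := by gcongr
  -- Crude bounds on both sides: M ≥ 1 and ln(1/ε) ≥ 1/4 on the left, d^{1/4} ≤ d and ln d ≤ d on
  -- the right.
  have h3 : D ^ 4 / d ≤ d * d ^ 2 := by
    refine le_trans (le_of_eq ?_) (h2.trans (h.trans h1))
    field_simp
  rw [div_le_iff₀ hd0] at h3
  refine le_of_pow_le_pow_left₀ (n := 4) (by norm_num) hd0.le (h3.trans (le_of_eq (by ring)))

/-- The lower bound on ε says ln ln(1/ε) ≤ |a| ln d, so the loss of 28 ln ln(1/ε) per level costs 56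
|a| in the exponent of 1/ε. -/
theorem Algorithm.Solves.delta_le {d M T : ℕ} {A : Algorithm d M} {ε δ a : ℝ}
    (h : A.Solves ε T (9 / 10)) (hd : Real.exp (2 * 10 ^ 28) ≤ d)
    (hεa : Real.exp (-((d : ℝ) ^ a)) ≤ ε) (hε : ε ≤ 1 / Real.sqrt d) (hδ : 0 ≤ δ)
    (hM : (M : ℝ) ≤ (d : ℝ) ^ (1 + δ)) :
    1 / ((d : ℝ) ^ (2 * δ) * ε ^ (2 * (1 - 4 * δ) - 56 * |a|)) ≤ T := by
  have hε0 : 0 < ε := (Real.exp_pos _).trans_le hεa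
  have hd0 : (0 : ℝ) < d := (Real.exp_pos _).trans_le hd
  have hd1 : 1 ≤ d := by exact_mod_cast hd0
  have hl : 2 * 10 ^ 28 ≤ Real.log d := (Real.le_log_iff_exp_le hd0).2 hd
  have hlL := log_le_two_mul_log_one_div hd1 hε0 hε
  have hlog : Real.log ε = -Real.log (1 / ε) := by simp
  have h1 := h.exp_le (k := Real.log d * δ) hd hε0 hε (mul_nonneg (by linarith) hδ) (by
    rw [← Real.rpow_def_of_pos hd0, ← Real.rpow_add_one' hd0.le (by linarith), add_comm]
    exact hM)
  refine le_trans ?_ h1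
  have hLd : Real.log (1 / ε) ≤ (d : ℝ) ^ a := by
    have := (Real.le_log_iff_exp_le hε0).2 hεa
    linarith
  set L := Real.log (1 / ε) with hL
  have hLa : Real.log L ≤ Real.log d * |a| := by
    have h2 := Real.log_le_log (by linarith) hLd
    rw [Real.log_rpow hd0] at h2
    refine h2.trans ?_
    rw [mul_comm]
    exact mul_le_mul_of_nonneg_left (le_abs_self a) (by linarith)
  rw [Real.rpow_def_of_pos hd0, Real.rpow_def_of_pos hε0, ← Real.exp_add, one_div,
    ← Real.exp_neg, hlog]
  refine Real.exp_le_exp.2 ?_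
  set l := Real.log d with hldef
  have hR : 0 ≤ 2 * L / l := div_nonneg (by linarith) (by linarith)
  have h3 : 2 * L / l * (4 * (l * δ) + 28 * Real.log L)
      ≤ 2 * L / l * (4 * (l * δ) + 28 * (l * |a|)) := by gcongr
  have h4 : 2 * L / l * (4 * (l * δ) + 28 * (l * |a|)) = L * (8 * δ + 56 * |a|) := by
    field_simp; ring
  have h5 : 0 ≤ l * δ := mul_nonneg (by linarith) hδ
  linarith

end

end Feasibility

theorem theorem2 :
    (∃ c₆ : ℝ, 0 < c₆ ∧ ∃ C : ℝ, 0 < C ∧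
      ∀ (d M : ℕ) (ε : ℝ), 2 ≤ d → 1 ≤ M → 0 < ε → ε ≤ 1 / Real.sqrt d →
        c₆ * ((M : ℝ) / d) * Real.log (1 / ε) ^ (3 + 1 / 4 : ℝ)
          ≤ (d : ℝ) ^ (1 / 4 : ℝ) * Real.log d ^ 2 →
        ∀ (A : Feasibility.Algorithm d M) (T : ℕ), A.Solves ε T (9 / 10) →
          ((d : ℝ) / M) ^ 2 * (1 / ε ^ (2 * Feasibility.phi C d M ε)) ≤ (T : ℝ)) ∧
    (∀ a : ℕ → ℝ, Tendsto a atTop (𝓝 0) →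
      ∃ b : ℕ → ℝ, Tendsto b atTop (𝓝 0) ∧
        ∀ᶠ d : ℕ in atTop, ∀ ε : ℝ,
          Real.exp (-((d : ℝ) ^ a d)) ≤ ε → ε ≤ 1 / Real.sqrt d →
          ∀ δ ∈ Set.Icc (0 : ℝ) (1 / 4), ∀ M : ℕ, (M : ℝ) ≤ (d : ℝ) ^ (1 + δ) →
            ∀ (A : Feasibility.Algorithm d M) (T : ℕ), A.Solves ε T (9 / 10) →
              1 / ((d : ℝ) ^ (2 * δ) * ε ^ (2 * (1 - 4 * δ) - b d)) ≤ (T : ℝ)) := by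
  -- The constant is so large that the parameter condition forces d ≥ exp(2 · 10²⁸); nothing else is
  -- taken from that condition.
  refine ⟨⟨256 * Real.exp (2 * 10 ^ 28) ^ 4, by positivity, 28, by norm_num, ?_⟩, ?_⟩
  · intro d M ε hd hM hε0 hε hcond A T h
    exact h.phi_le (Feasibility.le_dim_of_condition (Real.exp_pos _) hd hM hε0 hε hcond) hM hε0 hε
  · intro a ha
    refine ⟨fun d => 56 * |a d|, by simpa using ha.abs.const_mul 56, ?_⟩
    filter_upwards [tendsto_natCast_atTop_atTop.eventually_ge_atTop (Real.exp (2 * 10 ^ 28))]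
      with d hd ε hεa hε δ hδ M hM A T h
    exact h.delta_le hd hεa hε hδ.1 hM
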